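/- Let $R$ be either a Gorenstein local ring with maximal ideal $\mathfrak m$, or a standard graded Gorenstein algebra over a field $K=[R]_0$ with irrelevant maximal ideal $\mathfrak m$. In the graded case all ideals and modules below are graded, all homomorphisms are homogeneous of degree $0$, and $[M(s)]_i=[M]_{i+s}$; in the local case all shifts $(s)$ are to be omitted. A finitely generated module is perfect if it is Cohen–Macaulay and has finite projective dimension. A perfect module $C$ of codimension $c=\dim R-\dim C$ is quasi-Gorenstein if there is an isomorphism $\alpha: C\to \operatorname{Ext}^c_R(C,R)(s)$ for some integer $s$. For such $C$ and a homomorphism $\varphi: C\to M$ whose image has the same dimension as $C$ (written $\varphi\in\operatorname{Epi}(C)$), let $L_C(\varphi): C\to \operatorname{Ext}^c_R(\ker\varphi,R)(s)$ be the composition of $\alpha$ with the map induced by the inclusion $\ker\varphi\subset C$. Two modules $M,N$ are module linked in one step by a quasi-Gorenstein module $C$ if there are $\varphi,\psi\in\operatorname{Epi}(C)$ with $M=\operatorname{im}\varphi$, $N=\operatorname{im}\psi$, $M\cong\operatorname{im}L_C(\psi)$ and $N\cong\operatorname{im}L_C(\varphi)$. Ideals $I,J$ of $R$ are sm-linked by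 an ideal $\mathfrak c$ if $R/I$ and $R/J$ are module linked in one step by $R/\mathfrak c$. An ideal $\mathfrak c$ is a Gorenstein ideal if $R/\mathfrak c$ is a perfect $R$-module and a Gorenstein ring; $I$ and $J$ are Gorenstein linked by $\mathfrak c$ if $\mathfrak c$ is a Gorenstein ideal, $\mathfrak c:I=J$ and $\mathfrak c:J=I$. Let $I,J$ be proper ideals and $\mathfrak c$ an ideal of $R$. Then $I$ and $J$ are sm-linked by $\mathfrak c$ if and only if $\mathfrak c$ is a Gorenstein ideal of $R$ and $$\mathfrak c:I=J\quad\text{and}\quad \mathfrak c:J=I,$$ that is, if and only if $I$ and $J$ are Gorenstein linked by $\mathfrak c$. Consequently, the equivalence relation on the proper ideals of $R$ generated by sm-linkage (submodule liaison inside $R$) is the same as the one generated by Gorenstein linkage (Gorenstein liaison). -/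

import Mathlib

open CategoryTheory CategoryTheory.Abelian

universe u v

noncomputable section

/-! ### Gorenstein rings -/

/-- A Gorenstein local ring: a Noetherian local ring of finite injective dimension over itself. -/
structure IsGorensteinLocalRing (A : Type u) [CommRing A] : Prop where
  isLocalRing : IsLocalRing A
  isNoetherianRing : IsNoetherianRing A
  finite_injectiveDimension : ∃ n : ℕ, HasInjectiveDimensionLE (ModuleCat.of A A) n

/-- A Gorenstein ring: a Noetherian ring whose localizations at maximal ideals are Gorenstein
local rings. -/
structure IsGorensteinRing (A : Type u) [CommRing A] : Prop where
  isNoetherianRing : IsNoetherianRing A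
  localization : ∀ (P : Ideal A) [P.IsMaximal], IsGorensteinLocalRing (Localization.AtPrime P)

section Modules

variable {R : Type u} [CommRing R]

/-! ### Perfect modules -/

/-- `codim M = dim R - dim M` is the natural number `c` (in particular `M ≠ 0`). -/
def HasCodim (R : Type u) [CommRing R] (M : Type u) [AddCommGroup M] [Module R M] (c : ℕ) : Prop :=
  (c : WithBot ℕ∞) + Module.supportDim R M = ringKrullDim R

/-- `M` is Cohen-Macaulay with respect to the (irrelevant) maximal ideal `𝔪`: there is an
`M`-regular sequence in `𝔪` of length `dim M`. -/
def IsCohenMacaulayModule (𝔪 : Ideal R) (M : Type u) [AddCommGroup M] [Module R M] : Prop :=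
  ∃ rs : List R, (∀ r ∈ rs, r ∈ 𝔪) ∧ RingTheory.Sequence.IsRegular M rs ∧
    (rs.length : WithBot ℕ∞) = Module.supportDim R M

/-- A perfect module: a finitely generated Cohen-Macaulay module of finite projective
dimension. -/
structure IsPerfectModule (𝔪 : Ideal R) (M : Type u) [AddCommGroup M] [Module R M] : Prop where
  finite : Module.Finite R M
  isCohenMacaulay : IsCohenMacaulayModule 𝔪 M
  finite_projectiveDimension : ∃ n : ℕ, HasProjectiveDimensionLE (ModuleCat.of R M) n

/-! ### The linking map -/

/-- The `R`-module `Ext^n_R(M, R)`. -/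
abbrev ExtRing (R : Type u) [CommRing R] (M : Type u) [AddCommGroup M] [Module R M] (n : ℕ) :
    Type u :=
  Ext (ModuleCat.of R M) (ModuleCat.of R R) n

/-- The map `Ext^n_R(N, R) → Ext^n_R(M, R)` induced by `f : M → N`. -/
def extRingMap {M N : Type u} [AddCommGroup M] [Module R M] [AddCommGroup N] [Module R N]
    (f : M →ₗ[R] N) (n : ℕ) : ExtRing R N n →ₗ[R] ExtRing R M n :=
  (Ext.mk₀ (ModuleCat.ofHom f)).precompOfLinear R (ModuleCat.of R R) (zero_add n)

variable {M N C : Type u} [AddCommGroup M] [Module R M] [AddCommGroup N] [Module R N]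
  [AddCommGroup C] [Module R C]

/-- `φ ∈ Epi(C)`: the image of `φ` has the same dimension as `C`. -/
def IsEpiFrom (φ : C →ₗ[R] M) : Prop :=
  Module.supportDim R (LinearMap.range φ) = Module.supportDim R C

/-- `L_C(φ) : C → Ext^c_R(ker φ, R)`, the composite of an isomorphism
`α : C ≃ Ext^c_R(C, R)` and the map `Ext^c_R(C, R) → Ext^c_R(ker φ, R)` induced by the inclusion
`ker φ → C`. -/
def linkingMap {c : ℕ} (α : C ≃ₗ[R] ExtRing R C c) (φ : C →ₗ[R] M) :
    C →ₗ[R] ExtRing R (LinearMap.ker φ) c :=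
  (extRingMap (LinearMap.ker φ).subtype c).comp α.toLinearMap

end Modules

/-! ### The local case -/

namespace LocalLiaison

variable {R : Type u} [CommRing R] [IsLocalRing R]

/-- A quasi-Gorenstein module: a perfect module isomorphic to its canonical module
`Ext^c_R(C, R)`, where `c = codim C`. -/
def IsQuasiGorenstein (R : Type u) [CommRing R] [IsLocalRing R]
    (C : Type u) [AddCommGroup C] [Module R C] : Prop :=
  IsPerfectModule (IsLocalRing.maximalIdeal R) C ∧
    ∃ c : ℕ, HasCodim R C c ∧ Nonempty (C ≃ₗ[R] ExtRing R C c)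

/-- `M` and `N` are module linked in one step by the quasi-Gorenstein module `C`. -/
def ModuleLinked (R : Type u) [CommRing R] [IsLocalRing R] (M N C : Type u)
    [AddCommGroup M] [Module R M] [AddCommGroup N] [Module R N]
    [AddCommGroup C] [Module R C] : Prop :=
  IsQuasiGorenstein R C ∧
    ∃ (c : ℕ) (_ : HasCodim R C c) (α : C ≃ₗ[R] ExtRing R C c)
      (φ : C →ₗ[R] M) (ψ : C →ₗ[R] N),
      IsEpiFrom φ ∧ IsEpiFrom ψ ∧ LinearMap.range φ = ⊤ ∧ LinearMap.range ψ = ⊤ ∧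
      Nonempty (M ≃ₗ[R] LinearMap.range (linkingMap α ψ)) ∧
      Nonempty (N ≃ₗ[R] LinearMap.range (linkingMap α φ))

/-- Submodules `M'`, `N'` of a free module `F` are sm-linked by the submodule `C'` if `F/M'` and
`F/N'` are module linked by `F/C'`. -/
def SmLinked {F : Type u} [AddCommGroup F] [Module R F] [Module.Free R F]
    (M' N' C' : Submodule R F) : Prop :=
  ModuleLinked R (F ⧸ M') (F ⧸ N') (F ⧸ C')

/-- A Gorenstein ideal: a perfect ideal whose residue class ring is a Gorenstein ring. -/
def IsGorensteinIdeal (c : Ideal R) : Prop :=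
  IsPerfectModule (IsLocalRing.maximalIdeal R) (R ⧸ c) ∧ IsGorensteinLocalRing (R ⧸ c)

/-- `I` and `J` are Gorenstein linked by `c`. -/
def GorensteinLinked (I J c : Ideal R) : Prop :=
  IsGorensteinIdeal c ∧ c.colon (I : Set R) = J ∧ c.colon (J : Set R) = I

/-- Submodule liaison inside `R`: the equivalence relation on proper ideals generated by
sm-linkage. -/
def SmLiaison : {I : Ideal R // I ≠ ⊤} → {I : Ideal R // I ≠ ⊤} → Prop :=
  Relation.EqvGen fun I J => ∃ c : Ideal R, SmLinked I.1 J.1 c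

/-- Gorenstein liaison: the equivalence relation on proper ideals generated by Gorenstein
linkage. -/
def GorensteinLiaison : {I : Ideal R // I ≠ ⊤} → {I : Ideal R // I ≠ ⊤} → Prop :=
  Relation.EqvGen fun I J => ∃ c : Ideal R, GorensteinLinked I.1 J.1 c

end LocalLiaison

/-! ### The graded case -/

namespace GradedLiaison

variable {K : Type v} [Field K] {R : Type u} [CommRing R] [Algebra K R]

/-- `R = ⨁ R_i` is a standard graded `K`-algebra: it lives in nonnegative degrees, `R_0 = K`
(the image of `K`), and `R` is generated by `R_1` as a `K`-algebra. -/
structure IsStandardGraded (𝒜 : ℤ → Submodule K R) [GradedAlgebra 𝒜] : Prop where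
  nontrivial : Nontrivial R
  neg : ∀ i < 0, 𝒜 i = ⊥
  zero : 𝒜 0 = 1
  generated : Algebra.adjoin K (𝒜 1 : Set R) = ⊤

/-- The irrelevant maximal ideal `⨁_{i > 0} R_i`. -/
def irrelevantIdeal (𝒜 : ℤ → Submodule K R) : Ideal R :=
  Ideal.span {x | ∃ i : ℤ, 0 < i ∧ x ∈ 𝒜 i}

/-- The subgroups `gr i` of `M` form a grading of the `R`-module `M`. -/
structure IsModuleGrading (𝒜 : ℤ → Submodule K R) {M : Type u} [AddCommGroup M] [Module R M]
    (gr : ℤ → AddSubgroup M) : Prop where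
  isInternal : DirectSum.IsInternal gr
  smul_mem : ∀ i j, ∀ r ∈ 𝒜 i, ∀ x ∈ gr j, r • x ∈ gr (i + j)

/-- The degree `j` part of `Ext^n_R(M, R)` for a graded module `M` (with grading `gr`).
For `n = 0` it consists of the homomorphisms `M → R` that are homogeneous of degree `j`. For
`n + 1` it consists of the images of the degree `j` elements of `Ext^n_R(N, R)` under the
connecting maps of all short exact sequences `0 → N → F → M → 0` of graded modules with
homomorphisms of degree `0`. -/
def IsHomogeneousExt (𝒜 : ℤ → Submodule K R) (j : ℤ) :
    (n : ℕ) → (M : ModuleCat.{u} R) → (ℤ → AddSubgroup M) → Ext M (ModuleCat.of R R) n → Prop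
  | 0, M, gr, e =>
      ∃ f : M ⟶ ModuleCat.of R R, e = Ext.mk₀ f ∧ ∀ i, ∀ x ∈ gr i, f.hom x ∈ 𝒜 (i + j)
  | n + 1, M, gr, e =>
      ∃ (N F : ModuleCat.{u} R) (grN : ℤ → AddSubgroup N) (grF : ℤ → AddSubgroup F)
        (f : N ⟶ F) (g : F ⟶ M) (w : f ≫ g = 0) (hS : (ShortComplex.mk f g w).ShortExact)
        (e' : Ext N (ModuleCat.of R R) n),
        IsModuleGrading 𝒜 grN ∧ IsModuleGrading 𝒜 grF ∧
        (∀ i, ∀ x ∈ grN i, f.hom x ∈ grF i) ∧ (∀ i, ∀ x ∈ grF i, g.hom x ∈ gr i) ∧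
        IsHomogeneousExt 𝒜 j n N grN e' ∧ e = hS.extClass.comp e' (add_comm 1 n)

/-- The grading of a (graded) submodule. -/
def subGrading {M : Type u} [AddCommGroup M] [Module R M] (gr : ℤ → AddSubgroup M)
    (P : Submodule R M) : ℤ → AddSubgroup P :=
  fun i => (gr i).comap P.subtype.toAddMonoidHom

/-- The grading of the quotient by a (graded) submodule. -/
def quotientGrading {M : Type u} [AddCommGroup M] [Module R M] (gr : ℤ → AddSubgroup M)
    (P : Submodule R M) : ℤ → AddSubgroup (M ⧸ P) :=
  fun i => (gr i).map P.mkQ.toAddMonoidHom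

/-- The isomorphism `α : C ≃ Ext^c_R(C, R)(s)` is homogeneous of degree `0`, where
`[M(s)]_i = [M]_{i + s}`. -/
def IsGradedDuality (𝒜 : ℤ → Submodule K R) {C : Type u} [AddCommGroup C] [Module R C]
    (grC : ℤ → AddSubgroup C) {c : ℕ} (s : ℤ) (α : C ≃ₗ[R] ExtRing R C c) : Prop :=
  ∀ i, ∀ x ∈ grC i, IsHomogeneousExt 𝒜 (i + s) c (ModuleCat.of R C) grC (α x)

/-- A graded quasi-Gorenstein module: a perfect graded module with a graded isomorphism to a
shift of its canonical module, that is, to `Ext^c_R(C, R)(s)` for some integer `s`, where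
`c = codim C`. -/
def IsQuasiGorenstein (𝒜 : ℤ → Submodule K R) {C : Type u} [AddCommGroup C] [Module R C]
    (grC : ℤ → AddSubgroup C) : Prop :=
  IsPerfectModule (irrelevantIdeal 𝒜) C ∧
    ∃ (c : ℕ) (s : ℤ) (α : C ≃ₗ[R] ExtRing R C c), HasCodim R C c ∧ IsGradedDuality 𝒜 grC s α

/-- There is a graded isomorphism (of degree `0`) from `N` to the image of
`L_C(φ) : C → Ext^c_R(ker φ, R)(s)`. -/
def IsoImageLinkingMap (𝒜 : ℤ → Submodule K R) {M N C : Type u}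
    [AddCommGroup M] [Module R M] [AddCommGroup N] [Module R N] [AddCommGroup C] [Module R C]
    (grN : ℤ → AddSubgroup N) (grC : ℤ → AddSubgroup C)
    {c : ℕ} (s : ℤ) (α : C ≃ₗ[R] ExtRing R C c) (φ : C →ₗ[R] M) : Prop :=
  ∃ e : N ≃ₗ[R] LinearMap.range (linkingMap α φ), ∀ i, ∀ x ∈ grN i,
    IsHomogeneousExt 𝒜 (i + s) c (ModuleCat.of R (LinearMap.ker φ))
      (subGrading grC (LinearMap.ker φ)) (e x).1

/-- The graded modules `M` and `N` are module linked in one step by the graded quasi-Gorenstein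
module `C` (all homomorphisms are homogeneous of degree `0`). -/
def ModuleLinked (𝒜 : ℤ → Submodule K R) {M N C : Type u}
    [AddCommGroup M] [Module R M] [AddCommGroup N] [Module R N] [AddCommGroup C] [Module R C]
    (grM : ℤ → AddSubgroup M) (grN : ℤ → AddSubgroup N) (grC : ℤ → AddSubgroup C) : Prop :=
  IsQuasiGorenstein 𝒜 grC ∧
    ∃ (c : ℕ) (s : ℤ) (α : C ≃ₗ[R] ExtRing R C c) (φ : C →ₗ[R] M) (ψ : C →ₗ[R] N),
      HasCodim R C c ∧ IsGradedDuality 𝒜 grC s α ∧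
      (∀ i, ∀ x ∈ grC i, φ x ∈ grM i) ∧ (∀ i, ∀ x ∈ grC i, ψ x ∈ grN i) ∧
      IsEpiFrom φ ∧ IsEpiFrom ψ ∧ LinearMap.range φ = ⊤ ∧ LinearMap.range ψ = ⊤ ∧
      IsoImageLinkingMap 𝒜 grM grC s α ψ ∧ IsoImageLinkingMap 𝒜 grN grC s α φ

/-- Graded submodules `M'`, `N'` of a graded free module `F` are sm-linked by the graded submodule
`C'` if `F/M'` and `F/N'` are module linked by `F/C'`. -/
def SmLinked (𝒜 : ℤ → Submodule K R) {F : Type u} [AddCommGroup F] [Module R F]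
    [Module.Free R F] (grF : ℤ → AddSubgroup F) (M' N' C' : Submodule R F) : Prop :=
  ModuleLinked 𝒜 (quotientGrading grF M') (quotientGrading grF N') (quotientGrading grF C')

/-- Homogeneous ideals `I`, `J` of `R` are sm-linked by the homogeneous ideal `c`, that is, as
graded submodules of the graded free module `R`. -/
def IdealsSmLinked (𝒜 : ℤ → Submodule K R) (I J c : Ideal R) : Prop :=
  SmLinked 𝒜 (fun i => (𝒜 i).toAddSubgroup) I J c

/-- A Gorenstein ideal: a perfect ideal whose residue class ring is a Gorenstein ring. -/
def IsGorensteinIdeal (𝒜 : ℤ → Submodule K R) (c : Ideal R) : Prop :=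
  IsPerfectModule (irrelevantIdeal 𝒜) (R ⧸ c) ∧ IsGorensteinRing (R ⧸ c)

/-- `I` and `J` are Gorenstein linked by `c`. -/
def GorensteinLinked (𝒜 : ℤ → Submodule K R) (I J c : Ideal R) : Prop :=
  IsGorensteinIdeal 𝒜 c ∧ c.colon (I : Set R) = J ∧ c.colon (J : Set R) = I

/-- The proper homogeneous ideals of `R`. -/
abbrev ProperHomogeneousIdeal (𝒜 : ℤ → Submodule K R) [GradedAlgebra 𝒜] : Type u :=
  {I : Ideal R // I.IsHomogeneous 𝒜 ∧ I ≠ ⊤}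

/-- Submodule liaison inside `R`: the equivalence relation on proper homogeneous ideals generated
by sm-linkage. -/
def SmLiaison (𝒜 : ℤ → Submodule K R) [GradedAlgebra 𝒜] :
    ProperHomogeneousIdeal 𝒜 → ProperHomogeneousIdeal 𝒜 → Prop :=
  Relation.EqvGen fun I J => ∃ c : Ideal R, c.IsHomogeneous 𝒜 ∧ IdealsSmLinked 𝒜 I.1 J.1 c

/-- Gorenstein liaison: the equivalence relation on proper homogeneous ideals generated by
Gorenstein linkage. -/
def GorensteinLiaison (𝒜 : ℤ → Submodule K R) [GradedAlgebra 𝒜] :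
    ProperHomogeneousIdeal 𝒜 → ProperHomogeneousIdeal 𝒜 → Prop :=
  Relation.EqvGen fun I J => ∃ c : Ideal R, c.IsHomogeneous 𝒜 ∧ GorensteinLinked 𝒜 I.1 J.1 c

end GradedLiaison

end

/-! Let `m` be the codimension of `R/c`. There are two independent points: which ideals the linking
map produces, and when `R/c` is quasi-Gorenstein.

For the first, a surjection `R/c → R/I` has kernel `I/c`. Since `Ext^j(R/c, R) = 0` for `j < m`, the
same holds for every finitely generated module killed by `c`, so a cover of `I/c` by a power of
`R/c` induces an injection on `Ext^m(-, R)`. Hence a class in `Ext^m(R/c, R)` restricts to zero on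
`I/c` exactly when `I` kills it (`pre_subtype_eq_zero_iff`). Through `α`, the kernel of the linking
map becomes `(c : I)/c` and its image `R/(c : I)`; comparing annihilators gives `c : I = J`.
Conversely the canonical projections realise the linkage. Their images have the right dimension
because the image of `J` in the Cohen-Macaulay module `R/c` is non-zero, hence of full dimension,
and is killed by `I = c : J`.

For the second, if `R/c ≅ Ext^m(R/c, R)`, then `Hom(R/c, -)` turns a finite injective resolution of
`R` into a complex of injective `R/c`-modules whose only cohomology is `R/c`; its exact initial part
splits off, so `R/c` has finite injective dimension (`exists_injectiveDimensionLE_quotient`). If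
`R/c` is Gorenstein, it has a simple socle modulo a maximal regular sequence. The self-duality of
such a cyclic module of dimension zero follows from a length count, and Nakayama lifts it along the
regular sequence (`nonempty_equiv_ext`). Both directions rest on the fact that over a Gorenstein
local ring `Ext^i(k, R) ≠ 0` only for `i = dim R` (`ext_residueField_nontrivial_iff`).

The graded case is reduced to the localization at the irrelevant ideal `𝔪`: Ext commutes with
localization, graded modules satisfy Nakayama's lemma at `𝔪` (`le_of_locally_le`), and `dim R` is
the height of `𝔪`. A generator of the localized canonical module has a homogeneous component that
still generates, and its degree is the shift `s`. -/

/-! ### Ext modules and their long exact sequences -/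

namespace ExtModule

noncomputable section

variable (R : Type u) [CommRing R]

/-- The `R`-module `Ext^n_R(M, N)`. -/
abbrev ExtMod (M N : Type u) [AddCommGroup M] [Module R M] [AddCommGroup N] [Module R N]
    (n : ℕ) : Type u :=
  Ext (ModuleCat.of R M) (ModuleCat.of R N) n

variable {R}
variable {M M₁ M₂ M₃ N N₁ N₂ N₃ : Type u}
  [AddCommGroup M] [Module R M] [AddCommGroup M₁] [Module R M₁]
  [AddCommGroup M₂] [Module R M₂] [AddCommGroup M₃] [Module R M₃]
  [AddCommGroup N] [Module R N] [AddCommGroup N₁] [Module R N₁]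
  [AddCommGroup N₂] [Module R N₂] [AddCommGroup N₃] [Module R N₃]

/-- Restriction `Ext^n(M₂, N) → Ext^n(M₁, N)` along `f : M₁ → M₂`. -/
def pre (N : Type u) [AddCommGroup N] [Module R N] (f : M₁ →ₗ[R] M₂) (n : ℕ) :
    ExtMod R M₂ N n →ₗ[R] ExtMod R M₁ N n :=
  (Ext.mk₀ (ModuleCat.ofHom f)).precompOfLinear R (ModuleCat.of R N) (zero_add n)

/-- The map `Ext^n(M, N₁) → Ext^n(M, N₂)` induced by `f : N₁ → N₂`. -/
def post (M : Type u) [AddCommGroup M] [Module R M] (f : N₁ →ₗ[R] N₂) (n : ℕ) :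
    ExtMod R M N₁ n →ₗ[R] ExtMod R M N₂ n :=
  (Ext.mk₀ (ModuleCat.ofHom f)).postcompOfLinear R (ModuleCat.of R M) (add_zero n)

lemma pre_apply (f : M₁ →ₗ[R] M₂) (n : ℕ) (e : ExtMod R M₂ N n) :
    pre N f n e = (Ext.mk₀ (ModuleCat.ofHom f)).comp e (zero_add n) := rfl

lemma post_apply (f : N₁ →ₗ[R] N₂) (n : ℕ) (e : ExtMod R M N₁ n) :
    post M f n e = e.comp (Ext.mk₀ (ModuleCat.ofHom f)) (add_zero n) := rfl

lemma pre_comp_apply (f : M₁ →ₗ[R] M₂) (g : M₂ →ₗ[R] M₃) (n : ℕ) (e : ExtMod R M₃ N n) :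
    pre N (g ∘ₗ f) n e = pre N f n (pre N g n e) := by
  simp only [pre_apply, ModuleCat.ofHom_comp, Ext.mk₀_comp_mk₀_assoc]

lemma pre_smul_id (r : R) (n : ℕ) (e : ExtMod R M N n) :
    pre N (r • LinearMap.id) n e = r • e := by
  have : ModuleCat.ofHom (r • (LinearMap.id : M →ₗ[R] M)) = r • 𝟙 (ModuleCat.of R M) := rfl
  rw [pre_apply, this, Ext.mk₀_smul, Ext.smul_comp, Ext.mk₀_id_comp]

lemma post_smul_id (r : R) (n : ℕ) (e : ExtMod R M N n) :
    post M (r • LinearMap.id) n e = r • e := by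
  have : ModuleCat.ofHom (r • (LinearMap.id : N →ₗ[R] N)) = r • 𝟙 (ModuleCat.of R N) := rfl
  rw [post_apply, this, Ext.mk₀_smul, Ext.comp_smul, Ext.comp_mk₀_id]

lemma pre_id (n : ℕ) (e : ExtMod R M N n) : pre N (LinearMap.id : M →ₗ[R] M) n e = e := by
  simpa using pre_smul_id (1 : R) n e

lemma pre_zero (n : ℕ) (e : ExtMod R M₂ N n) : pre N (0 : M₁ →ₗ[R] M₂) n e = 0 := by
  have : ModuleCat.ofHom (0 : M₁ →ₗ[R] M₂) = 0 := rfl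
  rw [pre_apply, this, Ext.mk₀_zero, Ext.zero_comp]

lemma pre_add (f g : M₁ →ₗ[R] M₂) (n : ℕ) (e : ExtMod R M₂ N n) :
    pre N (f + g) n e = pre N f n e + pre N g n e := by
  have : ModuleCat.ofHom (f + g) = ModuleCat.ofHom f + ModuleCat.ofHom g := rfl
  rw [pre_apply, this, Ext.mk₀_add, Ext.add_comp]; rfl

lemma pre_sum {ι : Type*} (s : Finset ι) (f : ι → M₁ →ₗ[R] M₂) (n : ℕ) (e : ExtMod R M₂ N n) :
    pre N (∑ i ∈ s, f i) n e = ∑ i ∈ s, pre N (f i) n e := by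
  classical
  induction s using Finset.induction_on with
  | empty => simpa using pre_zero n e
  | insert a s ha ih => rw [Finset.sum_insert ha, Finset.sum_insert ha, pre_add, ih]

/-- Isomorphic modules have isomorphic Ext modules. -/
def preEquiv (N : Type u) [AddCommGroup N] [Module R N] (f : M₁ ≃ₗ[R] M₂) (n : ℕ) :
    ExtMod R M₂ N n ≃ₗ[R] ExtMod R M₁ N n :=
  LinearEquiv.ofLinearMap (pre N f.toLinearMap n) (pre N f.symm.toLinearMap n)
    (by ext e; simp [← pre_comp_apply, pre_id])
    (by ext e; simp [← pre_comp_apply, pre_id])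

/-- Scalars act on Ext through the first variable, so annihilators of `M` pass to all of its Ext
modules. -/
lemma smul_eq_zero_of_left (r : R) (hr : ∀ m : M, r • m = 0) (n : ℕ) (e : ExtMod R M N n) :
    r • e = 0 := by
  have : r • (LinearMap.id : M →ₗ[R] M) = 0 := by ext m; simpa using hr m
  rw [← pre_smul_id, this, pre_zero]

lemma subsingleton_of_left [Subsingleton M] (n : ℕ) : Subsingleton (ExtMod R M N n) :=
  subsingleton_of_forall_eq 0 fun e => by
    simpa using smul_eq_zero_of_left (1 : R) (fun m => Subsingleton.elim _ _) n e

/-- `Ext^0` is `Hom`. -/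
def homEquiv (M N : Type u) [AddCommGroup M] [Module R M] [AddCommGroup N] [Module R N] :
    ExtMod R M N 0 ≃ₗ[R] (M →ₗ[R] N) :=
  Ext.linearEquiv₀.trans ModuleCat.homLinearEquiv

lemma homEquiv_symm_apply (f : M →ₗ[R] N) :
    (homEquiv M N).symm f = Ext.mk₀ (ModuleCat.ofHom f) := rfl

lemma pre_homEquiv_symm (f : M₁ →ₗ[R] M₂) (g : M₂ →ₗ[R] N) :
    pre N f 0 ((homEquiv M₂ N).symm g) = (homEquiv M₁ N).symm (g ∘ₗ f) := by
  rw [homEquiv_symm_apply, homEquiv_symm_apply, pre_apply, Ext.mk₀_comp_mk₀, ModuleCat.ofHom_comp]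

lemma homEquiv_pre (f : M₁ →ₗ[R] M₂) (e : ExtMod R M₂ N 0) :
    homEquiv M₁ N (pre N f 0 e) = homEquiv M₂ N e ∘ₗ f := by
  obtain ⟨g, rfl⟩ := (homEquiv M₂ N).symm.surjective e
  rw [pre_homEquiv_symm]; simp

lemma homEquiv_post (f : N₁ →ₗ[R] N₂) (e : ExtMod R M N₁ 0) :
    homEquiv M N₂ (post M f 0 e) = f ∘ₗ homEquiv M N₁ e := by
  obtain ⟨g, rfl⟩ := (homEquiv M N₁).symm.surjective e
  apply (homEquiv M N₂).symm.injective
  simp only [LinearEquiv.symm_apply_apply, LinearEquiv.apply_symm_apply]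
  rw [homEquiv_symm_apply, homEquiv_symm_apply, post_apply, Ext.mk₀_comp_mk₀, ModuleCat.ofHom_comp]

lemma pre_injective_zero {g : M₂ →ₗ[R] M₃} (hg : Function.Surjective g) : Function.Injective (pre N g 0) := by
  rw [← LinearMap.ker_eq_bot, LinearMap.ker_eq_bot']
  intro e he
  apply (homEquiv M₃ N).injective
  have := congrArg (homEquiv M₂ N) he
  rw [homEquiv_pre, map_zero] at this
  rw [map_zero]
  ext x
  obtain ⟨y, rfl⟩ := hg x
  exact LinearMap.congr_fun this y

variable {f : M₁ →ₗ[R] M₂} {g : M₂ →ₗ[R] M₃}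

lemma shortExact (hf : Function.Injective f) (hg : Function.Surjective g)
    (h : Function.Exact f g) :
    (ShortComplex.mk (ModuleCat.ofHom f) (ModuleCat.ofHom g)
      (by rw [← ModuleCat.ofHom_comp, h.linearMap_comp_eq_zero]; rfl)).ShortExact :=
  ModuleCat.shortComplex_shortExact _ h hf hg

/-- The connecting map in the first variable. -/
def preδ (N : Type u) [AddCommGroup N] [Module R N] (hf : Function.Injective f)
    (hg : Function.Surjective g) (h : Function.Exact f g) (n : ℕ) :
    ExtMod R M₁ N n →ₗ[R] ExtMod R M₃ N (n + 1) :=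
  (shortExact hf hg h).extClass.precompOfLinear R (ModuleCat.of R N) (add_comm 1 n)

/-- The connecting map in the second variable. -/
def postδ {f : N₁ →ₗ[R] N₂} {g : N₂ →ₗ[R] N₃} (M : Type u) [AddCommGroup M] [Module R M]
    (hf : Function.Injective f) (hg : Function.Surjective g) (h : Function.Exact f g) (n : ℕ) :
    ExtMod R M N₃ n →ₗ[R] ExtMod R M N₁ (n + 1) :=
  (shortExact hf hg h).extClass.postcompOfLinear R (ModuleCat.of R M) rfl

section

variable (hf : Function.Injective f) (hg : Function.Surjective g) (h : Function.Exact f g)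
include hf hg h

lemma pre_exact (n : ℕ) : Function.Exact (pre N g n) (pre N f n) := by
  intro e
  refine ⟨fun he => ?_, ?_⟩
  · exact Ext.contravariant_sequence_exact₂ (shortExact hf hg h) _ e he
  · rintro ⟨e, rfl⟩
    rw [← pre_comp_apply, h.linearMap_comp_eq_zero, pre_zero]

lemma pre_preδ_exact (n : ℕ) : Function.Exact (pre N f n) (preδ N hf hg h n) := by
  intro e
  refine ⟨fun he => ?_, ?_⟩
  · exact Ext.contravariant_sequence_exact₁ (shortExact hf hg h) _ e (add_comm 1 n) he
  · rintro ⟨e, rfl⟩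
    exact (shortExact hf hg h).extClass_comp_assoc (γ := e) (h := add_comm 1 n)

lemma preδ_pre_exact (n : ℕ) : Function.Exact (preδ N hf hg h n) (pre N g (n + 1)) := by
  intro e
  refine ⟨fun he => ?_, ?_⟩
  · exact Ext.contravariant_sequence_exact₃ (shortExact hf hg h) _ e he (add_comm 1 n)
  · rintro ⟨e, rfl⟩
    exact (shortExact hf hg h).comp_extClass_assoc e (add_comm 1 n)

end

section

variable {f : N₁ →ₗ[R] N₂} {g : N₂ →ₗ[R] N₃}
  (hf : Function.Injective f) (hg : Function.Surjective g) (h : Function.Exact f g)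
include hf hg h

lemma post_postδ_exact (n : ℕ) : Function.Exact (post M g n) (postδ M hf hg h n) := by
  intro e
  refine ⟨fun he => ?_, ?_⟩
  · exact Ext.covariant_sequence_exact₃ _ (shortExact hf hg h) e rfl he
  · rintro ⟨e, rfl⟩
    change (e.comp (Ext.mk₀ _) (add_zero n)).comp (shortExact hf hg h).extClass rfl = 0
    rw [Ext.comp_assoc_of_second_deg_zero, (shortExact hf hg h).comp_extClass, Ext.comp_zero]

lemma postδ_post_exact (n : ℕ) : Function.Exact (postδ M hf hg h n) (post M f (n + 1)) := by
  intro e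
  refine ⟨fun he => ?_, ?_⟩
  · exact Ext.covariant_sequence_exact₁ _ (shortExact hf hg h) e he rfl
  · rintro ⟨e, rfl⟩
    change (e.comp (shortExact hf hg h).extClass rfl).comp (Ext.mk₀ _) (add_zero _) = 0
    rw [Ext.comp_assoc_of_third_deg_zero, (shortExact hf hg h).extClass_comp, Ext.comp_zero]

end

lemma subsingleton_of_injDim {n : ℕ} (h : HasInjectiveDimensionLE (ModuleCat.of R N) n) {i : ℕ}
    (hi : n < i) : Subsingleton (ExtMod R M N i) :=
  HasInjectiveDimensionLT.subsingleton _ (n + 1) i hi _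

lemma subsingleton_of_free [Module.Projective R M] {i : ℕ} (hi : 0 < i) :
    Subsingleton (ExtMod R M N i) := by
  obtain ⟨i, rfl⟩ := Nat.exists_eq_succ_of_ne_zero hi.ne'
  have : Projective (ModuleCat.of R M) := ModuleCat.projective_of_categoryTheory_projective _
  exact Ext.subsingleton_of_projective (ModuleCat.of R M) (ModuleCat.of R N) i

end

end ExtModule


/-! ### Supports of Ext modules -/

namespace ExtModule

open scoped Pointwise

variable {R : Type u} [CommRing R]
variable {M N : Type u} [AddCommGroup M] [Module R M] [AddCommGroup N] [Module R N]

/-- The long exact sequence of multiplication by an `M`-regular element. -/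
lemma exists_connecting {x : R} (hx : IsSMulRegular M x) (n : ℕ) :
    ∃ δ : ExtMod R M N n →ₗ[R] ExtMod R (QuotSMulTop x M) N (n + 1),
      (∀ e, δ e = 0 ↔ ∃ e', x • e' = e) ∧
      Function.Exact δ (pre N (Submodule.mkQ (x • (⊤ : Submodule R M))) (n + 1)) ∧
      (∀ e : ExtMod R M N (n + 1), x • e = 0 ↔
        ∃ e', pre N (Submodule.mkQ (x • (⊤ : Submodule R M))) (n + 1) e' = e) := by
  have hf : Function.Injective (x • (LinearMap.id : M →ₗ[R] M)) := hx
  have hg := Submodule.mkQ_surjective (x • (⊤ : Submodule R M))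
  have h : Function.Exact (x • (LinearMap.id : M →ₗ[R] M))
      (Submodule.mkQ (x • (⊤ : Submodule R M))) := LinearMap.exact_lsmul_mkQ_smul_top M x
  refine ⟨preδ N hf hg h n, fun e => ?_, preδ_pre_exact hf hg h n, fun e => ?_⟩
  · rw [pre_preδ_exact hf hg h n e]
    simp [pre_smul_id]
  · have := pre_exact (N := N) hf hg h (n + 1) e
    rw [pre_smul_id] at this
    exact this

lemma exists_injective_of_isAssociatedPrime [IsNoetherianRing R] {p : Ideal R}
    (hp : IsAssociatedPrime p M) : ∃ f : (R ⧸ p) →ₗ[R] M, Function.Injective f := by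
  obtain ⟨-, x, rfl⟩ := isAssociatedPrime_iff.mp hp
  have hker : LinearMap.ker (LinearMap.toSpanSingleton R M x) = (⊥ : Submodule R M).colon {x} := by
    ext r; simp [Submodule.mem_colon_singleton]
  refine ⟨Submodule.liftQ _ (LinearMap.toSpanSingleton R M x) hker.ge, ?_⟩
  rw [← LinearMap.ker_eq_bot, Submodule.ker_liftQ_eq_bot']
  exact hker.symm

lemma mem_support_or_of_exact {M₁ M₂ M₃ : Type*} [AddCommGroup M₁] [Module R M₁]
    [AddCommGroup M₂] [Module R M₂] [AddCommGroup M₃] [Module R M₃]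
    {f : M₁ →ₗ[R] M₂} {g : M₂ →ₗ[R] M₃} (h : Function.Exact f g) {q : PrimeSpectrum R}
    (hq : q ∈ Module.support R M₂) : q ∈ Module.support R M₁ ∨ q ∈ Module.support R M₃ := by
  by_contra! hc
  rw [Module.notMem_support_iff', Module.notMem_support_iff'] at hc
  refine (Module.notMem_support_iff'.mpr fun m => ?_) hq
  obtain ⟨s, hs, hsm⟩ := hc.2 (g m)
  rw [← map_smul] at hsm
  obtain ⟨m₁, hm₁⟩ := (h _).mp hsm
  obtain ⟨t, ht, htm⟩ := hc.1 m₁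
  refine ⟨t * s, fun hts => (q.2.mem_or_mem hts).elim ht hs, ?_⟩
  rw [mul_smul, ← hm₁, ← map_smul, htm, map_zero]

/-- A prime in the support of `Ext^i(M, N)` is in the support of `Ext^i(R/p, N)` for some prime
`p` in the support of `M`. -/
lemma exists_prime_of_mem_support [IsNoetherianRing R] (N : Type u) [AddCommGroup N] [Module R N]
    (M : Type u) [AddCommGroup M] [Module R M] [hM : Module.Finite R M] (i : ℕ)
    (q : PrimeSpectrum R) (hq : q ∈ Module.support R (ExtMod R M N i)) :
    ∃ p ∈ Module.support R M, p ≤ q ∧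
      q ∈ Module.support R (ExtMod R (R ⧸ p.asIdeal) N i) := by
  revert hq
  -- Dévissage along a filtration with factors `R/p`; exactness in the middle is all that the
  -- support needs.
  induction hM using IsNoetherianRing.induction_on_isQuotientEquivQuotientPrime R with
  | subsingleton M =>
    intro hq
    have := subsingleton_of_left (R := R) (M := M) (N := N) i
    rw [Module.support_eq_empty] at hq
    exact hq.elim
  | quotient M p e =>
    intro hq
    rw [← (preEquiv N e i).support_eq] at hq
    refine ⟨p, ?_, ?_, hq⟩
    · rw [e.support_eq, Module.mem_support_iff_of_finite, Ideal.annihilator_quotient]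
    · change p.asIdeal ≤ q.asIdeal
      refine le_trans (fun r hr => ?_) (Module.annihilator_le_of_mem_support hq)
      rw [Module.mem_annihilator]
      refine smul_eq_zero_of_left r (fun m => ?_) i
      obtain ⟨m, rfl⟩ := Ideal.Quotient.mk_surjective m
      rw [← Ideal.Quotient.mk_eq_mk, ← Submodule.Quotient.mk_smul]
      exact (Submodule.Quotient.mk_eq_zero _).mpr (Ideal.mul_mem_right _ _ hr)
  | exact M₁ M₂ M₃ f g hf hg h h₁ h₃ =>
    intro hq
    rcases mem_support_or_of_exact (pre_exact hf hg h i) hq with hq | hq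
    · obtain ⟨p, hp, hpq⟩ := h₃ hq
      exact ⟨p, Module.support_subset_of_surjective g hg hp, hpq⟩
    · obtain ⟨p, hp, hpq⟩ := h₁ hq
      exact ⟨p, Module.support_subset_of_injective f hf hp, hpq⟩

lemma isSMulRegular_quotient_prime {p : Ideal R} [p.IsPrime] {x : R} (hx : x ∉ p) :
    IsSMulRegular (R ⧸ p) x := by
  rw [isSMulRegular_iff_right_eq_zero_of_smul]
  intro m hm
  rw [Algebra.smul_def, mul_eq_zero] at hm
  exact hm.resolve_left fun h => hx (Ideal.Quotient.eq_zero_iff_mem.mp h)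

/-- If `q` is in the support of `Ext^i(R/p, N)` and `p < q`, then `q` is in the support of
`Ext^{i+1}(R/p', N)` for some prime `p'` with `p < p' ≤ q`. -/
lemma exists_lt_of_mem_support [IsNoetherianRing R] [Module.Finite R N] {i : ℕ}
    {p q : PrimeSpectrum R} (hpq : p < q)
    (hq : q ∈ Module.support R (ExtMod R (R ⧸ p.asIdeal) N i)) :
    ∃ p', p < p' ∧ p' ≤ q ∧
      q ∈ Module.support R (ExtMod R (R ⧸ p'.asIdeal) N (i + 1)) := by
  obtain ⟨x, hxq, hxp⟩ := Set.exists_of_ssubset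
    (show (p.asIdeal : Set R) ⊂ q.asIdeal from hpq)
  have hx := isSMulRegular_quotient_prime hxp
  obtain ⟨δ, hδ, -, -⟩ := exists_connecting (N := N) hx i
  -- By Nakayama `q` survives in the support of `Ext^i / x Ext^i`, because `x ∈ q`. The connecting
  -- map embeds this quotient into `Ext^(i+1)` of `(R/p)/x`, whose support lies strictly above `p`.
  have hq' : q ∈ Module.support R (QuotSMulTop x (ExtMod R (R ⧸ p.asIdeal) N i)) := by
    rw [Module.support_quotSMulTop]
    exact ⟨hq, by simpa using hxq⟩
  have hle : x • (⊤ : Submodule R (ExtMod R (R ⧸ p.asIdeal) N i)) ≤ LinearMap.ker δ := by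
    intro e he
    obtain ⟨e', -, rfl⟩ := (Submodule.mem_smul_pointwise_iff_exists _ _ _).mp he
    exact (hδ _).mpr ⟨e', rfl⟩
  have hinj : Function.Injective (Submodule.liftQ _ δ hle) := by
    rw [← LinearMap.ker_eq_bot, Submodule.ker_liftQ_eq_bot]
    intro e he
    obtain ⟨e', rfl⟩ := (hδ _).mp he
    exact Submodule.smul_mem_pointwise_smul _ _ _ trivial
  obtain ⟨p', hp', hp'q, hqp'⟩ := exists_prime_of_mem_support N _ _ q
    (Module.support_subset_of_injective _ hinj hq')
  refine ⟨p', ?_, hp'q, hqp'⟩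
  rw [Module.support_quotSMulTop] at hp'
  have h1 : p ≤ p' := by
    have := hp'.1
    rwa [Module.mem_support_iff_of_finite, Ideal.annihilator_quotient] at this
  refine lt_of_le_of_ne h1 ?_
  rintro rfl
  exact hxp (by simpa using hp'.2)

/-- A prime of height `d` is in the support of `Ext^j(R/q, R)` for some `j ≥ d`. -/
lemma exists_mem_support_of_height [IsNoetherianRing R] (d : ℕ) (q : PrimeSpectrum R)
    (hd : q.asIdeal.height = d) :
    ∃ j, d ≤ j ∧ q ∈ Module.support R (ExtMod R (R ⧸ q.asIdeal) R j) := by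
  induction d generalizing q with
  | zero =>
    have hmin : q.asIdeal ∈ minimalPrimes R := by
      rw [← Ideal.height_eq_zero_iff]
      exact_mod_cast hd
    have hmin' : q.asIdeal ∈ (Module.annihilator R R).minimalPrimes := by
      rwa [Module.annihilator_eq_bot.mpr inferInstance]
    have hass := Module.associatedPrimes.minimalPrimes_annihilator_subset_associatedPrimes R R hmin'
    -- A minimal prime is associated to `R`, so the embedding `R/q → R` is a homomorphism that
    -- survives at `q`.
    obtain ⟨f, hf⟩ := exists_injective_of_isAssociatedPrime hass
    refine ⟨0, le_rfl, Module.mem_support_iff'.mpr ⟨(homEquiv _ _).symm f, fun s hs h0 => hs ?_⟩⟩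
    rw [← map_smul, map_eq_zero_iff _ (homEquiv _ _).symm.injective] at h0
    have h1 := LinearMap.congr_fun h0 (Ideal.Quotient.mk q.asIdeal 1)
    rw [LinearMap.smul_apply, ← map_smul, LinearMap.zero_apply, map_eq_zero_iff _ hf] at h1
    rw [← Ideal.Quotient.mk_eq_mk, ← Submodule.Quotient.mk_smul,
      Submodule.Quotient.mk_eq_zero] at h1
    simpa using h1
  | succ d ih =>
    rw [PrimeSpectrum.height_eq_orderHeight] at hd
    obtain ⟨-, ⟨p, hpq, hp⟩, -⟩ := (Order.height_eq_coe_add_one_iff (x := q) (n := d)).mp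
      (by exact_mod_cast hd)
    obtain ⟨j, hj, hpj⟩ := ih p (by rw [PrimeSpectrum.height_eq_orderHeight, hp])
    obtain ⟨p', hpp', hp'q, hq⟩ := exists_lt_of_mem_support hpq
      (Module.mem_support_mono hpq.le hpj)
    -- Here `p` has height `d` and `q` has height `d + 1`, which leaves no room for a prime strictly
    -- between them.
    have : p' = q := by
      by_contra hne
      have h1 := Order.height_add_one_le hpp'
      have h2 := Order.height_add_one_le (lt_of_le_of_ne hp'q hne)
      rw [hd] at h2
      rw [hp] at h1
      have h3 := (add_le_add_left h1 1).trans h2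
      norm_cast at h3
      omega
    subst this
    exact ⟨j + 1, by omega, hq⟩

/-- If `Ext^i(R/p, N)` is non-zero then so is `Ext^{i+l}(k, N)` for some `l ≤ dim R/p`, where `k`
is the residue field of the local ring `R`. -/
lemma exists_residueField_of_nontrivial [IsNoetherianRing R] [IsLocalRing R] [Module.Finite R N]
    (p : PrimeSpectrum R) (i : ℕ) (hp : Nontrivial (ExtMod R (R ⧸ p.asIdeal) N i)) :
    ∃ l : ℕ, (l : WithBot ℕ∞) ≤ ringKrullDim (R ⧸ p.asIdeal) ∧
      Nontrivial (ExtMod R (R ⧸ IsLocalRing.maximalIdeal R) N (i + l)) := by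
  have : WellFoundedGT (PrimeSpectrum R) :=
    StrictMono.wellFoundedGT (f := PrimeSpectrum.asIdeal) fun _ _ h => h
  -- Induction from the closed point downwards: passing to a strictly larger prime raises the degree
  -- by one and lowers `dim R/p` by at least one.
  induction p using WellFoundedGT.induction generalizing i with
  | ind p ih =>
    by_cases hpm : p = IsLocalRing.closedPoint R
    · subst hpm
      refine ⟨0, ?_, hp⟩
      have : Nontrivial (R ⧸ (IsLocalRing.closedPoint R).asIdeal) :=
        Ideal.Quotient.nontrivial_iff.mpr (IsLocalRing.closedPoint R).2.ne_top
      exact_mod_cast ringKrullDim_nonneg_of_nontrivial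
    · have hlt : p < IsLocalRing.closedPoint R :=
        lt_of_le_of_ne (IsLocalRing.le_maximalIdeal p.2.ne_top) hpm
      obtain ⟨q, hq⟩ := Module.nonempty_support_iff (R := R).mpr hp
      have hm : IsLocalRing.closedPoint R ∈
          Module.support R (ExtMod R (R ⧸ p.asIdeal) N i) :=
        Module.mem_support_mono (IsLocalRing.le_maximalIdeal q.2.ne_top) hq
      obtain ⟨p', hpp', -, hp'⟩ := exists_lt_of_mem_support hlt hm
      obtain ⟨l, hl, hnt⟩ := ih p' hpp' (i + 1) (Module.nonempty_support_iff.mp ⟨_, hp'⟩)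
      refine ⟨l + 1, ?_, by rwa [add_right_comm] at hnt⟩
      obtain ⟨x, hxp', hxp⟩ := Set.exists_of_ssubset
        (show (p.asIdeal : Set R) ⊂ p'.asIdeal from hpp')
      have h1 := ringKrullDim_succ_le_of_surjective
        (Ideal.Quotient.factor (show p.asIdeal ≤ p'.asIdeal from hpp'.le))
        (Ideal.Quotient.factor_surjective _) (r := Ideal.Quotient.mk _ x)
        (mem_nonZeroDivisors_of_ne_zero fun h => hxp (Ideal.Quotient.eq_zero_iff_mem.mp h))
        (by simpa [Ideal.Quotient.eq_zero_iff_mem] using hxp')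
      refine le_trans ?_ h1
      push_cast
      gcongr

/-- Dévissage reduces this to the prime quotients in the support of `M`. In this way the
non-vanishing degrees of `Ext(k, N)` control those of every finitely generated module. -/
lemma exists_residueField_of_nontrivial_ext [IsNoetherianRing R] [IsLocalRing R]
    [Module.Finite R N] [Module.Finite R M] (i : ℕ) (h : Nontrivial (ExtMod R M N i)) :
    ∃ l : ℕ, (l : WithBot ℕ∞) ≤ Module.supportDim R M ∧
      Nontrivial (ExtMod R (R ⧸ IsLocalRing.maximalIdeal R) N (i + l)) := by
  obtain ⟨q, hq⟩ := Module.nonempty_support_iff (R := R).mpr h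
  obtain ⟨p, hp, -, hqp⟩ := exists_prime_of_mem_support N M i q hq
  obtain ⟨l, hl, hnt⟩ := exists_residueField_of_nontrivial p i
    (Module.nonempty_support_iff.mp ⟨_, hqp⟩)
  refine ⟨l, hl.trans ?_, hnt⟩
  rw [Module.supportDim_eq_ringKrullDim_quotient_annihilator]
  rw [Module.mem_support_iff_of_finite] at hp
  exact ringKrullDim_le_of_surjective (Ideal.Quotient.factor hp) (Ideal.Quotient.factor_surjective hp)

end ExtModule


/-! ### Regular sequences and vanishing of Ext modules -/

namespace ExtModule

open scoped Pointwise
open RingTheory.Sequence IsLocalRing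

variable {R : Type u} [CommRing R]
variable {M N K : Type u} [AddCommGroup M] [Module R M] [AddCommGroup N] [Module R N]
  [AddCommGroup K] [Module R K]

/-- The long exact sequence in the second variable of multiplication by a regular element. -/
lemma exists_postConnecting {x : R} (hx : IsSMulRegular N x) (n : ℕ) :
    ∃ δ : ExtMod R M (QuotSMulTop x N) n →ₗ[R] ExtMod R M N (n + 1),
      (∀ e, δ e = 0 ↔ ∃ e', post M (Submodule.mkQ (x • (⊤ : Submodule R N))) n e' = e) ∧
      (∀ e, x • e = 0 ↔ ∃ e', δ e' = e) := by
  have hf : Function.Injective (x • (LinearMap.id : N →ₗ[R] N)) := hx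
  have hg := Submodule.mkQ_surjective (x • (⊤ : Submodule R N))
  have h : Function.Exact (x • (LinearMap.id : N →ₗ[R] N))
      (Submodule.mkQ (x • (⊤ : Submodule R N))) := LinearMap.exact_lsmul_mkQ_smul_top N x
  refine ⟨postδ M hf hg h n, fun e => post_postδ_exact hf hg h n e, fun e => ?_⟩
  have := postδ_post_exact (M := M) hf hg h n e
  rwa [post_smul_id] at this

/-- If `rs` is an `N`-regular sequence of length `t` killing `K` then `Ext^i(K, N) = 0` for `i < t`
and `Hom(K, N/rs N)` embeds into `Ext^t(K, N)`. -/
lemma rees (N : Type u) [AddCommGroup N] [Module R N] (rs : List R) (h : IsWeaklyRegular N rs)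
    (hK : ∀ r ∈ rs, ∀ y : K, r • y = 0) :
    (∀ i < rs.length, Subsingleton (ExtMod R K N i)) ∧
      ∃ f : ExtMod R K (N ⧸ Ideal.ofList rs • (⊤ : Submodule R N)) 0 →ₗ[R]
        ExtMod R K N rs.length, Function.Injective f := by
  induction rs generalizing N with
  | nil =>
    refine ⟨fun i hi => by simp at hi, ?_⟩
    have e : (N ⧸ Ideal.ofList ([] : List R) • (⊤ : Submodule R N)) ≃ₗ[R] N :=
      Submodule.quotEquivOfEqBot _ (by simp)
    refine ⟨post K e.toLinearMap 0, fun a b hab => (homEquiv _ _).injective ?_⟩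
    have := congrArg (homEquiv _ _) hab
    rw [homEquiv_post, homEquiv_post] at this
    ext y
    exact e.injective (LinearMap.congr_fun this y)
  | cons x rs ih =>
    rw [isWeaklyRegular_cons_iff] at h
    obtain ⟨h0, f, hf⟩ := ih (QuotSMulTop x N) h.2 fun r hr => hK r (List.mem_cons_of_mem _ hr)
    -- The element `x` acts as zero on these Ext modules through `K`, so every class of
    -- `Ext^(i+1)(K, N)` lies in the image of `Ext^i(K, N/xN)`, which vanishes in low degrees by
    -- induction.
    have hx0 : ∀ i, ∀ e : ExtMod R K N i, x • e = 0 := fun i e =>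
      smul_eq_zero_of_left x (hK x List.mem_cons_self) i e
    have hvan : ∀ i < rs.length + 1, Subsingleton (ExtMod R K N i) := by
      intro i hi
      refine subsingleton_of_forall_eq 0 fun e => ?_
      rcases i with _ | i
      · apply (homEquiv _ _).injective
        rw [map_zero]
        ext y
        apply h.1
        have := LinearMap.congr_fun (congrArg (homEquiv K N) (hx0 0 e)) y
        simpa using this
      · obtain ⟨δ, -, hδ⟩ := exists_postConnecting (M := K) h.1 i
        obtain ⟨e', rfl⟩ := (hδ e).mp (hx0 _ e)
        have := h0 i (by omega)
        rw [Subsingleton.elim e' 0, map_zero]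
    refine ⟨hvan, ?_⟩
    obtain ⟨δ, hδ, -⟩ := exists_postConnecting (M := K) h.1 rs.length
    have hδi : Function.Injective δ := by
      rw [← LinearMap.ker_eq_bot, LinearMap.ker_eq_bot']
      intro e he
      obtain ⟨e', rfl⟩ := (hδ e).mp he
      have := hvan rs.length (by omega)
      rw [Subsingleton.elim e' 0, map_zero]
    let e := Submodule.quotOfListConsSMulTopEquivQuotSMulTopInner N x rs
    refine ⟨δ ∘ₗ f ∘ₗ post K e.toLinearMap 0, hδi.comp (hf.comp ?_)⟩
    intro a b hab
    apply (homEquiv _ _).injective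
    have := congrArg (homEquiv _ _) hab
    rw [homEquiv_post, homEquiv_post] at this
    ext y
    exact e.injective (LinearMap.congr_fun this y)

section Local

variable [IsLocalRing R] [IsNoetherianRing R]

omit [IsNoetherianRing R] in
lemma subsingleton_of_smul_surjective [Module.Finite R M] {x : R} (hx : x ∈ maximalIdeal R)
    (h : ∀ m : M, ∃ m', x • m' = m) : Subsingleton M := by
  have : (⊤ : Submodule R M) = ⊥ := by
    apply Submodule.eq_bot_of_le_smul_of_le_jacobson_bot (Ideal.span {x}) ⊤
      Module.Finite.fg_top
    · intro m _
      obtain ⟨m', rfl⟩ := h m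
      exact Submodule.smul_mem_smul (Ideal.mem_span_singleton_self x) trivial
    · rw [IsLocalRing.jacobson_eq_maximalIdeal ⊥ bot_ne_top, Ideal.span_le]
      simpa using hx
  exact (Submodule.subsingleton_iff R).mp (subsingleton_of_bot_eq_top this.symm)

/-- `Ext^n(M, N) = 0` if `Ext^{n+1}(M/xM, N) = 0`. -/
lemma subsingleton_of_quotSMulTop [Module.Finite R M] [Module.Finite R N] {x : R}
    (hx : x ∈ maximalIdeal R) (hreg : IsSMulRegular M x) (n : ℕ)
    (h : Subsingleton (ExtMod R (QuotSMulTop x M) N (n + 1))) :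
    Subsingleton (ExtMod R M N n) := by
  obtain ⟨δ, hδ, -, -⟩ := exists_connecting (N := N) hreg n
  exact subsingleton_of_smul_surjective hx fun m => (hδ m).mp (Subsingleton.elim _ _)

/-- By Nakayama `Ext^i(M, N)` vanishes as soon as `Ext^(i+1)(M/xM, N)` does. Thus each regular
element lowers by one the bound `e` on the non-vanishing degrees. -/
lemma ext_subsingleton_of_isWeaklyRegular [Module.Finite R N] (e : ℕ)
    (he : ∀ (M : Type u) [AddCommGroup M] [Module R M] [Module.Finite R M] (i : ℕ), e < i →
      Subsingleton (ExtMod R M N i))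
    (M : Type u) [AddCommGroup M] [Module R M] [Module.Finite R M] (rs : List R)
    (hrs : ∀ r ∈ rs, r ∈ maximalIdeal R) (hreg : IsWeaklyRegular M rs) (i : ℕ)
    (hi : e < i + rs.length) : Subsingleton (ExtMod R M N i) := by
  induction rs generalizing M i with
  | nil => exact he M i (by simpa using hi)
  | cons x rs ih =>
    rw [isWeaklyRegular_cons_iff] at hreg
    refine subsingleton_of_quotSMulTop (hrs x List.mem_cons_self) hreg.1 i ?_
    refine ih (QuotSMulTop x M) (fun r hr => hrs r (List.mem_cons_of_mem _ hr)) hreg.2 (i + 1) ?_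
    simp only [List.length_cons] at hi
    omega

/-- The bound is attained when the residue field embeds in `M` modulo the sequence. Restriction of
`Ext^e` to the residue field is onto because `Ext^(e+1) = 0`; going back along each regular element,
the connecting map out of `Ext^i(M, N)` is onto because `Ext^(i+1)(M, N) = 0`. -/
lemma ext_nontrivial_of_isWeaklyRegular [Module.Finite R N] (e : ℕ)
    (he : ∀ (M : Type u) [AddCommGroup M] [Module R M] [Module.Finite R M] (i : ℕ), e < i →
      Subsingleton (ExtMod R M N i)) (he' : Nontrivial (ExtMod R (R ⧸ maximalIdeal R) N e))
    (M : Type u) [AddCommGroup M] [Module R M] [Module.Finite R M] (rs : List R)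
    (hrs : ∀ r ∈ rs, r ∈ maximalIdeal R) (hreg : IsWeaklyRegular M rs)
    (hass : ∃ f : (R ⧸ maximalIdeal R) →ₗ[R] (M ⧸ Ideal.ofList rs • (⊤ : Submodule R M)),
      Function.Injective f) (i : ℕ)
    (hi : i + rs.length = e) : Nontrivial (ExtMod R M N i) := by
  induction rs generalizing M i with
  | nil =>
    obtain rfl : i = e := by simpa using hi
    obtain ⟨f, hf⟩ := hass
    have e : (M ⧸ Ideal.ofList ([] : List R) • (⊤ : Submodule R M)) ≃ₗ[R] M :=
      Submodule.quotEquivOfEqBot _ (by simp)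
    let f' := e.toLinearMap ∘ₗ f
    have hf' : Function.Injective f' := e.injective.comp hf
    have hsurj : Function.Surjective (pre N f' i) := by
      intro a
      have hex : Function.Exact f' (Submodule.mkQ (LinearMap.range f')) :=
        LinearMap.exact_map_mkQ_range f'
      have := he (M ⧸ LinearMap.range f') (i + 1) (by omega)
      exact (pre_preδ_exact (N := N) hf' (Submodule.mkQ_surjective _) hex i a).mp
        (Subsingleton.elim _ _)
    exact hsurj.nontrivial
  | cons x rs ih =>
    rw [isWeaklyRegular_cons_iff] at hreg
    simp only [List.length_cons] at hi
    have h1 : Nontrivial (ExtMod R (QuotSMulTop x M) N (i + 1)) := by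
      refine ih (QuotSMulTop x M) (fun r hr => hrs r (List.mem_cons_of_mem _ hr)) hreg.2 ?_
        (i + 1) (by omega)
      obtain ⟨f, hf⟩ := hass
      exact ⟨(Submodule.quotOfListConsSMulTopEquivQuotSMulTopInner M x rs).toLinearMap ∘ₗ f,
        (Submodule.quotOfListConsSMulTopEquivQuotSMulTopInner M x rs).injective.comp hf⟩
    have h2 : Subsingleton (ExtMod R M N (i + 1)) :=
      ext_subsingleton_of_isWeaklyRegular e he M (x :: rs) hrs
        (by rw [isWeaklyRegular_cons_iff]; exact hreg) (i + 1) (by simp; omega)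
    obtain ⟨δ, -, hδ, -⟩ := exists_connecting (N := N) hreg.1 i
    have hsurj : Function.Surjective δ := fun a => (hδ a).mp (Subsingleton.elim _ _)
    exact hsurj.nontrivial

lemma exists_ringKrullDim_eq (R : Type u) [CommRing R] [IsLocalRing R] [IsNoetherianRing R] :
    ∃ n : ℕ, ringKrullDim R = n := by
  have h1 := ringKrullDim_ne_bot (R := R)
  have h2 := ringKrullDim_ne_top (R := R)
  generalize ringKrullDim R = d at h1 h2
  induction d with
  | bot => exact (h1 rfl).elim
  | coe d =>
    induction d with
    | top => exact (h2 rfl).elim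
    | coe n => exact ⟨n, rfl⟩

lemma supportDim_nonneg (R M : Type*) [CommRing R] [AddCommGroup M] [Module R M] [Nontrivial M] :
    (0 : WithBot ℕ∞) ≤ Module.supportDim R M := by
  have := Module.supportDim_ne_bot_of_nontrivial R M
  generalize Module.supportDim R M = d at this
  induction d with
  | bot => exact (this rfl).elim
  | coe d => exact_mod_cast zero_le

lemma length_le_supportDim [Module.Finite R M] [Nontrivial M] (rs : List R)
    (hrs : ∀ r ∈ rs, r ∈ maximalIdeal R) (hreg : IsWeaklyRegular M rs) :
    (rs.length : WithBot ℕ∞) ≤ Module.supportDim R M := by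
  have hreg' := (isRegular_iff_isWeaklyRegular_of_subset_maximalIdeal hrs).mpr hreg
  rw [← Module.supportDim_add_length_eq_supportDim_of_isRegular rs hreg']
  have : Nontrivial (M ⧸ Ideal.ofList rs • (⊤ : Submodule R M)) :=
    Submodule.Quotient.nontrivial_iff.mpr hreg'.top_ne_smul.symm
  simpa using add_le_add_left (supportDim_nonneg R (M ⧸ Ideal.ofList rs • (⊤ : Submodule R M)))
    (rs.length : WithBot ℕ∞)

/-- A maximal regular sequence. -/
lemma exists_maximal_isWeaklyRegular (M : Type u) [AddCommGroup M] [Module R M]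
    [Module.Finite R M] [Nontrivial M] :
    ∃ rs : List R, (∀ r ∈ rs, r ∈ maximalIdeal R) ∧ IsWeaklyRegular M rs ∧
      ∃ f : (R ⧸ maximalIdeal R) →ₗ[R] (M ⧸ Ideal.ofList rs • (⊤ : Submodule R M)),
        Function.Injective f := by
  have hbd : ∀ rs : List R, (∀ r ∈ rs, r ∈ maximalIdeal R) ∧ IsWeaklyRegular M rs →
      (rs.length : WithBot ℕ∞) ≤ Module.supportDim R M := fun rs h =>
    length_le_supportDim rs h.1 h.2
  obtain ⟨n, hn⟩ := exists_ringKrullDim_eq R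
  let P : ℕ → Prop := fun t => ∃ rs : List R,
    ((∀ r ∈ rs, r ∈ maximalIdeal R) ∧ IsWeaklyRegular M rs) ∧ rs.length = t
  have hP : ∀ t, P t → t ≤ n := by
    rintro t ⟨rs, hrs, rfl⟩
    have := (hbd rs hrs).trans (Module.supportDim_le_ringKrullDim R M)
    rw [hn] at this
    exact_mod_cast this
  classical
  have hP0 : P 0 := ⟨[], ⟨by simp, IsWeaklyRegular.nil R M⟩, rfl⟩
  obtain ⟨rs, ⟨h1, h2⟩, hlen⟩ := Nat.findGreatest_spec (P := P) (Nat.zero_le n) hP0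
  refine ⟨rs, h1, h2, ?_⟩
  by_contra hcon
  -- If the residue field did not embed, `𝔪` would not be an associated prime, and prime avoidance
  -- would yield one more regular element in `𝔪`, against the choice of a longest sequence.
  have hass : maximalIdeal R ∉ associatedPrimes R (M ⧸ Ideal.ofList rs • (⊤ : Submodule R M)) :=
    fun h => hcon (exists_injective_of_isAssociatedPrime h)
  obtain ⟨x, hx, hxreg⟩ : ∃ x ∈ maximalIdeal R,
      IsSMulRegular (M ⧸ Ideal.ofList rs • (⊤ : Submodule R M)) x := by
    by_contra! hno
    have hsub : (maximalIdeal R : Set R) ⊆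
        ⋃ p ∈ associatedPrimes R (M ⧸ Ideal.ofList rs • (⊤ : Submodule R M)), (p : Set R) := by
      rw [biUnion_associatedPrimes_eq_compl_regular]
      exact fun x hx => hno x hx
    obtain ⟨p, hp, hle⟩ := (Ideal.subset_union_prime_finite (associatedPrimes.finite R _) ⊥ ⊥
      (fun p hp _ _ => hp.isPrime)).mp hsub
    have : p = maximalIdeal R := le_antisymm (le_maximalIdeal hp.isPrime.ne_top) hle
    exact hass (this ▸ hp)
  have hbig : P (rs.length + 1) := by
    refine ⟨rs ++ [x], ⟨?_, ?_⟩, by simp⟩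
    · intro r hr
      rw [List.mem_append, List.mem_singleton] at hr
      rcases hr with hr | rfl
      · exact h1 r hr
      · exact hx
    · rw [isWeaklyRegular_append_iff]
      exact ⟨h2, (isWeaklyRegular_singleton_iff _ _).mpr hxreg⟩
  have := Nat.le_findGreatest (hP _ hbig) hbig
  omega

end Local

end ExtModule


/-! ### Gorenstein local rings -/

namespace ExtModule

open scoped Pointwise
open RingTheory.Sequence IsLocalRing

/-! ### Baer's criterion and injective dimension -/

section Baer

variable {R : Type u} [CommRing R]

lemma injective_of_ext_one (M : Type u) [AddCommGroup M] [Module R M]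
    (h : ∀ I : Ideal R, Subsingleton (ExtMod R (R ⧸ I) M 1)) : Module.Injective R M := by
  refine Module.Baer.injective fun I g => ?_
  have hex : Function.Exact (Submodule.subtype I) (Submodule.mkQ I) :=
    LinearMap.exact_subtype_mkQ I
  have := h I
  obtain ⟨e, he⟩ := (pre_preδ_exact (N := M) (Submodule.subtype_injective I)
    (Submodule.mkQ_surjective I) hex 0 ((homEquiv _ _).symm g)).mp (Subsingleton.elim _ _)
  refine ⟨homEquiv _ _ e, fun x hx => ?_⟩
  have h2 := congrArg (homEquiv _ _) he
  rw [homEquiv_pre, LinearEquiv.apply_symm_apply] at h2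
  exact LinearMap.congr_fun h2 ⟨x, hx⟩

/-- A module has injective dimension at most `n` if `Ext^{n+1}(R/I, M) = 0` for all ideals `I`. -/
lemma injectiveDimensionLE_of_ext (n : ℕ) (M : ModuleCat.{u} R)
    (h : ∀ I : Ideal R, Subsingleton (ExtMod R (R ⧸ I) M (n + 1))) :
    HasInjectiveDimensionLE M n := by
  induction n generalizing M with
  | zero =>
    have := injective_of_ext_one M h
    have : Injective M := Module.injective_object_of_injective_module R M
    change HasInjectiveDimensionLT M 1
    infer_instance
  | succ n ih =>
    obtain ⟨I, _, f, _⟩ := EnoughInjectives.presentation M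
    have hf : Function.Injective f.hom := (ModuleCat.mono_iff_injective f).mp ‹_›
    have hg := Submodule.mkQ_surjective (LinearMap.range f.hom)
    have hex : Function.Exact f.hom (Submodule.mkQ (LinearMap.range f.hom)) :=
      LinearMap.exact_map_mkQ_range f.hom
    have hS := shortExact hf hg hex
    refine (hS.hasInjectiveDimensionLT_X₃_iff n ‹_›).mp
      (ih (ModuleCat.of R (I ⧸ LinearMap.range f.hom)) fun J => ?_)
    -- Dimension shifting: a class on the cokernel comes from the injective module `I`, because
    -- `Ext^(n+2)(R/J, M) = 0`.
    refine subsingleton_of_forall_eq 0 fun e => ?_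
    have := h J
    obtain ⟨e', rfl⟩ := (post_postδ_exact (M := R ⧸ J) hf hg hex (n + 1) e).mp
      (Subsingleton.elim _ _)
    have : Subsingleton (ExtMod R (R ⧸ J) I (n + 1)) :=
      Ext.subsingleton_of_injective _ _ _
    rw [Subsingleton.elim e' 0, map_zero]

end Baer

variable {R : Type u} [CommRing R]

/-- The residue field of a Gorenstein local ring `R` of dimension `n` has `Ext^i(k, R) ≠ 0` exactly
for `i = n`. -/
theorem ext_residueField_nontrivial_iff [IsLocalRing R] (hR : IsGorensteinLocalRing R) {n : ℕ}
    (hn : ringKrullDim R = n) (i : ℕ) :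
    Nontrivial (ExtMod R (R ⧸ maximalIdeal R) R i) ↔ i = n := by
  have := hR.isNoetherianRing
  obtain ⟨b, hb⟩ := hR.finite_injectiveDimension
  let P : ℕ → Prop := fun i => Nontrivial (ExtMod R (R ⧸ maximalIdeal R) R i)
  have hPb : ∀ i, P i → i ≤ b := by
    intro i hi
    by_contra! hlt
    have := subsingleton_of_injDim (M := R ⧸ maximalIdeal R) hb hlt
    exact not_nontrivial _ hi
  -- The maximal ideal has height `n`, which yields a non-zero `Ext^j(k, R)` with `j ≥ n`.
  obtain ⟨j, hj, hjs⟩ := exists_mem_support_of_height n (closedPoint R) (by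
    have := maximalIdeal_height_eq_ringKrullDim (R := R)
    rw [hn] at this
    exact_mod_cast this)
  have hPj' : Nontrivial (ExtMod R (R ⧸ (closedPoint R).asIdeal) R j) :=
    Module.nonempty_support_iff.mp ⟨_, hjs⟩
  have hPj : P j := hPj'
  classical
  -- The last non-vanishing degree `e` exists by finite injective dimension. It satisfies `n ≤ j ≤
  -- e`, and it will turn out to be the depth of `R`, hence at most `n`.
  set e := Nat.findGreatest P b with he
  have hPe : P e := Nat.findGreatest_spec (hPb j hPj) hPj
  have hemax : ∀ i, P i → i ≤ e := fun i hi => Nat.le_findGreatest (hPb i hi) hi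
  have hvan : ∀ (M : Type u) [AddCommGroup M] [Module R M] [Module.Finite R M] (i : ℕ), e < i →
      Subsingleton (ExtMod R M R i) := by
    intro M _ _ _ i hi
    by_contra hns
    rw [not_subsingleton_iff_nontrivial] at hns
    obtain ⟨l, -, hl⟩ := exists_residueField_of_nontrivial_ext i hns
    have := hemax _ hl
    omega
  obtain ⟨rs, hrs, hreg, hass⟩ := exists_maximal_isWeaklyRegular (R := R) R
  have hle : rs.length ≤ e := by
    by_contra! hlt
    have := ext_subsingleton_of_isWeaklyRegular e hvan R rs hrs hreg 0 (by omega)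
    have : Subsingleton (R →ₗ[R] R) := (homEquiv R R).symm.toEquiv.subsingleton
    have h1 := LinearMap.congr_fun (Subsingleton.elim (LinearMap.id : R →ₗ[R] R) 0) 1
    simp at h1
  have hnt := ext_nontrivial_of_isWeaklyRegular e hvan hPe R rs hrs hreg hass (e - rs.length)
    (by omega)
  -- The module `R` is free, so its non-zero Ext in degree `e - rs.length` has to be in degree zero.
  have heq : e = rs.length := by
    by_contra hne
    have : Subsingleton (ExtMod R R R (e - rs.length)) := subsingleton_of_free (by omega)
    exact not_nontrivial _ hnt
  have hlen : rs.length ≤ n := by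
    have h2 := length_le_supportDim rs hrs hreg
    rw [Module.supportDim_self_eq_ringKrullDim, hn] at h2
    exact_mod_cast h2
  have hen : e = n := by have := hemax j hPj; omega
  refine ⟨fun hi => ?_, fun hi => by rw [hi, ← hen]; exact hPe⟩
  refine le_antisymm (hen ▸ hemax i hi) ?_
  by_contra! hlt
  -- Now `R` has depth `n`, and the sequence kills `Ext(k, R)` in all degrees below `n`.
  have := (rees (K := R ⧸ maximalIdeal R) R rs hreg (fun r hr y => by
    obtain ⟨y, rfl⟩ := Submodule.mkQ_surjective _ y
    rw [← map_smul]
    exact (Submodule.Quotient.mk_eq_zero _).mpr (Ideal.mul_mem_right _ _ (hrs r hr)))).1 i (by omega)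
  exact not_nontrivial _ hi

section Gorenstein

variable [IsLocalRing R] (hR : IsGorensteinLocalRing R) {n : ℕ} (hn : ringKrullDim R = n)
include hR hn

/-- Vanishing of `Ext^i(M, R)` below the codimension of `M`. -/
theorem ext_subsingleton_of_supportDim_lt (M : Type u) [AddCommGroup M] [Module R M]
    [Module.Finite R M] (i d : ℕ) (hd : Module.supportDim R M ≤ d) (hi : i + d < n) :
    Subsingleton (ExtMod R M R i) := by
  have := hR.isNoetherianRing
  by_contra hns
  rw [not_subsingleton_iff_nontrivial] at hns
  obtain ⟨l, hl, hnt⟩ := exists_residueField_of_nontrivial_ext i hns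
  rw [ext_residueField_nontrivial_iff hR hn] at hnt
  have : l ≤ d := by exact_mod_cast hl.trans hd
  omega

/-- A non-zero class would force a non-zero `Ext(k, R)` in a degree above `n`. -/
theorem ext_subsingleton_of_ringKrullDim_lt (M : Type u) [AddCommGroup M] [Module R M]
    [Module.Finite R M] (i : ℕ) (hi : n < i) : Subsingleton (ExtMod R M R i) := by
  have := hR.isNoetherianRing
  by_contra hns
  rw [not_subsingleton_iff_nontrivial] at hns
  obtain ⟨l, hl, hnt⟩ := exists_residueField_of_nontrivial_ext i hns
  rw [ext_residueField_nontrivial_iff hR hn] at hnt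
  omega

/-- A Gorenstein local ring has injective dimension at most its dimension. -/
theorem injectiveDimensionLE_ringKrullDim : HasInjectiveDimensionLE (ModuleCat.of R R) n :=
  injectiveDimensionLE_of_ext n _ fun _ =>
    ext_subsingleton_of_ringKrullDim_lt hR hn _ _ (Nat.lt_succ_self n)

/-- Vanishing of `Ext^i(M, R)` above `dim R - t`, where `t` is the length of an `M`-regular
sequence. -/
theorem ext_subsingleton_of_lt_add_length (M : Type u) [AddCommGroup M] [Module R M]
    [Module.Finite R M] (rs : List R) (hrs : ∀ r ∈ rs, r ∈ maximalIdeal R)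
    (hreg : IsWeaklyRegular M rs) (i : ℕ) (hi : n < i + rs.length) :
    Subsingleton (ExtMod R M R i) := by
  have := hR.isNoetherianRing
  exact ext_subsingleton_of_isWeaklyRegular n
    (fun M _ _ _ i hi => ext_subsingleton_of_ringKrullDim_lt hR hn M i hi) M rs hrs hreg i hi

end Gorenstein

end ExtModule


/-! ### The canonical module of a Gorenstein quotient -/

namespace ExtModule

open scoped Pointwise
open RingTheory.Sequence IsLocalRing

/-- A module generated by one element. -/
def IsCyclicModule (R M : Type*) [CommRing R] [AddCommGroup M] [Module R M] : Prop :=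
  ∃ g : M, ∀ y : M, ∃ r : R, r • g = y

/-- Every non-zero submodule contains a fixed non-zero element. -/
def HasSimpleSocle (R M : Type*) [CommRing R] [AddCommGroup M] [Module R M] : Prop :=
  ∃ σ : M, σ ≠ 0 ∧ ∀ y : M, y ≠ 0 → ∃ r : R, r • y = σ

section Cyclic

variable {R M N : Type*} [CommRing R] [AddCommGroup M] [Module R M] [AddCommGroup N] [Module R N]

lemma IsCyclicModule.of_surjective (h : IsCyclicModule R M) (f : M →ₗ[R] N)
    (hf : Function.Surjective f) : IsCyclicModule R N := by
  obtain ⟨g, hg⟩ := h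
  refine ⟨f g, fun y => ?_⟩
  obtain ⟨x, rfl⟩ := hf y
  obtain ⟨r, rfl⟩ := hg x
  exact ⟨r, (map_smul f r g).symm⟩

lemma IsCyclicModule.quotient (I : Ideal R) : IsCyclicModule R (R ⧸ I) := by
  refine ⟨Ideal.Quotient.mk I 1, fun y => ?_⟩
  obtain ⟨r, rfl⟩ := Ideal.Quotient.mk_surjective y
  exact ⟨r, by rw [Algebra.smul_def, map_one, mul_one]; rfl⟩

lemma HasSimpleSocle.of_equiv (h : HasSimpleSocle R M) (e : M ≃ₗ[R] N) : HasSimpleSocle R N := by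
  obtain ⟨σ, hσ, h⟩ := h
  refine ⟨e σ, by simpa using hσ, fun y hy => ?_⟩
  obtain ⟨r, hr⟩ := h (e.symm y) (by simpa using hy)
  exact ⟨r, by rw [← hr, map_smul, e.apply_symm_apply]⟩

/-- Both modules are the quotient of `R` by the common annihilator. The local self-duality
isomorphisms come from this comparison, so no natural map has to be followed. -/
lemma nonempty_equiv_of_annihilator_eq (hM : IsCyclicModule R M) (hN : IsCyclicModule R N)
    (h : Module.annihilator R M = Module.annihilator R N) : Nonempty (M ≃ₗ[R] N) := by
  obtain ⟨a, ha⟩ := hM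
  obtain ⟨b, hb⟩ := hN
  have h1 : LinearMap.ker (LinearMap.toSpanSingleton R M a) = Module.annihilator R M := by
    ext r
    simp only [LinearMap.mem_ker, LinearMap.toSpanSingleton_apply, Module.mem_annihilator]
    refine ⟨fun hr y => ?_, fun hr => hr a⟩
    obtain ⟨s, rfl⟩ := ha y
    rw [smul_comm, hr, smul_zero]
  have h2 : LinearMap.ker (LinearMap.toSpanSingleton R N b) = Module.annihilator R N := by
    ext r
    simp only [LinearMap.mem_ker, LinearMap.toSpanSingleton_apply, Module.mem_annihilator]
    refine ⟨fun hr y => ?_, fun hr => hr b⟩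
    obtain ⟨s, rfl⟩ := hb y
    rw [smul_comm, hr, smul_zero]
  exact ⟨((LinearMap.toSpanSingleton R M a).quotKerEquivOfSurjective ha).symm.trans
    ((Submodule.quotEquivOfEq _ _ (h1.trans (h.trans h2.symm))).trans
      ((LinearMap.toSpanSingleton R N b).quotKerEquivOfSurjective hb))⟩

/-- Nakayama: a module is cyclic if it is so modulo an element of the maximal ideal. -/
lemma IsCyclicModule.of_quotSMulTop [IsLocalRing R] [Module.Finite R M] {x : R}
    (hx : x ∈ maximalIdeal R) (h : ∃ g : M, ∀ y : M, ∃ r : R, ∃ z : M, y = r • g + x • z) :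
    IsCyclicModule R M := by
  obtain ⟨g, hg⟩ := h
  have hle : (⊤ : Submodule R M) ≤ Submodule.span R {g} := by
    refine Submodule.le_of_le_smul_of_le_jacobson_bot (I := Ideal.span {x})
      Module.Finite.fg_top ?_ ?_
    · rw [IsLocalRing.jacobson_eq_maximalIdeal ⊥ bot_ne_top, Ideal.span_le]
      simpa using hx
    · intro y _
      obtain ⟨r, z, rfl⟩ := hg y
      exact Submodule.add_mem_sup (Submodule.mem_span_singleton.mpr ⟨r, rfl⟩)
        (Submodule.smul_mem_smul (Ideal.mem_span_singleton_self x) trivial)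
  exact ⟨g, fun y => Submodule.mem_span_singleton.mp (hle (Submodule.mem_top (x := y)))⟩

end Cyclic

variable {R : Type u} [CommRing R]

/-- With `i` the last degree in which Ext may be non-zero, the connecting map makes `Ext^(i+1)(M/xM,
N)` a quotient of `Ext^i(M, N)`. The vanishing hypothesis moves up by one at the same time. -/
lemma ext_quotient_isCyclic {N : Type u} [AddCommGroup N] [Module R N]
    (M : Type u) [AddCommGroup M] [Module R M] (rs : List R) (hreg : IsWeaklyRegular M rs) (i : ℕ)
    (hc : IsCyclicModule R (ExtMod R M N i)) (hv : ∀ j, i < j → Subsingleton (ExtMod R M N j)) :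
    IsCyclicModule R (ExtMod R (M ⧸ Ideal.ofList rs • (⊤ : Submodule R M)) N (i + rs.length)) := by
  induction rs generalizing M i with
  | nil =>
    have e : M ≃ₗ[R] (M ⧸ Ideal.ofList ([] : List R) • (⊤ : Submodule R M)) :=
      (Submodule.quotEquivOfEqBot _ (by simp)).symm
    exact hc.of_surjective (preEquiv N e i).symm.toLinearMap (LinearEquiv.surjective _)
  | cons x rs ih =>
    rw [isWeaklyRegular_cons_iff] at hreg
    have hv' : ∀ j, i < j → Subsingleton (ExtMod R (QuotSMulTop x M) N (j + 1)) := by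
      intro j hj
      refine subsingleton_of_forall_eq 0 fun e => ?_
      obtain ⟨δ, -, hδ, -⟩ := exists_connecting (N := N) hreg.1 j
      have := hv (j + 1) (by omega)
      have := hv j hj
      obtain ⟨e', rfl⟩ := (hδ e).mp (Subsingleton.elim _ _)
      rw [Subsingleton.elim e' 0, map_zero]
    have h := ih (QuotSMulTop x M) hreg.2 (i + 1) ?_ ?_
    · rw [List.length_cons, show i + (rs.length + 1) = i + 1 + rs.length by omega]
      exact h.of_surjective
        (preEquiv N (Submodule.quotOfListConsSMulTopEquivQuotSMulTopInner M x rs) _).toLinearMap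
        (LinearEquiv.surjective _)
    · obtain ⟨δ, -, hδ, -⟩ := exists_connecting (N := N) hreg.1 i
      have := hv (i + 1) (by omega)
      exact hc.of_surjective δ fun e => (hδ e).mp (Subsingleton.elim _ _)
    · intro j hj
      obtain ⟨j, rfl⟩ : ∃ j', j = j' + 1 := ⟨j - 1, by omega⟩
      exact hv' j (by omega)

/-- In dimension zero the support is the closed point, so every associated prime is `𝔪`. -/
lemma exists_residueField_injective [IsLocalRing R] [IsNoetherianRing R] (M : Type u)
    [AddCommGroup M] [Module R M] [Module.Finite R M] [Nontrivial M]
    (hM : Module.supportDim R M ≤ 0) :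
    ∃ f : (R ⧸ maximalIdeal R) →ₗ[R] M, Function.Injective f := by
  obtain ⟨P, hP⟩ := associatedPrimes.nonempty R M
  have hPp := hP.isPrime
  obtain ⟨f, hf⟩ := exists_injective_of_isAssociatedPrime hP
  have h1 : (⟨P, hPp⟩ : PrimeSpectrum R) ∈ Module.support R (R ⧸ P) := by
    rw [Module.mem_support_iff_of_finite, Ideal.annihilator_quotient]
  have h2 := Module.support_subset_of_injective f hf h1
  rw [support_of_supportDim_eq_zero R M (le_antisymm hM (supportDim_nonneg R M))] at h2
  obtain rfl : P = maximalIdeal R := le_antisymm (le_maximalIdeal hPp.ne_top) h2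
  exact ⟨f, hf⟩

lemma residueField_smul_eq_zero [IsLocalRing R] {r : R} (hr : r ∈ maximalIdeal R)
    (y : R ⧸ maximalIdeal R) : r • y = 0 := by
  obtain ⟨y, rfl⟩ := Submodule.mkQ_surjective _ y
  rw [← map_smul]
  exact (Submodule.Quotient.mk_eq_zero _).mpr (Ideal.mul_mem_right _ _ hr)

section Gorenstein

variable [IsLocalRing R] (hR : IsGorensteinLocalRing R) {n : ℕ} (hn : ringKrullDim R = n)
include hR hn

/-- For a maximal regular sequence `rs`, which has length `n`, the module `Ext^n(R/(rs), R)` is a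
quotient of `Hom(R, R) = R`. The residue field embeds in `R/(rs)`, and since `Ext^(n+1) = 0`
restriction makes `Ext^n(k, R)` a further quotient. -/
lemma ext_residueField_isCyclic : IsCyclicModule R (ExtMod R (R ⧸ maximalIdeal R) R n) := by
  have := hR.isNoetherianRing
  obtain ⟨rs, hrs, hreg, f, hf⟩ := exists_maximal_isWeaklyRegular (R := R) R
  obtain ⟨-, F, hF⟩ := rees (K := R ⧸ maximalIdeal R) R rs hreg
    fun r hr y => residueField_smul_eq_zero (hrs r hr) y
  have hnt : Nontrivial (ExtMod R (R ⧸ maximalIdeal R) R rs.length) := by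
    refine ⟨F ((homEquiv _ _).symm f), 0, fun h0 => ?_⟩
    have := hF (h0.trans (map_zero F).symm)
    rw [map_eq_zero_iff _ (LinearEquiv.injective _)] at this
    have h1 : Ideal.Quotient.mk (maximalIdeal R) 1 = 0 := hf (by rw [this]; rfl)
    exact one_ne_zero h1
  rw [ext_residueField_nontrivial_iff hR hn] at hnt
  have hc : IsCyclicModule R (ExtMod R R R 0) := by
    refine IsCyclicModule.of_surjective (M := R) ⟨1, fun y => ⟨y, by simp⟩⟩
      ((LinearMap.ringLmapEquivSelf R R R).symm.trans (homEquiv R R).symm).toLinearMap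
      (LinearEquiv.surjective _)
  have h1 := ext_quotient_isCyclic R rs hreg 0 hc fun j hj => subsingleton_of_free hj
  rw [zero_add, hnt] at h1
  refine h1.of_surjective (pre R f n) fun a => ?_
  have := ext_subsingleton_of_ringKrullDim_lt hR hn
    ((R ⧸ Ideal.ofList rs • (⊤ : Submodule R R)) ⧸ LinearMap.range f) (n + 1) (by omega)
  exact (pre_preδ_exact (N := R) hf (Submodule.mkQ_surjective _)
    (LinearMap.exact_map_mkQ_range f) n a).mp (Subsingleton.elim _ _)

/-- A Gorenstein local ring has a simple socle modulo a maximal regular sequence. -/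
lemma hasSimpleSocle_quotient (rs : List R) (hrs : ∀ r ∈ rs, r ∈ maximalIdeal R)
    (hreg : IsWeaklyRegular R rs) (hlen : rs.length = n) :
    HasSimpleSocle R (R ⧸ Ideal.ofList rs • (⊤ : Submodule R R)) := by
  have := hR.isNoetherianRing
  have hreg' := (isRegular_iff_isWeaklyRegular_of_subset_maximalIdeal hrs).mpr hreg
  have : Nontrivial (R ⧸ Ideal.ofList rs • (⊤ : Submodule R R)) :=
    Submodule.Quotient.nontrivial_iff.mpr hreg'.top_ne_smul.symm
  have hdim : Module.supportDim R (R ⧸ Ideal.ofList rs • (⊤ : Submodule R R)) ≤ 0 := by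
    have := Module.supportDim_add_length_eq_supportDim_of_isRegular rs hreg'
    rw [Module.supportDim_self_eq_ringKrullDim, hn, hlen] at this
    generalize Module.supportDim R (R ⧸ Ideal.ofList rs • (⊤ : Submodule R R)) = d at this
    induction d with
    | bot => simp
    | coe d =>
      induction d with
      | top => exact absurd this (by simp; exact fun h => by cases h)
      | coe d =>
        have : d + n = n := by exact_mod_cast this
        obtain rfl : d = 0 := by omega
        simp
  obtain ⟨-, F, hF⟩ := rees (K := R ⧸ maximalIdeal R) R rs hreg
    fun r hr y => residueField_smul_eq_zero (hrs r hr) y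
  obtain ⟨g, hg⟩ := hlen ▸ ext_residueField_isCyclic hR hn
  -- `Hom(k, R/(rs))` embeds in `Ext^n(k, R)`, which is cyclic and killed by `𝔪`. A non-zero element
  -- is therefore a unit multiple of the generator, and every other element is a multiple of it.
  have hprop : ∀ f f' : (R ⧸ maximalIdeal R) →ₗ[R] (R ⧸ Ideal.ofList rs • (⊤ : Submodule R R)),
      f ≠ 0 → ∃ r : R, r • f = f' := by
    intro f f' hf
    obtain ⟨a, ha⟩ := hg (F ((homEquiv _ _).symm f))
    obtain ⟨b, hb⟩ := hg (F ((homEquiv _ _).symm f'))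
    have hu : IsUnit a := by
      by_contra hna
      apply hf
      rw [smul_eq_zero_of_left a (fun m => residueField_smul_eq_zero hna m)] at ha
      have := hF (ha.symm.trans (map_zero F).symm)
      rwa [map_eq_zero_iff _ (LinearEquiv.injective _)] at this
    obtain ⟨u, rfl⟩ := hu
    refine ⟨b * ↑u⁻¹, (homEquiv _ _).symm.injective (hF ?_)⟩
    rw [map_smul, map_smul, ← ha, ← hb, mul_smul, smul_smul (↑u⁻¹ : R), Units.inv_mul, one_smul]
  obtain ⟨f₀, hf₀⟩ := exists_residueField_injective _ hdim
  refine ⟨f₀ (Ideal.Quotient.mk _ 1), ?_, fun y hy => ?_⟩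
  · rw [Ne, map_eq_zero_iff _ hf₀]
    exact one_ne_zero
  -- The submodule spanned by `y` has dimension zero, hence contains a copy of `k`, whose inclusion
  -- can be scaled to `f₀`.
  · have : Nontrivial (Submodule.span R {y}) :=
      ⟨⟨⟨y, Submodule.mem_span_singleton_self y⟩, 0, fun h => hy (congrArg Subtype.val h)⟩⟩
    obtain ⟨f, hf⟩ := exists_residueField_injective (Submodule.span R {y})
      ((Module.supportDim_le_of_injective (Submodule.span R {y}).subtype
        (Submodule.subtype_injective _)).trans hdim)
    obtain ⟨s, hs⟩ := Submodule.mem_span_singleton.mp (f (Ideal.Quotient.mk _ 1)).2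
    obtain ⟨r, hr⟩ := hprop ((Submodule.span R {y}).subtype ∘ₗ f) f₀ (by
      intro h0
      have h1 := hf ((Subtype.ext (LinearMap.congr_fun h0 (Ideal.Quotient.mk _ 1))).trans
        (map_zero f).symm)
      exact one_ne_zero h1)
    refine ⟨r * s, ?_⟩
    rw [mul_smul, hs, ← hr]
    rfl

end Gorenstein

end ExtModule


/-! ### Self-duality of Gorenstein quotients -/

namespace ExtModule

open scoped Pointwise
open RingTheory.Sequence IsLocalRing

variable {R : Type u} [CommRing R]

section Gorenstein

variable [IsLocalRing R] (hR : IsGorensteinLocalRing R) {n : ℕ} (hn : ringKrullDim R = n)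
include hR hn

/-- By dévissage it suffices to treat `k`, where `Ext^n(k, R)` is cyclic and killed by `𝔪`, so of
length at most one. The inequality is enough: a copy of `M` inside `Ext^n(M, R)` must then fill it.
-/
lemma length_ext_le (M : Type u) [AddCommGroup M] [Module R M] [Module.Finite R M]
    (hM : Module.supportDim R M ≤ 0) :
    Module.length R (ExtMod R M R n) ≤ Module.length R M ∧ Module.length R M ≠ ⊤ := by
  have := hR.isNoetherianRing
  induction ‹Module.Finite R M› using
    IsNoetherianRing.induction_on_isQuotientEquivQuotientPrime R with
  | subsingleton N =>
    have := subsingleton_of_left (R := R) (M := N) (N := R) n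
    simp [Module.length_eq_zero]
  | quotient N p e =>
    have hp := p.isPrime
    have : Nontrivial N := e.toEquiv.nontrivial
    have hs : p ∈ Module.support R N := by
      rw [Module.mem_support_iff_of_finite, e.annihilator_eq, Ideal.annihilator_quotient]
    rw [support_of_supportDim_eq_zero R N (le_antisymm hM (supportDim_nonneg R N))] at hs
    have hpm : p.asIdeal = maximalIdeal R := le_antisymm (le_maximalIdeal hp.ne_top) hs
    rw [hpm] at e
    have hk : IsSimpleModule R (R ⧸ maximalIdeal R) :=
      isSimpleModule_iff_isCoatom.mpr (maximalIdeal.isMaximal R).out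
    rw [e.length_eq, ← (preEquiv R e n).length_eq,
      Module.length_eq_one R (R ⧸ maximalIdeal R)]
    obtain ⟨g, hg⟩ := ext_residueField_isCyclic hR hn
    refine ⟨?_, by simp⟩
    have h0 : ∀ r ∈ maximalIdeal R, LinearMap.toSpanSingleton R _ g r = 0 := fun r hr =>
      smul_eq_zero_of_left r (fun m => residueField_smul_eq_zero hr m) n g
    rw [← Module.length_eq_one R (R ⧸ maximalIdeal R)]
    refine Module.length_le_of_surjective (Submodule.liftQ _ _ h0) fun y => ?_
    obtain ⟨r, rfl⟩ := hg y
    exact ⟨Submodule.mkQ _ r, rfl⟩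
  | exact N₁ N₂ N₃ f g hf hg hfg h₁ h₃ =>
    obtain ⟨h₁, h₁'⟩ := h₁ ((Module.supportDim_le_of_injective f hf).trans hM)
    obtain ⟨h₃, h₃'⟩ := h₃ ((Module.supportDim_le_of_surjective g hg).trans hM)
    rw [Module.length_eq_add_of_exact f g hf hg hfg]
    refine ⟨?_, WithTop.add_ne_top.mpr ⟨h₁', h₃'⟩⟩
    rw [Module.length_eq_add_of_exact (LinearMap.ker (pre R f n)).subtype
      (pre R f n).rangeRestrict (Submodule.subtype_injective _) (LinearMap.surjective_rangeRestrict _)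
      (by rw [LinearMap.exact_iff, LinearMap.ker_rangeRestrict, Submodule.range_subtype]), add_comm]
    refine add_le_add ((Module.length_le_of_injective _ (Submodule.subtype_injective _)).trans h₁) ?_
    have hx := pre_exact (N := R) hf hg hfg n
    refine le_trans (Module.length_le_of_surjective
      ((pre R g n).codRestrict (LinearMap.ker (pre R f n)) fun e => (hx _).mpr ⟨e, rfl⟩) ?_) h₃
    rintro ⟨e, he⟩
    obtain ⟨e', rfl⟩ := (hx e).mp he
    exact ⟨e', rfl⟩

/-- Choose a class `e` with non-zero restriction to the socle `k`. If `r` killed `e` but not the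
generator of `M`, some multiple `r' * r` would map `M` onto the socle, so would factor as `M → k →
M`. As `Ext^n(k, R) → Ext^n(M, R)` is injective, the restriction of `e` to `k` would vanish. So `e`
spans a copy of `M`, and lengths force it to be everything. -/
lemma nonempty_equiv_ext_of_supportDim_le_zero (M : Type u) [AddCommGroup M] [Module R M]
    [Module.Finite R M] (hM : Module.supportDim R M ≤ 0) (hc : IsCyclicModule R M)
    (hs : HasSimpleSocle R M) : Nonempty (M ≃ₗ[R] ExtMod R M R n) := by
  have := hR.isNoetherianRing
  obtain ⟨σ, hσ, hs⟩ := hs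
  obtain ⟨g, hg⟩ := hc
  have : Nontrivial M := ⟨σ, 0, hσ⟩
  obtain ⟨f, hf⟩ := exists_residueField_injective M hM
  have hone : (Ideal.Quotient.mk (maximalIdeal R) 1) ≠ 0 := one_ne_zero
  have hsoc : ∀ y : M, y ≠ 0 → ∃ r : R, r • y = f (Ideal.Quotient.mk _ 1) := by
    intro y hy
    obtain ⟨r, hr⟩ := hs y hy
    obtain ⟨s, hs⟩ := hs (f (Ideal.Quotient.mk _ 1)) (by rwa [Ne, map_eq_zero_iff _ hf])
    have hu : IsUnit s := by
      by_contra hns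
      exact hσ (by rw [← hs, ← map_smul, residueField_smul_eq_zero hns, map_zero])
    obtain ⟨s, rfl⟩ := hu
    exact ⟨↑s⁻¹ * r, by rw [mul_smul, hr, ← hs, smul_smul, Units.inv_mul, one_smul]⟩
  obtain ⟨e₀, he₀⟩ := @exists_ne _ ((ext_residueField_nontrivial_iff hR hn n).mpr rfl) 0
  obtain ⟨e, he⟩ : ∃ e, pre R f n e = e₀ := by
    have := ext_subsingleton_of_ringKrullDim_lt hR hn (M ⧸ LinearMap.range f) (n + 1) (by omega)
    exact (pre_preδ_exact (N := R) hf (Submodule.mkQ_surjective _)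
      (LinearMap.exact_map_mkQ_range f) n e₀).mp (Subsingleton.elim _ _)
  have key : ∀ r : R, r • e = 0 → r • g = 0 := by
    intro r hr
    by_contra hrg
    obtain ⟨r', hr'⟩ := hsoc _ hrg
    have hrange : ∀ y : M, ((r' * r) • (LinearMap.id : M →ₗ[R] M)) y ∈ LinearMap.range f := by
      intro y
      obtain ⟨a, rfl⟩ := hg y
      refine ⟨a • Ideal.Quotient.mk _ 1, ?_⟩
      rw [map_smul, ← hr']
      simp only [LinearMap.smul_apply, LinearMap.id_apply, smul_smul]
      congr 1
      ring
    let p : M →ₗ[R] (R ⧸ maximalIdeal R) :=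
      (LinearEquiv.ofInjective f hf).symm.toLinearMap ∘ₗ LinearMap.codRestrict _ _ hrange
    have hfp : f ∘ₗ p = (r' * r) • LinearMap.id := by
      ext y
      have := LinearEquiv.apply_symm_apply (LinearEquiv.ofInjective f hf)
        (LinearMap.codRestrict _ _ hrange y)
      exact congrArg Subtype.val this
    have hp : Function.Surjective p := by
      intro z
      obtain ⟨a, rfl⟩ := Ideal.Quotient.mk_surjective z
      refine ⟨a • g, hf ?_⟩
      have h1 : f (p (a • g)) = (r' * r) • a • g := LinearMap.congr_fun hfp (a • g)
      rw [h1, smul_comm, mul_smul, hr', ← map_smul]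
      congr 1
      rw [Algebra.smul_def, map_one, mul_one]
      rfl
    -- The kernel of `p` has dimension zero, so its `Ext^(n-1)` vanishes; for `n = 0` left exactness
    -- of Hom takes its place.
    have hinj : Function.Injective (pre R p n) := by
      rcases Nat.eq_zero_or_pos n with h0 | h0
      · subst h0
        exact pre_injective_zero hp
      · obtain ⟨m, rfl⟩ := Nat.exists_eq_succ_of_ne_zero h0.ne'
        rw [← LinearMap.ker_eq_bot, LinearMap.ker_eq_bot']
        intro a ha
        have := ext_subsingleton_of_supportDim_lt hR hn (LinearMap.ker p) m 0
          ((Module.supportDim_le_of_injective _ (Submodule.subtype_injective _)).trans hM) (by omega)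
        obtain ⟨b, rfl⟩ := (preδ_pre_exact (N := R) (Submodule.subtype_injective _) hp
          (LinearMap.exact_subtype_ker_map p) m a).mp ha
        rw [Subsingleton.elim b 0, map_zero]
    apply he₀
    apply hinj
    rw [map_zero, ← he, ← pre_comp_apply, hfp, pre_smul_id, mul_smul, hr, smul_zero]
  have key' : ∀ r : R, r • g = 0 → r • e = 0 := by
    refine fun r hr => smul_eq_zero_of_left r (fun y => ?_) n e
    obtain ⟨a, rfl⟩ := hg y
    rw [smul_comm, hr, smul_zero]
  have hker : LinearMap.ker (LinearMap.toSpanSingleton R M g) =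
      LinearMap.ker (LinearMap.toSpanSingleton R _ e) := by
    ext r
    exact ⟨key' r, key r⟩
  have hlen : Module.length R M =
      Module.length R (LinearMap.range (LinearMap.toSpanSingleton R (ExtMod R M R n) e)) := by
    rw [← ((LinearMap.toSpanSingleton R M g).quotKerEquivOfSurjective hg).length_eq,
      ← (LinearMap.quotKerEquivRange _).length_eq, hker]
  obtain ⟨hle, htop⟩ := length_ext_le hR hn M hM
  have hq := Module.length_eq_add_of_exact
    (LinearMap.range (LinearMap.toSpanSingleton R (ExtMod R M R n) e)).subtype
    (LinearMap.range (LinearMap.toSpanSingleton R (ExtMod R M R n) e)).mkQ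
    (Submodule.subtype_injective _) (Submodule.mkQ_surjective _) (LinearMap.exact_subtype_mkQ _)
  rw [← hlen] at hq
  rw [hq] at hle
  have hz : Module.length R (ExtMod R M R n ⧸
      LinearMap.range (LinearMap.toSpanSingleton R (ExtMod R M R n) e)) = 0 := by
    have h1 := (ENat.add_le_add_iff_left htop).mp (hle.trans_eq (add_zero _).symm)
    exact le_antisymm h1 bot_le
  rw [Module.length_eq_zero_iff, Submodule.Quotient.subsingleton_iff] at hz
  refine nonempty_equiv_of_annihilator_eq ⟨g, hg⟩ ⟨e, LinearMap.range_eq_top.mp hz⟩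
    (le_antisymm ?_ ?_)
  · intro r hr
    rw [Module.mem_annihilator] at hr ⊢
    exact fun a => smul_eq_zero_of_left r hr n a
  · intro r hr
    rw [Module.mem_annihilator] at hr ⊢
    intro y
    obtain ⟨a, rfl⟩ := hg y
    rw [smul_comm, key r (hr e), smul_zero]

/-- The dualizing module of a cyclic Cohen-Macaulay module with a simple socle modulo a system of
parameters is isomorphic to it. -/
theorem nonempty_equiv_ext (M : Type u) [AddCommGroup M] [Module R M]
    [Module.Finite R M] (rs : List R) (hrs : ∀ r ∈ rs, r ∈ maximalIdeal R)
    (hreg : IsWeaklyRegular M rs) (hM : Module.supportDim R M ≤ rs.length)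
    (hc : IsCyclicModule R M) (hs : HasSimpleSocle R (M ⧸ Ideal.ofList rs • (⊤ : Submodule R M)))
    (i : ℕ) (hi : i + rs.length = n) : Nonempty (M ≃ₗ[R] ExtMod R M R i) := by
  have := hR.isNoetherianRing
  induction rs generalizing M i with
  | nil =>
    obtain rfl : i = n := by simpa using hi
    refine nonempty_equiv_ext_of_supportDim_le_zero hR hn M (by simpa using hM) hc ?_
    exact hs.of_equiv (Submodule.quotEquivOfEqBot _ (by simp))
  | cons x rs ih =>
    have hx := hrs x List.mem_cons_self
    rw [List.length_cons] at hi hM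
    have hi' : i + 1 + rs.length = n := by omega
    have hvan : Subsingleton (ExtMod R M R (i + 1)) :=
      ext_subsingleton_of_lt_add_length hR hn M (x :: rs) hrs hreg (i + 1) (by simp; omega)
    rw [isWeaklyRegular_cons_iff] at hreg
    have hdim : Module.supportDim R (QuotSMulTop x M) ≤ rs.length := by
      rw [← Module.supportDim_quotSMulTop_succ_eq_supportDim hreg.1 hx] at hM
      generalize Module.supportDim R (QuotSMulTop x M) = d at hM
      induction d with
      | bot => exact bot_le
      | coe d =>
        induction d with
        | top =>
          exact absurd (show (⊤ : ℕ∞) ≤ ((rs.length + 1 : ℕ) : ℕ∞) by exact_mod_cast hM)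
            (by simp)
        | coe d =>
          have : d + 1 ≤ rs.length + 1 := by exact_mod_cast hM
          exact_mod_cast Nat.le_of_succ_le_succ this
    obtain ⟨E⟩ := ih (QuotSMulTop x M) (fun r hr => hrs r (List.mem_cons_of_mem x hr)) hreg.2 hdim
      (hc.of_surjective _ (Submodule.mkQ_surjective _))
      (hs.of_equiv (Submodule.quotOfListConsSMulTopEquivQuotSMulTopInner M x rs)) (i + 1) hi'
    have hvan0 : Subsingleton (ExtMod R (QuotSMulTop x M) R i) :=
      ext_subsingleton_of_supportDim_lt hR hn _ i rs.length hdim (by omega)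
    obtain ⟨δ, hδ, hδ', -⟩ := exists_connecting (N := R) hreg.1 i
    have hsurj : Function.Surjective δ := fun a => (hδ' a).mp (Subsingleton.elim _ _)
    obtain ⟨g, hg⟩ := hc
    -- `Ext^i(M, R)` modulo `x` is `Ext^(i+1)(M/xM, R)`, which is cyclic by induction, and Nakayama
    -- lifts a generator.
    have hcE : IsCyclicModule R (ExtMod R M R i) := by
      obtain ⟨g₁, hg₁⟩ : IsCyclicModule R (ExtMod R (QuotSMulTop x M) R (i + 1)) :=
        IsCyclicModule.of_surjective ⟨g, hg⟩ (E.toLinearMap ∘ₗ Submodule.mkQ _)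
          (E.surjective.comp (Submodule.mkQ_surjective _))
      obtain ⟨g₂, rfl⟩ := hsurj g₁
      refine IsCyclicModule.of_quotSMulTop hx ⟨g₂, fun y => ?_⟩
      obtain ⟨r, hr⟩ := hg₁ (δ y)
      obtain ⟨z, hz⟩ := (hδ (y - r • g₂)).mp (by rw [map_sub, map_smul, hr, sub_self])
      exact ⟨r, z, by rw [hz, add_sub_cancel]⟩
    have hxE : ∀ e : ExtMod R M R i, x • e = 0 → e = 0 := by
      intro e he
      have h1 := pre_exact (N := R) (f := x • (LinearMap.id : M →ₗ[R] M)) hreg.1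
        (Submodule.mkQ_surjective (x • (⊤ : Submodule R M)))
        (LinearMap.exact_lsmul_mkQ_smul_top M x) i e
      rw [pre_smul_id] at h1
      obtain ⟨e', rfl⟩ := h1.mp he
      rw [Subsingleton.elim e' 0, map_zero]
    refine nonempty_equiv_of_annihilator_eq ⟨g, hg⟩ hcE (le_antisymm ?_ ?_)
    · intro r hr
      rw [Module.mem_annihilator] at hr ⊢
      exact fun a => smul_eq_zero_of_left r hr i a
    · set 𝔞 := Module.annihilator R (ExtMod R M R i) with h𝔞
      -- An element `a` of `𝔞` kills `M/xM` by the inductive isomorphism, so `a • g = x • b • g` for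
      -- some `b`. Since `x` is regular on `Ext^i(M, R)`, also `b ∈ 𝔞`. Thus `𝔞 M ⊆ x 𝔞 M`, and
      -- Nakayama gives `𝔞 M = 0`.
      have hstep : 𝔞 • (⊤ : Submodule R M) ≤ Ideal.span {x} • (𝔞 • (⊤ : Submodule R M)) := by
        rw [Submodule.smul_le]
        intro a ha m _
        have h1 : ∀ e : ExtMod R (QuotSMulTop x M) R (i + 1), a • e = 0 := by
          intro e
          obtain ⟨e, rfl⟩ := hsurj e
          rw [← map_smul, Module.mem_annihilator.mp ha e, map_zero]
        have h2 : Submodule.mkQ (x • (⊤ : Submodule R M)) (a • g) = 0 := by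
          apply E.injective
          rw [map_smul, map_smul, h1, map_zero]
        obtain ⟨m', -, hm'⟩ := (Submodule.mem_smul_pointwise_iff_exists _ _ _).mp
          ((Submodule.Quotient.mk_eq_zero _).mp h2)
        obtain ⟨b, rfl⟩ := hg m'
        have hb : b ∈ 𝔞 := by
          rw [h𝔞, Module.mem_annihilator]
          intro e
          apply hxE
          have h3 : ∀ y : M, (x * b - a) • y = 0 := by
            intro y
            obtain ⟨c, rfl⟩ := hg y
            rw [smul_comm, sub_smul, mul_smul, hm', sub_self, smul_zero]
          have h4 := smul_eq_zero_of_left (N := R) _ h3 i e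
          rwa [sub_smul, Module.mem_annihilator.mp ha e, sub_zero, mul_smul] at h4
        obtain ⟨c, rfl⟩ := hg m
        rw [smul_comm a c g, ← hm', smul_comm c x]
        refine Submodule.smul_mem_smul (Ideal.mem_span_singleton_self x) ?_
        rw [smul_comm c b]
        exact Submodule.smul_mem_smul hb trivial
      have hbot : 𝔞 • (⊤ : Submodule R M) = ⊥ := by
        refine Submodule.eq_bot_of_le_smul_of_le_jacobson_bot (Ideal.span {x}) _
          (IsNoetherian.noetherian _) hstep ?_
        rw [IsLocalRing.jacobson_eq_maximalIdeal ⊥ bot_ne_top, Ideal.span_le]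
        simpa using hx
      intro a ha
      rw [Module.mem_annihilator]
      intro m
      have : a • m ∈ 𝔞 • (⊤ : Submodule R M) := Submodule.smul_mem_smul ha trivial
      rwa [hbot] at this

/-- The canonical module of a Gorenstein quotient. -/
theorem nonempty_quotient_equiv_ext (c : Ideal R) [IsLocalRing (R ⧸ c)]
    (hc : IsGorensteinLocalRing (R ⧸ c)) (rs : List R) (hrs : ∀ r ∈ rs, r ∈ maximalIdeal R)
    (hreg : IsWeaklyRegular (R ⧸ c) rs) (hdim : Module.supportDim R (R ⧸ c) = rs.length)
    (i : ℕ) (hi : i + rs.length = n) : Nonempty ((R ⧸ c) ≃ₗ[R] ExtMod R (R ⧸ c) R i) := by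
  refine nonempty_equiv_ext hR hn _ rs hrs hreg hdim.le (IsCyclicModule.quotient c) ?_ i hi
  have hreg' : IsWeaklyRegular (R ⧸ c) (rs.map (algebraMap R (R ⧸ c))) :=
    (isWeaklyRegular_map_algebraMap_iff (R ⧸ c) (R ⧸ c) rs).mpr hreg
  have hd : ringKrullDim (R ⧸ c) = rs.length := by
    rw [← hdim]
    exact Module.supportDim_quotient_eq_ringKrullDim c |>.symm
  obtain ⟨σ, hσ, h⟩ := hasSimpleSocle_quotient hc hd (rs.map (algebraMap R (R ⧸ c))) (by
    intro r hr
    obtain ⟨r, hr', rfl⟩ := List.mem_map.mp hr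
    have := hrs r hr'
    have hloc := IsLocalHom.of_surjective (Ideal.Quotient.mk c) Ideal.Quotient.mk_surjective
    exact fun h => this (hloc.map_nonunit r h)) hreg' (by simp)
  -- The socle is computed over the ring `R/c`; the sequence generates the same submodule over `R`
  -- and over `R/c`.
  have hmem : ∀ y : R ⧸ c, y ∈ Ideal.ofList rs • (⊤ : Submodule R (R ⧸ c)) ↔
      y ∈ Ideal.ofList (rs.map (algebraMap R (R ⧸ c))) • (⊤ : Submodule (R ⧸ c) (R ⧸ c)) := by
    intro y
    rw [Ideal.smul_top_eq_map, Submodule.restrictScalars_mem, Ideal.map_ofList, smul_eq_mul,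
      Ideal.mul_top]
  obtain ⟨s, rfl⟩ := Submodule.mkQ_surjective _ σ
  refine ⟨Submodule.mkQ _ s, ?_, fun y hy => ?_⟩
  · rw [Submodule.mkQ_apply, Ne, Submodule.Quotient.mk_eq_zero, hmem]
    rwa [Submodule.mkQ_apply, Ne, Submodule.Quotient.mk_eq_zero] at hσ
  · obtain ⟨t, rfl⟩ := Submodule.mkQ_surjective _ y
    rw [Submodule.mkQ_apply, Ne, Submodule.Quotient.mk_eq_zero, hmem] at hy
    obtain ⟨b, hb⟩ := h (Submodule.mkQ _ t) (by
      rwa [Submodule.mkQ_apply, Ne, Submodule.Quotient.mk_eq_zero])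
    obtain ⟨r, rfl⟩ := Ideal.Quotient.mk_surjective b
    refine ⟨r, ?_⟩
    rw [← map_smul] at hb ⊢
    exact (Submodule.Quotient.eq _).mpr ((hmem _).mpr ((Submodule.Quotient.eq _).mp hb))

end Gorenstein

end ExtModule


/-! ### Injective dimension over a quotient ring -/

namespace ExtModule

variable {R : Type u} [CommRing R]

section Torsion

variable (c : Ideal R)

/-- The elements of `M` killed by `c`, a module over `R ⧸ c`. -/
abbrev KilledBy (M : Type u) [AddCommGroup M] [Module R M] : Submodule R M :=
  Submodule.torsionBySet R M (c : Set R)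

variable {M N P : Type u} [AddCommGroup M] [Module R M] [AddCommGroup N] [Module R N]
  [AddCommGroup P] [Module R P]

lemma mem_killedBy {x : M} : x ∈ KilledBy c M ↔ ∀ r ∈ c, r • x = 0 := by
  rw [Submodule.mem_torsionBySet_iff]
  exact Subtype.forall

/-- The map induced on the elements killed by `c`. -/
def killedByMap (f : M →ₗ[R] N) : KilledBy c M →ₗ[R ⧸ c] KilledBy c N :=
  LinearMap.extendScalarsOfSurjective Ideal.Quotient.mk_surjective
    (f.restrict (p := KilledBy c M) (q := KilledBy c N) fun x hx => by
      rw [mem_killedBy] at hx ⊢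
      exact fun r hr => by rw [← map_smul, hx r hr, map_zero])

/-- Elements killed by `c` are homomorphisms from `R ⧸ c`. -/
def killedByEquiv (M : Type u) [AddCommGroup M] [Module R M] :
    KilledBy c M ≃ₗ[R] ((R ⧸ c) →ₗ[R] M) where
  toFun x := Submodule.liftQ c (LinearMap.toSpanSingleton R M x) fun r hr =>
    (mem_killedBy c).mp x.2 r hr
  invFun f := ⟨f (Submodule.mkQ c 1), (mem_killedBy c).mpr fun r hr => by
    rw [← map_smul, ← map_smul, smul_eq_mul, mul_one, Submodule.mkQ_apply,
      (Submodule.Quotient.mk_eq_zero c).mpr hr, map_zero]⟩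
  map_add' x y := Submodule.linearMap_qext _ (LinearMap.ext fun r => smul_add r (x : M) y)
  map_smul' r x := Submodule.linearMap_qext _ (LinearMap.ext fun s => smul_comm s r (x : M))
  left_inv x := Subtype.ext (one_smul R (x : M))
  right_inv f := Submodule.linearMap_qext _ (LinearMap.ext fun r => by
    change r • f (Submodule.mkQ c 1) = f (Submodule.mkQ c r)
    rw [← map_smul, ← map_smul, smul_eq_mul, mul_one])

lemma killedByEquiv_map (f : M →ₗ[R] N) (x : KilledBy c M) :
    killedByEquiv c N (killedByMap c f x) = f ∘ₗ killedByEquiv c M x :=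
  Submodule.linearMap_qext _ (LinearMap.ext fun r => (map_smul f r (x : M)).symm)

/-- Elements killed by `c` are elements of `Ext^0(R ⧸ c, M)`. -/
noncomputable def killedByExt (M : Type u) [AddCommGroup M] [Module R M] :
    KilledBy c M ≃ₗ[R] ExtMod R (R ⧸ c) M 0 :=
  (killedByEquiv c M).trans (homEquiv (R ⧸ c) M).symm

lemma killedByExt_map (f : M →ₗ[R] N) (x : KilledBy c M) :
    killedByExt c N (killedByMap c f x) = post (R ⧸ c) f 0 (killedByExt c M x) := by
  apply (homEquiv (R ⧸ c) N).injective
  rw [homEquiv_post]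
  simp [killedByExt, killedByEquiv_map]

/-- This is the fact that `Hom(R/c, -)` preserves injectives: an extension over `R` of a map from an
`R/c`-module to an `R/c`-module lands in the elements killed by `c`. -/
lemma killedBy_injective [hM : Module.Injective R M] :
    Injective (ModuleCat.of (R ⧸ c) (KilledBy c M)) := by
  have : Module.Injective (R ⧸ c) (KilledBy c M) := by
    refine ⟨fun X Y _ _ _ _ i hi g => ?_⟩
    let _ : Module R X := Module.compHom X (Ideal.Quotient.mk c)
    let _ : Module R Y := Module.compHom Y (Ideal.Quotient.mk c)
    have hX : ∀ (r : R) (x : X), r • x = Ideal.Quotient.mk c r • x := fun _ _ => rfl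
    have hY : ∀ (r : R) (x : Y), r • x = Ideal.Quotient.mk c r • x := fun _ _ => rfl
    let i' : X →ₗ[R] Y :=
      { toFun := i
        map_add' := map_add i
        map_smul' := fun r x => (map_smul i (Ideal.Quotient.mk c r) x) }
    let g' : X →ₗ[R] M :=
      { toFun := fun x => g x
        map_add' := fun x y => by rw [map_add]; rfl
        map_smul' := fun r x => by rw [hX, map_smul]; rfl }
    obtain ⟨h, hh⟩ := hM.out i' hi g'
    have hmem : ∀ y : Y, h y ∈ KilledBy c M := fun y => (mem_killedBy c).mpr fun r hr => by
      rw [← map_smul, hY, Ideal.Quotient.eq_zero_iff_mem.mpr hr, zero_smul, map_zero]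
    refine ⟨{ toFun := fun y => ⟨h y, hmem y⟩
              map_add' := fun x y => Subtype.ext (map_add h x y)
              map_smul' := fun r y => ?_ }, fun x => Subtype.ext (hh x)⟩
    obtain ⟨r, rfl⟩ := Ideal.Quotient.mk_surjective r
    ext
    exact map_smul h r y
  exact Module.injective_object_of_injective_module _ _

section Exact

variable {f : M →ₗ[R] N} {g : N →ₗ[R] P} (hf : Function.Injective f)
  (hg : Function.Surjective g) (h : Function.Exact f g)

include hf in
lemma killedByMap_injective : Function.Injective (killedByMap c f) :=
  fun _ _ hxy => Subtype.ext (hf (congrArg Subtype.val hxy))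

include hf h in
lemma killedByMap_exact : Function.Exact (killedByMap c f) (killedByMap c g) := by
  intro y
  refine ⟨fun hy => ?_, ?_⟩
  · obtain ⟨x, hx⟩ := (h y).mp (congrArg Subtype.val hy)
    refine ⟨⟨x, (mem_killedBy c).mpr fun r hr => hf ?_⟩, Subtype.ext hx⟩
    rw [map_smul, hx, map_zero, (mem_killedBy c).mp y.2 r hr]
  · rintro ⟨x, rfl⟩
    exact Subtype.ext ((h _).mpr ⟨x, rfl⟩)

lemma killedByExt_exact :
    Function.Exact (killedByMap c g) (postδ (R ⧸ c) hf hg h 0 ∘ₗ (killedByExt c P).toLinearMap) := by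
  intro y
  have h1 := post_postδ_exact (M := R ⧸ c) hf hg h 0 (killedByExt c P y)
  refine h1.trans ⟨?_, ?_⟩
  · rintro ⟨e, he⟩
    obtain ⟨x, rfl⟩ := (killedByExt c N).surjective e
    exact ⟨x, (killedByExt c P).injective (by rw [killedByExt_map, he])⟩
  · rintro ⟨x, rfl⟩
    exact ⟨killedByExt c N x, (killedByExt_map c g x).symm⟩

include hf hg h in
lemma killedByMap_surjective [Subsingleton (ExtMod R (R ⧸ c) M 1)] :
    Function.Surjective (killedByMap c g) := fun y =>
  (killedByExt_exact c hf hg h y).mp (Subsingleton.elim (α := ExtMod R (R ⧸ c) M 1) _ _)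

end Exact

/-- An embedding of a module into an injective module, with its cokernel. -/
lemma exists_injective_embedding {R : Type u} [CommRing R] (M : Type u) [AddCommGroup M] [Module R M] :
    ∃ (E P : ModuleCat.{u} R) (f : M →ₗ[R] E) (g : E →ₗ[R] P), Function.Injective f ∧
      Function.Surjective g ∧ Function.Exact f g ∧ Injective (ModuleCat.of R E) := by
  obtain ⟨E, _, f, _⟩ := EnoughInjectives.presentation (ModuleCat.of R M)
  exact ⟨E, ModuleCat.of R (E ⧸ LinearMap.range f.hom), f.hom, Submodule.mkQ _,
    (ModuleCat.mono_iff_injective f).mp ‹_›, Submodule.mkQ_surjective _,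
    LinearMap.exact_map_mkQ_range f.hom, ‹_›⟩

lemma killedBy_injective_of_injective (E : Type u) [AddCommGroup E] [Module R E]
    [Injective (ModuleCat.of R E)] :
    Injective (ModuleCat.of (R ⧸ c) (KilledBy c E)) :=
  have : Module.Injective R E := Module.injective_module_of_injective_object R E
  killedBy_injective c

/-- Taking elements killed by `c` keeps `0 → M → E → P → 0` exact, because the obstruction lies in
`Ext^1(R/c, M) = 0`, and the vanishing of the higher Ext modules passes to `P`. -/
lemma killedBy_injectiveDimensionLE (n : ℕ) (M : Type u) [AddCommGroup M] [Module R M]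
    (hM : HasInjectiveDimensionLE (ModuleCat.of R M) n)
    (hv : ∀ i, Subsingleton (ExtMod R (R ⧸ c) M (i + 1))) :
    HasInjectiveDimensionLE (ModuleCat.of (R ⧸ c) (KilledBy c M)) n := by
  induction n generalizing M with
  | zero =>
    have : HasInjectiveDimensionLT (ModuleCat.of R M) 1 := hM
    have : Injective (ModuleCat.of R M) := inferInstance
    have := killedBy_injective_of_injective c M
    change HasInjectiveDimensionLT _ 1
    infer_instance
  | succ n ih =>
    obtain ⟨E, P, f, g, hf, hg, hex, hE⟩ := exists_injective_embedding (R := R) M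
    have hEv : ∀ i, Subsingleton (ExtMod R (R ⧸ c) E (i + 1)) := fun i =>
      Ext.subsingleton_of_injective _ _ _
    have hE' := killedBy_injective_of_injective c E
    have hP := ih P (((shortExact hf hg hex).hasInjectiveDimensionLT_X₃_iff n hE).mpr hM) fun i =>
      subsingleton_of_forall_eq 0 fun e => by
        obtain ⟨e', rfl⟩ := (post_postδ_exact (M := R ⧸ c) hf hg hex (i + 1) e).mp
          ((hv (i + 1)).elim _ _)
        rw [(hEv i).elim e' 0, map_zero]
    have := hv 0
    exact ((shortExact (killedByMap_injective c hf) (killedByMap_surjective c hf hg hex)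
      (killedByMap_exact c hf hex)).hasInjectiveDimensionLT_X₃_iff n hE').mp hP

/-- After `Hom(R/c, -)` an injective resolution of `M` is a complex of injective `R/c`-modules whose
only positive cohomology is `Ext^(m+1)(R/c, M)`. Starting from an injective kernel, all images
before that place are injective, so what remains resolves the cohomology. The module `X` is
`Ext^(m+1)(R/c, M)` with an explicit action of `R/c`. -/
lemma exists_module_quotient (m n : ℕ) (M : Type u) [AddCommGroup M] [Module R M]
    (hM : HasInjectiveDimensionLE (ModuleCat.of R M) n)
    (hv : ∀ i, i ≠ m → Subsingleton (ExtMod R (R ⧸ c) M (i + 1)))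
    (hinj : Injective (ModuleCat.of (R ⧸ c) (KilledBy c M))) :
    ∃ (X : Type u) (_ : AddCommGroup X) (_ : Module R X) (_ : Module (R ⧸ c) X)
      (_ : IsScalarTower R (R ⧸ c) X), Nonempty (X ≃ₗ[R] ExtMod R (R ⧸ c) M (m + 1)) ∧
        HasInjectiveDimensionLE (ModuleCat.of (R ⧸ c) X) n := by
  induction m generalizing M with
  | zero =>
    obtain ⟨E, P, f, g, hf, hg, hex, hE⟩ := exists_injective_embedding (R := R) M
    have hEv : ∀ i, Subsingleton (ExtMod R (R ⧸ c) E (i + 1)) := fun i =>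
      Ext.subsingleton_of_injective _ _ _
    have hE' := killedBy_injective_of_injective c E
    have hP := killedBy_injectiveDimensionLE c n P
      ((shortExact hf hg hex).hasInjectiveDimensionLT_X₃ (n + 1)
        (hasInjectiveDimensionLT_of_ge (ModuleCat.of R E) 1 (n + 1) (by omega))
        (hasInjectiveDimensionLT_of_ge _ (n + 1) (n + 2) (by omega))) fun i =>
      subsingleton_of_forall_eq 0 fun e => by
        obtain ⟨e', rfl⟩ := (post_postδ_exact (M := R ⧸ c) hf hg hex (i + 1) e).mp
          ((hv (i + 1) (by omega)).elim _ _)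
        rw [(hEv i).elim e' 0, map_zero]
    -- The image `Q` is a quotient of an injective module by an injective submodule, hence
    -- injective, and `Ext^1(R/c, M)` is `KilledBy c P` modulo `Q`.
    set Q := LinearMap.range (killedByMap c g) with hQ
    have hQi : HasInjectiveDimensionLT (ModuleCat.of (R ⧸ c) Q) 1 :=
      (shortExact (killedByMap_injective c hf) (killedByMap c g).surjective_rangeRestrict
        (by
          intro y
          rw [← killedByMap_exact c hf hex y]
          exact Subtype.ext_iff)).hasInjectiveDimensionLT_X₃ 1 inferInstance
        (hasInjectiveDimensionLT_of_ge _ 1 2 (by omega))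
    have hsurj : Function.Surjective
        (postδ (R ⧸ c) hf hg hex 0 ∘ₗ (killedByExt c P).toLinearMap) := by
      intro e
      obtain ⟨e', rfl⟩ := (postδ_post_exact (M := R ⧸ c) hf hg hex 0 e).mp ((hEv 0).elim _ _)
      obtain ⟨x, rfl⟩ := (killedByExt c P).surjective e'
      exact ⟨x, rfl⟩
    have hker : Q.restrictScalars R =
        LinearMap.ker (postδ (R ⧸ c) hf hg hex 0 ∘ₗ (killedByExt c P).toLinearMap) := by
      ext y
      exact (killedByExt_exact c hf hg hex y).symm
    refine ⟨KilledBy c P ⧸ Q, inferInstance, inferInstance, inferInstance, inferInstance,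
      ⟨(Submodule.Quotient.restrictScalarsEquiv R Q).symm.trans
        ((Submodule.quotEquivOfEq _ _ hker).trans (LinearMap.quotKerEquivOfSurjective _ hsurj))⟩, ?_⟩
    exact (shortExact (Submodule.subtype_injective Q) (Submodule.mkQ_surjective Q)
      (LinearMap.exact_subtype_mkQ Q)).hasInjectiveDimensionLT_X₃ (n + 1) hP
        (hasInjectiveDimensionLT_of_ge _ 1 (n + 2) (by omega))
  | succ m ih =>
    obtain ⟨E, P, f, g, hf, hg, hex, hE⟩ := exists_injective_embedding (R := R) M
    have hEv : ∀ i, Subsingleton (ExtMod R (R ⧸ c) E (i + 1)) := fun i =>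
      Ext.subsingleton_of_injective _ _ _
    have hE' := killedBy_injective_of_injective c E
    have hP := (shortExact hf hg hex).hasInjectiveDimensionLT_X₃ (n + 1)
        (hasInjectiveDimensionLT_of_ge (ModuleCat.of R E) 1 (n + 1) (by omega))
        (hasInjectiveDimensionLT_of_ge _ (n + 1) (n + 2) (by omega))
    have h1 := hv 0 (by omega)
    have hPi : HasInjectiveDimensionLT (ModuleCat.of (R ⧸ c) (KilledBy c P)) 1 :=
      (shortExact (killedByMap_injective c hf) (killedByMap_surjective c hf hg hex)
        (killedByMap_exact c hf hex)).hasInjectiveDimensionLT_X₃ 1 inferInstance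
          (hasInjectiveDimensionLT_of_ge _ 1 2 (by omega))
    obtain ⟨X, _, _, _, _, ⟨e⟩, hX⟩ := ih P hP (fun i hi =>
      subsingleton_of_forall_eq 0 fun e => by
        obtain ⟨e', rfl⟩ := (post_postδ_exact (M := R ⧸ c) hf hg hex (i + 1) e).mp
          ((hv (i + 1) (by omega)).elim _ _)
        rw [(hEv i).elim e' 0, map_zero]) inferInstance
    refine ⟨X, inferInstance, inferInstance, inferInstance, inferInstance, ⟨e.trans
      (LinearEquiv.ofBijective (postδ (R ⧸ c) hf hg hex (m + 1)) ⟨?_, fun y => ?_⟩)⟩, hX⟩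
    · rw [← LinearMap.ker_eq_bot, LinearMap.ker_eq_bot']
      intro a ha
      obtain ⟨b, rfl⟩ := (post_postδ_exact (M := R ⧸ c) hf hg hex (m + 1) a).mp ha
      rw [(hEv m).elim b 0, map_zero]
    · exact (postδ_post_exact (M := R ⧸ c) hf hg hex (m + 1) y).mp ((hEv (m + 1)).elim _ _)

/-- If `R ⧸ c` is its own dualizing module, then it has finite injective dimension over itself. -/
theorem exists_injectiveDimensionLE_quotient {n m : ℕ}
    (hR : HasInjectiveDimensionLE (ModuleCat.of R R) n)
    (hv : ∀ i, i ≠ m → Subsingleton (ExtMod R (R ⧸ c) R i))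
    (e : (R ⧸ c) ≃ₗ[R] ExtMod R (R ⧸ c) R m) :
    ∃ n', HasInjectiveDimensionLE (ModuleCat.of (R ⧸ c) (R ⧸ c)) n' := by
  refine ⟨n, ?_⟩
  rcases m with _ | m
  · have e' : KilledBy c R ≃ₗ[R ⧸ c] (R ⧸ c) := LinearEquiv.extendScalarsOfSurjective
      Ideal.Quotient.mk_surjective ((killedByExt c R).trans e.symm)
    have := killedBy_injectiveDimensionLE c n R hR fun i => hv (i + 1) (by omega)
    exact hasInjectiveDimensionLT_of_iso e'.toModuleIso (n + 1)
  -- In positive codimension `Hom(R/c, R) = 0`, and the zero module is an injective starting point.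
  -- In codimension zero it is `R/c` itself.
  · have h0 := hv 0 (by omega)
    have : Subsingleton (KilledBy c R) := (killedByExt c R).toEquiv.subsingleton
    have hz : Limits.IsZero (ModuleCat.of (R ⧸ c) (KilledBy c R)) :=
      ModuleCat.isZero_of_subsingleton _
    obtain ⟨X, _, _, _, _, ⟨E⟩, hX⟩ := exists_module_quotient c m n R hR
      (fun i hi => hv (i + 1) (by omega)) hz.injective
    have e' : X ≃ₗ[R ⧸ c] (R ⧸ c) := LinearEquiv.extendScalarsOfSurjective
      Ideal.Quotient.mk_surjective (E.trans e.symm)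
    have : HasInjectiveDimensionLT (ModuleCat.of (R ⧸ c) X) (n + 1) := hX
    exact hasInjectiveDimensionLT_of_iso e'.toModuleIso (n + 1)

end Torsion

end ExtModule


/-! ### Linkage of ideals -/

namespace ExtModule

open scoped Pointwise
open RingTheory.Sequence IsLocalRing

variable {R : Type u} [CommRing R]

/-- Non-zero submodules of a module of depth at least `t` have dimension at least `t`. -/
theorem length_le_supportDim_submodule [IsLocalRing R] [IsNoetherianRing R] (C : Type u)
    [AddCommGroup C] [Module R C] [Module.Finite R C] (rs : List R)
    (hrs : ∀ r ∈ rs, r ∈ maximalIdeal R) (hreg : IsWeaklyRegular C rs) (N : Submodule R C)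
    (hN : N ≠ ⊥) : (rs.length : WithBot ℕ∞) ≤ Module.supportDim R N := by
  induction rs generalizing C with
  | nil =>
    have := Submodule.nontrivial_iff_ne_bot.mpr hN
    exact supportDim_nonneg R N
  | cons x rs ih =>
    have hx := hrs x List.mem_cons_self
    rw [isWeaklyRegular_cons_iff] at hreg
    -- Replace `N` by a maximal non-zero submodule `P` of no larger dimension. Multiplication by `x`
    -- embeds `{y | x • y ∈ P}` into `P`, so maximality makes `P` saturated for `x`. Then `P/xP`
    -- embeds in `C/xC`, and the induction applies there.
    obtain ⟨P, ⟨hP0, hPd⟩, hPmax⟩ := WellFounded.has_min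
      (r := ((· > ·) : Submodule R C → Submodule R C → Prop)) (wellFounded_gt)
      {P : Submodule R C | P ≠ ⊥ ∧ Module.supportDim R P ≤ Module.supportDim R N} ⟨N, hN, le_rfl⟩
    have hsat : ∀ y : C, x • y ∈ P → y ∈ P := by
      set P' := P.comap (x • (LinearMap.id : C →ₗ[R] C)) with hP'
      have hle : P ≤ P' := fun y hy => P.smul_mem x hy
      have hd : Module.supportDim R P' ≤ Module.supportDim R P := by
        refine Module.supportDim_le_of_injective
          ((x • (LinearMap.id : C →ₗ[R] C)).restrict (p := P') (q := P) fun y hy => hy) ?_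
        intro a b hab
        exact Subtype.ext (hreg.1 (congrArg Subtype.val hab))
      have hnot := hPmax P' ⟨fun h => hP0 (le_bot_iff.mp (h ▸ hle)), hd.trans hPd⟩
      have : P' = P := by
        by_contra hne
        exact hnot (lt_of_le_of_ne hle (Ne.symm hne))
      intro y hy
      rw [← this]
      exact hy
    have hPn := Submodule.nontrivial_iff_ne_bot.mpr hP0
    have hregP : IsSMulRegular P x := hreg.1.submodule P x
    have hinj : Function.Injective (QuotSMulTop.map x P.subtype) := by
      rw [← LinearMap.ker_eq_bot, LinearMap.ker_eq_bot']
      intro y hy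
      obtain ⟨p, rfl⟩ := Submodule.mkQ_surjective _ y
      have hy' : Submodule.mkQ (x • (⊤ : Submodule R C)) (p : C) = 0 := hy
      obtain ⟨z, -, hz⟩ := (Submodule.mem_smul_pointwise_iff_exists _ _ _).mp
        ((Submodule.Quotient.mk_eq_zero _).mp hy')
      refine (Submodule.Quotient.mk_eq_zero _).mpr
        ((Submodule.mem_smul_pointwise_iff_exists _ _ _).mpr ⟨⟨z, hsat z ?_⟩, trivial, ?_⟩)
      · rw [hz]; exact p.2
      · exact Subtype.ext hz
    have hne : LinearMap.range (QuotSMulTop.map x P.subtype) ≠ ⊥ := by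
      intro h0
      rw [LinearMap.range_eq_bot] at h0
      have hz : ∀ p : P, ∃ p', x • p' = p := by
        intro p
        have h1 : Submodule.mkQ (x • (⊤ : Submodule R P)) p = 0 :=
          hinj (by rw [h0]; rfl)
        obtain ⟨z, -, hz⟩ := (Submodule.mem_smul_pointwise_iff_exists _ _ _).mp
          ((Submodule.Quotient.mk_eq_zero _).mp h1)
        exact ⟨z, hz⟩
      exact not_subsingleton P (subsingleton_of_smul_surjective hx hz)
    have h1 := ih (QuotSMulTop x C) (fun r hr => hrs r (List.mem_cons_of_mem x hr)) hreg.2 _ hne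
    rw [← Module.supportDim_eq_of_equiv (LinearEquiv.ofInjective _ hinj)] at h1
    refine le_trans ?_ hPd
    rw [← Module.supportDim_quotSMulTop_succ_eq_supportDim hregP hx]
    push_cast [List.length_cons]
    gcongr

/-! ### Extension classes restricted to ideals of `R ⧸ c` -/

section Vanishing

variable [IsNoetherianRing R] {c : Ideal R} {n : ℕ}
  (hv : ∀ j < n, Subsingleton (ExtMod R (R ⧸ c) R j))

omit [IsNoetherianRing R] in
lemma subsingleton_ext_pi {M N : Type u} [AddCommGroup M] [Module R M] [AddCommGroup N] [Module R N]
    (j k : ℕ) [h : Subsingleton (ExtMod R M N j)] : Subsingleton (ExtMod R (Fin k → M) N j) := by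
  refine subsingleton_of_forall_eq 0 fun e => ?_
  have hid : (LinearMap.id : (Fin k → M) →ₗ[R] (Fin k → M)) =
      ∑ i, LinearMap.single R (fun _ => M) i ∘ₗ LinearMap.proj i := by
    ext i x j
    simp [Pi.single_apply]
  rw [← pre_id j e, hid, pre_sum]
  refine Finset.sum_eq_zero fun i _ => ?_
  rw [pre_comp_apply, h.elim (pre N (LinearMap.single R (fun _ => M) i) j e) 0, map_zero]

omit [IsNoetherianRing R] in
lemma ext_pi_eq_zero {M N : Type u} [AddCommGroup M] [Module R M] [AddCommGroup N] [Module R N]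
    {j k : ℕ} (e : ExtMod R (Fin k → M) N j)
    (h : ∀ i, pre N (LinearMap.single R (fun _ => M) i) j e = 0) : e = 0 := by
  have hid : (LinearMap.id : (Fin k → M) →ₗ[R] (Fin k → M)) =
      ∑ i, LinearMap.single R (fun _ => M) i ∘ₗ LinearMap.proj i := by
    ext i x j
    simp [Pi.single_apply]
  rw [← pre_id j e, hid, pre_sum]
  refine Finset.sum_eq_zero fun i _ => ?_
  rw [pre_comp_apply, h, map_zero]

omit [IsNoetherianRing R] in
/-- A finitely generated module killed by `c` is a quotient of a finite power of `R ⧸ c`. -/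
lemma exists_surjective_of_killed (N : Type u) [AddCommGroup N] [Module R N] [Module.Finite R N]
    (hN : ∀ r ∈ c, ∀ x : N, r • x = 0) :
    ∃ (k : ℕ) (p : (Fin k → R ⧸ c) →ₗ[R] N), Function.Surjective p := by
  obtain ⟨k, q, hq⟩ := Module.Finite.exists_fin' R N
  let t : Fin k → (R ⧸ c) →ₗ[R] N := fun i =>
    Submodule.liftQ c (q ∘ₗ LinearMap.single R (fun _ => R) i) fun r hr => by
      rw [LinearMap.mem_ker]
      have : r = r • (1 : R) := by simp
      rw [this, map_smul, hN r hr]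
  refine ⟨k, ∑ i, t i ∘ₗ LinearMap.proj i, fun y => ?_⟩
  obtain ⟨a, rfl⟩ := hq y
  refine ⟨fun i => Submodule.mkQ c (a i), ?_⟩
  rw [LinearMap.sum_apply]
  conv_rhs => rw [← LinearMap.sum_single_apply (fun _ : Fin k => R) a, map_sum]
  rfl

include hv in
-- The kernel of a cover by a power of `R/c` is again killed by `c`, so dimension shifting descends
-- to Hom. The argument works over any Noetherian ring and serves the local and the graded case
-- alike.
lemma ext_subsingleton_of_killed (j : ℕ) (hj : j < n) (N : Type u) [AddCommGroup N] [Module R N]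
    [Module.Finite R N] (hN : ∀ r ∈ c, ∀ x : N, r • x = 0) : Subsingleton (ExtMod R N R j) := by
  induction j generalizing N with
  | zero =>
    obtain ⟨k, p, hp⟩ := exists_surjective_of_killed N hN
    have := hv 0 hj
    have := subsingleton_ext_pi (R := R) (M := R ⧸ c) (N := R) 0 k
    exact (pre_injective_zero (N := R) hp).subsingleton
  | succ j ih =>
    obtain ⟨k, p, hp⟩ := exists_surjective_of_killed N hN
    have := hv (j + 1) hj
    have := subsingleton_ext_pi (R := R) (M := R ⧸ c) (N := R) (j + 1) k
    have := ih (by omega) (LinearMap.ker p) fun r hr x => Subtype.ext (funext fun i => by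
      obtain ⟨a, ha⟩ := Submodule.mkQ_surjective c (x.1 i)
      change r • x.1 i = 0
      rw [← ha, ← map_smul]
      exact (Submodule.Quotient.mk_eq_zero c).mpr (Ideal.mul_mem_right _ _ hr))
    refine subsingleton_of_forall_eq 0 fun e => ?_
    obtain ⟨b, rfl⟩ := (preδ_pre_exact (N := R) (Submodule.subtype_injective _) hp
      (LinearMap.exact_subtype_ker_map p) j e).mp (Subsingleton.elim _ _)
    rw [Subsingleton.elim b 0, map_zero]

include hv in
-- The obstruction is `Ext^(n-1)` of the kernel of `p`, which is killed by `c`.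
lemma pre_injective_of_killed {M N : Type u} [AddCommGroup M] [Module R M] [AddCommGroup N]
    [Module R N] [Module.Finite R M] (hM : ∀ r ∈ c, ∀ x : M, r • x = 0) (p : M →ₗ[R] N)
    (hp : Function.Surjective p) : Function.Injective (pre R p n) := by
  rcases Nat.eq_zero_or_pos n with h0 | h0
  · subst h0
    exact pre_injective_zero hp
  · obtain ⟨m, rfl⟩ := Nat.exists_eq_succ_of_ne_zero h0.ne'
    rw [← LinearMap.ker_eq_bot, LinearMap.ker_eq_bot']
    intro a ha
    have := ext_subsingleton_of_killed hv m (by omega) (LinearMap.ker p) fun r hr x =>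
      Subtype.ext (hM r hr x)
    obtain ⟨b, rfl⟩ := (preδ_pre_exact (N := R) (Submodule.subtype_injective _) hp
      (LinearMap.exact_subtype_ker_map p) m a).mp ha
    rw [Subsingleton.elim b 0, map_zero]

omit [IsNoetherianRing R] in
lemma smul_quotient_eq_zero {r : R} (hr : r ∈ c) (y : R ⧸ c) : r • y = 0 := by
  obtain ⟨y, rfl⟩ := Submodule.mkQ_surjective _ y
  rw [← map_smul]
  exact (Submodule.Quotient.mk_eq_zero _).mpr (Ideal.mul_mem_right _ _ hr)

omit [IsNoetherianRing R] in
lemma smul_mkQ_eq (r a : R) : r • c.mkQ a = a • c.mkQ r := by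
  rw [← map_smul, ← map_smul, smul_eq_mul, smul_eq_mul, mul_comm]

include hv in
/-- The restriction of an extension class to an ideal `P` of `R ⧸ c` vanishes iff it is killed by
this ideal. -/
lemma pre_subtype_eq_zero_iff (P : Submodule R (R ⧸ c)) (e : ExtMod R (R ⧸ c) R n) :
    pre R P.subtype n e = 0 ↔ ∀ r : R, c.mkQ r ∈ P → r • e = 0 := by
  -- Multiplication by an element of the ideal `P` factors through `P`.
  have hmul : ∀ r : R, ∀ hr : c.mkQ r ∈ P, ∃ f : (R ⧸ c) →ₗ[R] P,
      P.subtype ∘ₗ f = r • LinearMap.id ∧ f (c.mkQ 1) = ⟨c.mkQ r, hr⟩ := by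
    intro r hr
    refine ⟨LinearMap.codRestrict P (r • LinearMap.id) fun y => ?_, rfl, Subtype.ext ?_⟩
    · obtain ⟨a, rfl⟩ := Submodule.mkQ_surjective _ y
      change r • c.mkQ a ∈ P
      rw [smul_mkQ_eq]
      exact P.smul_mem a hr
    · change r • c.mkQ 1 = c.mkQ r
      rw [smul_mkQ_eq, one_smul]
  constructor
  · intro he r hr
    obtain ⟨f, hf, -⟩ := hmul r hr
    rw [← pre_smul_id, ← hf, pre_comp_apply, he, map_zero]
  · intro h
    -- Cover `P` by a power of `R/c`. The induced map on `Ext^n` is injective, so the restriction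
    -- can be tested on each summand, where `R/c → P → R/c` is multiplication by some `r` with class
    -- in `P`.
    obtain ⟨k, p, hp⟩ := exists_surjective_of_killed (c := c) P
      fun r hr x => Subtype.ext (smul_quotient_eq_zero hr _)
    have hinj := pre_injective_of_killed (R := R) hv (M := Fin k → R ⧸ c) (N := P)
      (fun r hr x => funext fun i => smul_quotient_eq_zero hr (x i)) p hp
    apply hinj
    rw [map_zero]
    refine ext_pi_eq_zero _ fun i => ?_
    obtain ⟨r, hr⟩ := Submodule.mkQ_surjective c (p (LinearMap.single R (fun _ => R ⧸ c) i (c.mkQ 1)))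
    have hrP : c.mkQ r ∈ P := by rw [hr]; exact Subtype.mem _
    obtain ⟨f, hf, hf1⟩ := hmul r hrP
    have hfp : p ∘ₗ LinearMap.single R (fun _ => R ⧸ c) i = f := by
      refine Submodule.linearMap_qext _ (LinearMap.ext_ring ?_)
      change p (LinearMap.single R (fun _ => R ⧸ c) i (c.mkQ 1)) = f (c.mkQ 1)
      rw [hf1]
      exact Subtype.ext hr.symm
    rw [← pre_comp_apply, hfp, ← pre_comp_apply, hf, pre_smul_id, h r hrP]

omit [IsNoetherianRing R] in
-- The surjection `φ` need not be the canonical one, but it sends `1` to a generator of `R/I`, whose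
-- annihilator is `I`.
lemma mkQ_mem_ker_iff {I : Ideal R} {φ : (R ⧸ c) →ₗ[R] (R ⧸ I)} (hφ : LinearMap.range φ = ⊤)
    (r : R) : c.mkQ r ∈ LinearMap.ker φ ↔ r ∈ I := by
  have h1 : c.mkQ r = r • c.mkQ 1 := by rw [← map_smul, smul_eq_mul, mul_one]
  rw [LinearMap.mem_ker, h1, map_smul]
  refine ⟨fun h => ?_, fun h => smul_quotient_eq_zero h _⟩
  obtain ⟨y, hy⟩ := LinearMap.range_eq_top.mp hφ (I.mkQ 1)
  obtain ⟨a, rfl⟩ := Submodule.mkQ_surjective c y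
  have h2 : c.mkQ a = a • c.mkQ 1 := by rw [← map_smul, smul_eq_mul, mul_one]
  rw [h2, map_smul] at hy
  have h3 : I.mkQ r = 0 := by
    rw [show I.mkQ r = r • I.mkQ 1 by rw [← map_smul, smul_eq_mul, mul_one], ← hy, smul_comm, h,
      smul_zero]
  exact (Submodule.Quotient.mk_eq_zero I).mp h3

omit [IsNoetherianRing R] in
lemma le_of_range_eq_top {I : Ideal R} {φ : (R ⧸ c) →ₗ[R] (R ⧸ I)} (hφ : LinearMap.range φ = ⊤) :
    c ≤ I := fun r hr => (mkQ_mem_ker_iff hφ r).mp (by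
  rw [Submodule.mkQ_apply, (Submodule.Quotient.mk_eq_zero c).mpr hr]; exact zero_mem _)

include hv in
-- The class `α(a)` restricts to zero on `I/c` iff every `r ∈ I` kills it, that is, iff `r * a ∈ c`
-- because `α` is injective. The kernel of the linking map is therefore `(c : I)/c`, for any choice
-- of `α` and `φ`.
lemma linkingMap_mkQ_eq_zero_iff {I : Ideal R} (α : (R ⧸ c) ≃ₗ[R] ExtRing R (R ⧸ c) n)
    (φ : (R ⧸ c) →ₗ[R] (R ⧸ I)) (hφ : LinearMap.range φ = ⊤) (a : R) :
    linkingMap α φ (c.mkQ a) = 0 ↔ a ∈ c.colon (I : Set R) := by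
  have h1 := pre_subtype_eq_zero_iff hv (LinearMap.ker φ) (α (c.mkQ a))
  refine h1.trans ?_
  rw [Submodule.mem_colon]
  refine forall_congr' fun r => imp_congr (mkQ_mem_ker_iff hφ r) ?_
  rw [← map_smul, ← map_smul, LinearEquiv.map_eq_zero_iff, Submodule.mkQ_apply,
    Submodule.Quotient.mk_eq_zero, smul_eq_mul, smul_eq_mul, mul_comm]

include hv in
/-- The ideal linked to `I` is `c : I`. -/
theorem colon_eq_of_linkingMap {I J : Ideal R} (α : (R ⧸ c) ≃ₗ[R] ExtRing R (R ⧸ c) n)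
    (φ : (R ⧸ c) →ₗ[R] (R ⧸ I)) (hφ : LinearMap.range φ = ⊤)
    (e : (R ⧸ J) ≃ₗ[R] LinearMap.range (linkingMap α φ)) : c.colon (I : Set R) = J := by
  -- Isomorphic modules have the same annihilator, and the image of the linking map is generated by
  -- the image of `1`.
  rw [← Ideal.annihilator_quotient (I := J), e.annihilator_eq]
  ext a
  rw [Module.mem_annihilator]
  constructor
  · rintro ha ⟨_, y, rfl⟩
    obtain ⟨b, rfl⟩ := Submodule.mkQ_surjective c y
    refine Subtype.ext ?_
    change a • linkingMap α φ (c.mkQ b) = 0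
    rw [← map_smul, smul_mkQ_eq, map_smul, (linkingMap_mkQ_eq_zero_iff hv α φ hφ a).mpr ha,
      smul_zero]
  · intro h
    rw [← linkingMap_mkQ_eq_zero_iff hv α φ hφ a]
    have h1 := congrArg Subtype.val (h ⟨_, c.mkQ 1, rfl⟩)
    change a • linkingMap α φ (c.mkQ 1) = 0 at h1
    rwa [← map_smul, smul_mkQ_eq, one_smul] at h1

include hv in
-- The formula on residue classes is kept because it later shows that the isomorphism respects the
-- gradings.
theorem exists_equiv_range_linkingMap {I J : Ideal R} (α : (R ⧸ c) ≃ₗ[R] ExtRing R (R ⧸ c) n)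
    (φ : (R ⧸ c) →ₗ[R] (R ⧸ I)) (hφ : LinearMap.range φ = ⊤) (h : c.colon (I : Set R) = J) :
    ∃ e : (R ⧸ J) ≃ₗ[R] LinearMap.range (linkingMap α φ),
      ∀ a, (e (J.mkQ a)).1 = linkingMap α φ (c.mkQ a) := by
  have hk : J = LinearMap.ker ((linkingMap α φ).rangeRestrict ∘ₗ c.mkQ) := by
    ext a
    rw [← h, ← linkingMap_mkQ_eq_zero_iff hv α φ hφ a, LinearMap.mem_ker]
    exact ⟨fun h => Subtype.ext h, fun h => congrArg Subtype.val h⟩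
  refine ⟨(Submodule.quotEquivOfEq _ _ hk).trans (LinearMap.quotKerEquivOfSurjective _
    ((linkingMap α φ).surjective_rangeRestrict.comp (Submodule.mkQ_surjective c))), fun a => rfl⟩

end Vanishing

end ExtModule


/-! ### Dimensions of linked ideals -/

namespace ExtModule

open scoped Pointwise
open RingTheory.Sequence IsLocalRing

variable {R : Type u} [CommRing R]

lemma supportDim_le_of_killed [IsNoetherianRing R] (I : Ideal R) (P : Type u) [AddCommGroup P]
    [Module R P] [Module.Finite R P] (h : ∀ r ∈ I, ∀ x : P, r • x = 0) :
    Module.supportDim R P ≤ Module.supportDim R (R ⧸ I) := by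
  have hle : I ≤ Module.annihilator R P := fun r hr => Module.mem_annihilator.mpr (h r hr)
  rw [Module.supportDim_eq_ringKrullDim_quotient_annihilator,
    Module.supportDim_quotient_eq_ringKrullDim]
  exact ringKrullDim_le_of_surjective (Ideal.Quotient.factor hle)
    (Ideal.Quotient.factor_surjective hle)

lemma le_colon (c : Ideal R) (S : Set R) : c ≤ c.colon S := fun r hr =>
  Submodule.mem_colon.mpr fun s _ => by
    rw [smul_eq_mul]
    exact Ideal.mul_mem_right s c hr

/-- Ideals linked by `c` have the same dimension as `c`. -/
lemma supportDim_quotient_colon [IsLocalRing R] [IsNoetherianRing R] {I J c : Ideal R}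
    (rs : List R) (hrs : ∀ r ∈ rs, r ∈ maximalIdeal R) (hreg : IsWeaklyRegular (R ⧸ c) rs)
    (hdim : Module.supportDim R (R ⧸ c) = rs.length) (hI : I ≠ ⊤)
    (h : c.colon (J : Set R) = I) :
    Module.supportDim R (R ⧸ I) = Module.supportDim R (R ⧸ c) := by
  have hcI : c ≤ I := h ▸ le_colon c J
  refine le_antisymm (Module.supportDim_le_of_surjective (Submodule.factor hcI)
    (Submodule.factor_surjective hcI)) ?_
  rw [hdim]
  -- If the image of `J` in `R/c` were zero, `c : J` would be the unit ideal. Being non-zero, this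
  -- image has full dimension, and it is killed by `I`.
  have hne : Submodule.map c.mkQ J ≠ ⊥ := by
    intro h0
    apply hI
    rw [← h, Ideal.eq_top_iff_one, Submodule.mem_colon]
    intro j hj
    rw [one_smul, ← Submodule.Quotient.mk_eq_zero c]
    have h1 : c.mkQ j ∈ Submodule.map c.mkQ J := Submodule.mem_map_of_mem hj
    rwa [h0] at h1
  refine (length_le_supportDim_submodule _ rs hrs hreg _ hne).trans
    (supportDim_le_of_killed I _ ?_)
  rintro r hr ⟨_, j, hj, rfl⟩
  refine Subtype.ext ?_
  change r • c.mkQ j = 0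
  rw [← map_smul]
  rw [← h, Submodule.mem_colon] at hr
  exact (Submodule.Quotient.mk_eq_zero c).mpr (hr j hj)

lemma range_factor {I c : Ideal R} (h : c ≤ I) :
    LinearMap.range (Submodule.factor h : (R ⧸ c) →ₗ[R] (R ⧸ I)) = ⊤ :=
  LinearMap.range_eq_top.mpr (Submodule.factor_surjective h)

lemma isEpiFrom_iff {M C : Type u} [AddCommGroup M] [Module R M] [AddCommGroup C] [Module R C]
    (φ : C →ₗ[R] M) (h : LinearMap.range φ = ⊤) :
    IsEpiFrom φ ↔ Module.supportDim R M = Module.supportDim R C := by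
  rw [IsEpiFrom, h, Module.supportDim_eq_of_equiv (Submodule.topEquiv (R := R) (M := M))]

section

variable [IsLocalRing R] (hR : IsGorensteinLocalRing R) {n : ℕ} (hn : ringKrullDim R = n)
  {C : Type u} [AddCommGroup C] [Module R C] [Module.Finite R C] (rs : List R)
  (hrs : ∀ r ∈ rs, r ∈ maximalIdeal R) (hreg : IsWeaklyRegular C rs)
  (hdim : Module.supportDim R C = rs.length)
include hR hn hrs hreg hdim

/-- `Ext^i(C, R)` vanishes for `i ≠ codim C` if `C` is Cohen-Macaulay. -/
lemma ext_subsingleton_of_ne {m : ℕ} (hm : m + rs.length = n) (i : ℕ) (hi : i ≠ m) :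
    Subsingleton (ExtMod R C R i) := by
  rcases lt_or_gt_of_ne hi with h | h
  · exact ext_subsingleton_of_supportDim_lt hR hn C i rs.length hdim.le (by omega)
  · exact ext_subsingleton_of_lt_add_length hR hn C rs hrs hreg i (by omega)

end

lemma add_length_eq {R : Type u} [CommRing R] {C : Type u} [AddCommGroup C] [Module R C] {n m k : ℕ}
    (hn : ringKrullDim R = n) (hk : Module.supportDim R C = k) :
    HasCodim R C m ↔ m + k = n := by
  rw [HasCodim, hk, hn]
  exact_mod_cast Iff.rfl

end ExtModule

/-! ### The local theorem -/

namespace LocalLiaison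

open ExtModule RingTheory.Sequence IsLocalRing

variable {R : Type u} [CommRing R] [IsLocalRing R]

/-- The duality `α` makes `R/c` Gorenstein, and the kernel of the linking map gives the two colon
ideals. Conversely the canonical module of `R/c` supplies `α`, and the canonical projections serve
as `φ` and `ψ`. -/
theorem smLinked_iff (hR : IsGorensteinLocalRing R) {I J c : Ideal R} (hI : I ≠ ⊤) (hJ : J ≠ ⊤) :
    SmLinked I J c ↔ GorensteinLinked I J c := by
  have := hR.isNoetherianRing
  obtain ⟨n, hn⟩ := exists_ringKrullDim_eq R
  have hid := injectiveDimensionLE_ringKrullDim hR hn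
  constructor
  · rintro ⟨⟨hperf, -⟩, m, hm, α, φ, ψ, -, -, hφ, hψ, ⟨eψ⟩, ⟨eφ⟩⟩
    obtain ⟨rs, hrs, hreg, hdim⟩ := hperf.isCohenMacaulay
    have hmn := (add_length_eq hn hdim.symm).mp hm
    have hv := ext_subsingleton_of_ne hR hn rs hrs hreg.toIsWeaklyRegular hdim.symm hmn
    have hv' : ∀ j < m, Subsingleton (ExtMod R (R ⧸ c) R j) := fun j hj => hv j hj.ne
    refine ⟨⟨hperf, ?_, inferInstance, exists_injectiveDimensionLE_quotient c hid hv α⟩,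
      colon_eq_of_linkingMap hv' α φ hφ eφ, colon_eq_of_linkingMap hv' α ψ hψ eψ⟩
    have hc : c ≠ ⊤ := fun h => hI (top_le_iff.mp (h ▸ le_of_range_eq_top hφ))
    have := Ideal.Quotient.nontrivial_iff.mpr hc
    exact IsLocalRing.of_surjective' (Ideal.Quotient.mk c) Ideal.Quotient.mk_surjective
  · rintro ⟨⟨hperf, hgor⟩, hcI, hcJ⟩
    have := hgor.isLocalRing
    obtain ⟨rs, hrs, hreg, hdim⟩ := hperf.isCohenMacaulay
    have hle : rs.length ≤ n := by
      have := Module.supportDim_le_ringKrullDim R (R ⧸ c)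
      rw [← hdim, hn] at this
      exact_mod_cast this
    obtain ⟨m, rfl⟩ : ∃ m, n = m + rs.length := ⟨n - rs.length, by omega⟩
    have hm : HasCodim R (R ⧸ c) m := (add_length_eq hn hdim.symm).mpr rfl
    have hv := ext_subsingleton_of_ne hR hn rs hrs hreg.toIsWeaklyRegular hdim.symm rfl
    have hv' : ∀ j < m, Subsingleton (ExtMod R (R ⧸ c) R j) := fun j hj => hv j hj.ne
    obtain ⟨α⟩ := nonempty_quotient_equiv_ext hR hn c hgor rs hrs hreg.toIsWeaklyRegular hdim.symm
      m rfl
    have h1 : c ≤ I := hcJ ▸ le_colon c J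
    have h2 : c ≤ J := hcI ▸ le_colon c I
    obtain ⟨e1, -⟩ := exists_equiv_range_linkingMap hv' α _ (range_factor h1) hcI
    obtain ⟨e2, -⟩ := exists_equiv_range_linkingMap hv' α _ (range_factor h2) hcJ
    exact ⟨⟨hperf, m, hm, ⟨α⟩⟩, m, hm, α, Submodule.factor h1, Submodule.factor h2,
      (isEpiFrom_iff _ (range_factor h1)).mpr
        (supportDim_quotient_colon rs hrs hreg.toIsWeaklyRegular hdim.symm hI hcJ),
      (isEpiFrom_iff _ (range_factor h2)).mpr
        (supportDim_quotient_colon rs hrs hreg.toIsWeaklyRegular hdim.symm hJ hcI),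
      range_factor h1, range_factor h2, ⟨e2⟩, ⟨e1⟩⟩

theorem smLiaison_iff (hR : IsGorensteinLocalRing R) (I J : {I : Ideal R // I ≠ ⊤}) :
    SmLiaison I J ↔ GorensteinLiaison I J := by
  have h : (fun I J : {I : Ideal R // I ≠ ⊤} => ∃ c : Ideal R, SmLinked I.1 J.1 c) =
      fun I J => ∃ c : Ideal R, GorensteinLinked I.1 J.1 c := by
    funext I J
    exact propext (exists_congr fun c => smLinked_iff hR I.2 J.2)
  rw [SmLiaison, h]
  rfl

end LocalLiaison


/-! ### Graded modules -/

namespace GradedLiaison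

/-- `π` is the family of projections onto the components of the grading `gr`. -/
structure IsProjection {M : Type*} [AddCommGroup M] (gr : ℤ → AddSubgroup M)
    (π : ℤ → M →+ M) : Prop where
  mem : ∀ i x, π i x ∈ gr i
  same : ∀ i x, x ∈ gr i → π i x = x
  ne : ∀ i j x, x ∈ gr j → j ≠ i → π i x = 0
  exists_sum : ∀ x, ∃ s : Finset ℤ, x = ∑ i ∈ s, π i x

section

variable {M : Type*} [AddCommGroup M] {gr : ℤ → AddSubgroup M} {π : ℤ → M →+ M}

lemma IsProjection.apply_coe (h : IsProjection gr π) (z : DirectSum ℤ fun i => gr i) (i : ℤ) :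
    π i (DirectSum.coeAddMonoidHom gr z) = z i := by
  classical
  induction z using DirectSum.induction_on with
  | zero => simp
  | of j x =>
    rw [DirectSum.coeAddMonoidHom_of]
    by_cases hij : j = i
    · subst hij
      rw [h.same j x x.2, DirectSum.of_eq_same]
    · rw [h.ne i j x x.2 hij, DirectSum.of_eq_of_ne _ _ _ (Ne.symm hij)]
      rfl
  | add x y hx hy =>
    rw [map_add, map_add, hx, hy]
    rfl

lemma IsProjection.isInternal (h : IsProjection gr π) : DirectSum.IsInternal gr := by
  classical
  refine ⟨fun z w hzw => ?_, fun x => ?_⟩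
  · refine DFinsupp.ext fun i => Subtype.ext ?_
    rw [← h.apply_coe z i, ← h.apply_coe w i, hzw]
  · obtain ⟨s, hs⟩ := h.exists_sum x
    refine ⟨∑ i ∈ s, DirectSum.of (fun i => gr i) i ⟨π i x, h.mem i x⟩, ?_⟩
    rw [map_sum]
    simp only [DirectSum.coeAddMonoidHom_of]
    exact hs.symm

lemma exists_isProjection (h : DirectSum.IsInternal gr) : ∃ π, IsProjection gr π := by
  classical
  let e := AddEquiv.ofBijective (DirectSum.coeAddMonoidHom gr) h
  have he : ∀ i (x : gr i), e.symm x = DirectSum.of (fun i => gr i) i x := by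
    intro i x
    rw [AddEquiv.symm_apply_eq]
    exact (DirectSum.coeAddMonoidHom_of gr i x).symm
  refine ⟨fun i => (gr i).subtype.comp ((DFinsupp.evalAddMonoidHom i).comp e.symm.toAddMonoidHom),
    fun i x => ((e.symm x) i).2, fun i x hx => ?_, fun i j x hx hij => ?_, fun x => ?_⟩
  · change ((e.symm x) i : M) = x
    rw [he i ⟨x, hx⟩, DirectSum.of_eq_same]
  · change ((e.symm x) i : M) = 0
    rw [he j ⟨x, hx⟩, DirectSum.of_eq_of_ne _ _ _ (Ne.symm hij)]
    rfl
  · refine ⟨DFinsupp.support (e.symm x), ?_⟩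
    have h1 := DirectSum.sum_support_of (e.symm x)
    have h2 := congrArg (DirectSum.coeAddMonoidHom gr) h1
    rw [map_sum] at h2
    simp only [DirectSum.coeAddMonoidHom_of] at h2
    exact (h2.trans (e.apply_symm_apply x)).symm

lemma IsProjection.apply_apply (h : IsProjection gr π) (i j : ℤ) (x : M) :
    π i (π j x) = if j = i then π i x else 0 := by
  split_ifs with hij
  · subst hij
    exact h.same _ _ (h.mem _ _)
  · exact h.ne i j _ (h.mem _ _) hij

lemma IsProjection.exists_finset (h : IsProjection gr π) (x : M) :
    ∃ s : Finset ℤ, ∀ t, s ⊆ t → x = ∑ i ∈ t, π i x := by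
  obtain ⟨s, hs⟩ := h.exists_sum x
  refine ⟨s, fun t ht => ?_⟩
  have h0 : ∀ i, i ∉ s → π i x = 0 := by
    intro i hi
    rw [hs, map_sum]
    refine Finset.sum_eq_zero fun j hj => ?_
    rw [h.apply_apply, if_neg]
    rintro rfl
    exact hi hj
  rw [← Finset.sum_subset ht fun i _ hi => h0 i hi]
  exact hs

end

variable {K : Type v} [Field K] {R : Type u} [CommRing R] [Algebra K R]
  {𝒜 : ℤ → Submodule K R}

section Projections

variable {M N : Type u} [AddCommGroup M] [Module R M] [AddCommGroup N] [Module R N]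
  {gr : ℤ → AddSubgroup M} {π : ℤ → M →+ M} {grN : ℤ → AddSubgroup N} {πN : ℤ → N →+ N}

/-- A submodule containing the components of its elements. -/
def IsHomogeneousSubmodule (π : ℤ → M →+ M) (P : Submodule R M) : Prop :=
  ∀ x ∈ P, ∀ i, π i x ∈ P

lemma IsProjection.map_apply (h : IsProjection gr π) (hN : IsProjection grN πN) (f : M →+ N)
    (d : ℤ) (hf : ∀ i, ∀ x ∈ gr i, f x ∈ grN (i + d)) (i : ℤ) (x : M) :
    πN (i + d) (f x) = f (π i x) := by
  obtain ⟨s, hs⟩ := h.exists_finset x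
  -- The index `i` is adjoined to the finite set so that its term can be singled out even when it is
  -- zero.
  obtain hs' := hs (insert i s) (Finset.subset_insert i s)
  conv_lhs => rw [hs', map_sum, map_sum]
  rw [Finset.sum_eq_single i]
  · exact hN.same _ _ (hf i _ (h.mem i x))
  · intro j _ hj
    exact hN.ne _ (j + d) _ (hf j _ (h.mem j x)) (by omega)
  · intro hi
    exact absurd (Finset.mem_insert_self i s) hi

lemma IsProjection.map_apply_zero (h : IsProjection gr π) (hN : IsProjection grN πN) (f : M →+ N)
    (hf : ∀ i, ∀ x ∈ gr i, f x ∈ grN i) (i : ℤ) (x : M) : πN i (f x) = f (π i x) := by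
  have := h.map_apply hN f 0 (fun i x hx => by rw [add_zero]; exact hf i x hx) i x
  rwa [add_zero] at this

lemma IsProjection.isHomogeneousSubmodule_ker (h : IsProjection gr π) (hN : IsProjection grN πN)
    (f : M →ₗ[R] N) (hf : ∀ i, ∀ x ∈ gr i, f x ∈ grN i) :
    IsHomogeneousSubmodule π (LinearMap.ker f) := by
  intro x hx i
  rw [LinearMap.mem_ker] at hx ⊢
  have := h.map_apply_zero hN f.toAddMonoidHom hf i x
  rw [← LinearMap.toAddMonoidHom_coe, ← this, LinearMap.toAddMonoidHom_coe, hx, map_zero]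

lemma IsProjection.isHomogeneousSubmodule_comap (h : IsProjection gr π) (hN : IsProjection grN πN)
    (f : M →ₗ[R] N) (hf : ∀ i, ∀ x ∈ gr i, f x ∈ grN i) {P : Submodule R N}
    (hP : IsHomogeneousSubmodule πN P) : IsHomogeneousSubmodule π (P.comap f) := by
  intro x hx i
  have := h.map_apply_zero hN f.toAddMonoidHom hf i x
  rw [Submodule.mem_comap, ← LinearMap.toAddMonoidHom_coe, ← this]
  exact hP _ hx i

lemma IsModuleGrading.smul_apply (hM : IsModuleGrading 𝒜 gr) (h : IsProjection gr π) {d : ℤ} {r : R}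
    (hr : r ∈ 𝒜 d) (i : ℤ) (x : M) : π (i + d) (r • x) = r • π i x :=
  h.map_apply h (DistribSMul.toAddMonoidHom M r) d
    (fun i x hx => by rw [add_comm]; exact hM.smul_mem d i r hr x hx) i x

lemma IsModuleGrading.of_projection (h : IsProjection gr π)
    (hs : ∀ i j, ∀ r ∈ 𝒜 i, ∀ x ∈ gr j, r • x ∈ gr (i + j)) : IsModuleGrading 𝒜 gr :=
  ⟨h.isInternal, hs⟩

/-- The image of a grading under a surjection with homogeneous kernel. -/
lemma IsProjection.exists_map (h : IsProjection gr π) (f : M →ₗ[R] N)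
    (hf : Function.Surjective f) (hk : IsHomogeneousSubmodule π (LinearMap.ker f)) :
    ∃ π' : ℤ → N →+ N, IsProjection (fun i => (gr i).map f.toAddMonoidHom) π' ∧
      ∀ i x, π' i (f x) = f (π i x) := by
  let e : (M ⧸ f.toAddMonoidHom.ker) ≃+ N :=
    QuotientAddGroup.quotientKerEquivOfSurjective f.toAddMonoidHom hf
  have he : ∀ x, e (QuotientAddGroup.mk x) = f x := fun _ => rfl
  let π' : ℤ → N →+ N := fun i =>
    (QuotientAddGroup.lift f.toAddMonoidHom.ker (f.toAddMonoidHom.comp (π i))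
      fun x hx => hk x hx i).comp e.symm.toAddMonoidHom
  have hπ : ∀ i x, π' i (f x) = f (π i x) := by
    intro i x
    have h1 : e.symm (f x) = QuotientAddGroup.mk x := e.symm_apply_eq.mpr (he x).symm
    exact congrArg (QuotientAddGroup.lift f.toAddMonoidHom.ker (f.toAddMonoidHom.comp (π i))
      fun x hx => hk x hx i) h1
  refine ⟨π', ⟨?_, ?_, ?_, ?_⟩, hπ⟩
  · intro i y
    obtain ⟨x, rfl⟩ := hf y
    rw [hπ]
    exact ⟨π i x, h.mem i x, rfl⟩
  · rintro i _ ⟨x, hx, rfl⟩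
    change π' i (f x) = f x
    rw [hπ, h.same i x hx]
  · rintro i j _ ⟨x, hx, rfl⟩ hij
    change π' i (f x) = 0
    rw [hπ, h.ne i j x hx hij, map_zero]
  · intro y
    obtain ⟨x, rfl⟩ := hf y
    obtain ⟨s, hs⟩ := h.exists_sum x
    refine ⟨s, ?_⟩
    simp only [hπ]
    rw [← map_sum, ← hs]

lemma IsModuleGrading.map (hM : IsModuleGrading 𝒜 gr) (h : IsProjection gr π) (f : M →ₗ[R] N)
    (hf : Function.Surjective f) (hk : IsHomogeneousSubmodule π (LinearMap.ker f)) :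
    IsModuleGrading 𝒜 (fun i => (gr i).map f.toAddMonoidHom) := by
  obtain ⟨π', hπ', -⟩ := h.exists_map f hf hk
  refine .of_projection hπ' ?_
  rintro i j r hr _ ⟨x, hx, rfl⟩
  exact ⟨r • x, hM.smul_mem i j r hr x hx, map_smul f r x⟩

lemma IsProjection.exists_sub (h : IsProjection gr π) {P : Submodule R M}
    (hP : IsHomogeneousSubmodule π P) :
    ∃ π' : ℤ → P →+ P, IsProjection (subGrading gr P) π' ∧ ∀ i x, (π' i x : M) = π i x := by
  let π' : ℤ → P →+ P := fun i =>
    { toFun := fun x => ⟨π i x, hP x x.2 i⟩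
      map_zero' := Subtype.ext (map_zero (π i))
      map_add' := fun x y => Subtype.ext (map_add (π i) (x : M) y) }
  refine ⟨π', ⟨fun i x => h.mem i x, fun i x hx => Subtype.ext (h.same i x hx),
    fun i j x hx hij => Subtype.ext (h.ne i j x hx hij), fun x => ?_⟩, fun i x => rfl⟩
  obtain ⟨s, hs⟩ := h.exists_sum (x : M)
  refine ⟨s, Subtype.ext ?_⟩
  rw [AddSubmonoidClass.coe_finsetSum]
  exact hs

lemma IsModuleGrading.sub (hM : IsModuleGrading 𝒜 gr) (h : IsProjection gr π) {P : Submodule R M}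
    (hP : IsHomogeneousSubmodule π P) : IsModuleGrading 𝒜 (subGrading gr P) := by
  obtain ⟨π', hπ', -⟩ := h.exists_sub hP
  exact .of_projection hπ' fun i j r hr x hx => hM.smul_mem i j r hr x hx

end Projections

/-! ### The irrelevant ideal and graded Nakayama -/

section Ring

variable [GradedAlgebra 𝒜]

/-- The grading of the ring. -/
abbrev ringGrading (𝒜 : ℤ → Submodule K R) : ℤ → AddSubgroup R := fun i => (𝒜 i).toAddSubgroup

/-- The projections of the ring onto its components. -/
abbrev ringProj (𝒜 : ℤ → Submodule K R) [GradedAlgebra 𝒜] : ℤ → R →+ R := fun i =>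
  GradedRing.proj 𝒜 i

lemma isProjection_ring : IsProjection (ringGrading 𝒜) (ringProj 𝒜) where
  mem i x := SetLike.coe_mem (DirectSum.decompose 𝒜 x i)
  same i x hx := DirectSum.decompose_of_mem_same 𝒜 hx
  ne i j x hx hij := DirectSum.decompose_of_mem_ne 𝒜 hx hij
  exists_sum x := by
    classical
    exact ⟨_, (DirectSum.sum_support_decompose 𝒜 x).symm⟩

lemma isModuleGrading_ring : IsModuleGrading 𝒜 (ringGrading 𝒜) :=
  .of_projection isProjection_ring fun _ _ _ hr _ hx =>
    SetLike.mul_mem_graded (A := 𝒜) hr hx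

lemma isHomogeneousSubmodule_ideal {I : Ideal R} (hI : I.IsHomogeneous 𝒜) :
    IsHomogeneousSubmodule (ringProj 𝒜) I := fun _ hx i => hI i hx

/-- Without negative degrees, multiples of elements of positive degree have no component in degree
zero. -/
lemma irrelevantIdeal_proj_zero {x : R} (hx : x ∈ irrelevantIdeal 𝒜)
    (h𝒜 : IsStandardGraded 𝒜) : ringProj 𝒜 0 x = 0 := by
  induction hx using Submodule.span_induction with
  | mem x hx =>
    obtain ⟨i, hi, hx⟩ := hx
    exact isProjection_ring.ne 0 i x hx hi.ne'
  | zero => exact map_zero _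
  | add x y _ _ hx hy => rw [map_add, hx, hy, add_zero]
  | smul a x _ hx =>
    obtain ⟨s, hs⟩ := isProjection_ring (𝒜 := 𝒜).exists_sum a
    rw [hs, Finset.sum_smul, map_sum]
    refine Finset.sum_eq_zero fun i _ => ?_
    rcases lt_or_ge i 0 with hi | hi
    · have h0 : ringProj 𝒜 i a ∈ 𝒜 i := isProjection_ring.mem i a
      rw [h𝒜.neg i hi, Submodule.mem_bot] at h0
      rw [h0, zero_smul, map_zero]
    · have h1 := isModuleGrading_ring.smul_apply (isProjection_ring (𝒜 := 𝒜)) (d := i)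
        (isProjection_ring.mem i a) (-i) x
      rw [neg_add_cancel] at h1
      rw [h1]
      rcases hi.eq_or_lt with rfl | hi
      · rw [neg_zero, hx, smul_zero]
      · have h0 : ringProj 𝒜 (-i) x ∈ 𝒜 (-i) := isProjection_ring.mem (-i) x
        rw [h𝒜.neg (-i) (by omega), Submodule.mem_bot] at h0
        rw [h0, smul_zero]

lemma mem_irrelevantIdeal_iff (h𝒜 : IsStandardGraded 𝒜) {x : R} :
    x ∈ irrelevantIdeal 𝒜 ↔ ringProj 𝒜 0 x = 0 := by
  refine ⟨fun hx => irrelevantIdeal_proj_zero hx h𝒜, fun hx => ?_⟩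
  obtain ⟨s, hs⟩ := isProjection_ring (𝒜 := 𝒜).exists_sum x
  rw [hs]
  refine Ideal.sum_mem _ fun i _ => ?_
  rcases lt_trichotomy i 0 with hi | rfl | hi
  · have h0 : ringProj 𝒜 i x ∈ 𝒜 i := isProjection_ring.mem i x
    rw [h𝒜.neg i hi, Submodule.mem_bot] at h0
    rw [h0]
    exact zero_mem _
  · rw [hx]
    exact zero_mem _
  · exact Ideal.subset_span ⟨i, hi, isProjection_ring.mem i x⟩

lemma exists_proj_zero_eq (h𝒜 : IsStandardGraded 𝒜) (x : R) :
    ∃ k : K, ringProj 𝒜 0 x = algebraMap K R k := by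
  have h0 : ringProj 𝒜 0 x ∈ 𝒜 0 := isProjection_ring.mem 0 x
  rw [h𝒜.zero, Submodule.mem_one] at h0
  obtain ⟨k, hk⟩ := h0
  exact ⟨k, hk.symm⟩

lemma isUnit_proj_zero (h𝒜 : IsStandardGraded 𝒜) {x : R} (hx : x ∉ irrelevantIdeal 𝒜) :
    IsUnit (ringProj 𝒜 0 x) := by
  obtain ⟨k, hk⟩ := exists_proj_zero_eq h𝒜 x
  rw [mem_irrelevantIdeal_iff h𝒜] at hx
  rw [hk] at hx ⊢
  exact (IsUnit.mk0 k fun h => hx (by rw [h, map_zero])).map (algebraMap K R)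

lemma irrelevantIdeal_isMaximal (h𝒜 : IsStandardGraded 𝒜) : (irrelevantIdeal 𝒜).IsMaximal := by
  have := h𝒜.nontrivial
  have h1 : ringProj 𝒜 0 (1 : R) = 1 := isProjection_ring.same 0 1 (SetLike.one_mem_graded 𝒜)
  rw [Ideal.isMaximal_iff]
  refine ⟨fun h => ?_, fun J x hJ hx hxJ => ?_⟩
  · rw [mem_irrelevantIdeal_iff h𝒜, h1] at h
    exact one_ne_zero h
  · have h2 : x - ringProj 𝒜 0 x ∈ irrelevantIdeal 𝒜 := by
      rw [mem_irrelevantIdeal_iff h𝒜, map_sub, isProjection_ring.apply_apply, if_pos rfl, sub_self]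
    have h3 : ringProj 𝒜 0 x ∈ J := by
      have := J.sub_mem hxJ (hJ h2)
      rwa [sub_sub_cancel] at this
    exact (Ideal.eq_top_iff_one J).mp (Ideal.eq_top_of_isUnit_mem J h3 (isUnit_proj_zero h𝒜 hx))

lemma le_irrelevantIdeal (h𝒜 : IsStandardGraded 𝒜) {I : Ideal R} (hI : I.IsHomogeneous 𝒜)
    (hI' : I ≠ ⊤) : I ≤ irrelevantIdeal 𝒜 := by
  intro x hx
  by_contra hxm
  exact hI' (Ideal.eq_top_of_isUnit_mem I (hI 0 hx) (isUnit_proj_zero h𝒜 hxm))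

lemma smul_proj_apply {M : Type u} [AddCommGroup M] [Module R M] {gr : ℤ → AddSubgroup M}
    {π : ℤ → M →+ M} (hM : IsModuleGrading 𝒜 gr) (h : IsProjection gr π) (s : R) {j : ℤ} {x : M}
    (hx : x ∈ gr j) (i : ℤ) : π (i + j) (s • x) = ringProj 𝒜 i s • x := by
  refine (isProjection_ring (𝒜 := 𝒜)).map_apply h (AddMonoidHom.flip (smulAddHom R M) x) j ?_ i s
  intro i r hr
  exact hM.smul_mem i j r hr x hx

/-- Graded Nakayama: graded submodules which agree locally at the irrelevant ideal are equal. -/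
lemma le_of_locally_le (h𝒜 : IsStandardGraded 𝒜) {M : Type u} [AddCommGroup M] [Module R M]
    {gr : ℤ → AddSubgroup M} {π : ℤ → M →+ M} (hM : IsModuleGrading 𝒜 gr) (h : IsProjection gr π)
    {P Q : Submodule R M} (hP : IsHomogeneousSubmodule π P) (hQ : IsHomogeneousSubmodule π Q)
    (hPQ : ∀ x ∈ Q, ∃ s, s ∉ irrelevantIdeal 𝒜 ∧ s • x ∈ P) : Q ≤ P := by
  intro x hx
  obtain ⟨t, ht⟩ := h.exists_sum x
  rw [ht]
  refine P.sum_mem fun i _ => ?_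
  obtain ⟨s, hs, hsx⟩ := hPQ _ (hQ x hx i)
  -- The degree `i` part of `s • x_i` is `s_0 • x_i`, and `s_0` is a unit because `s ∉ 𝔪`.
  have h1 := smul_proj_apply hM h s (h.mem i x) 0
  rw [zero_add] at h1
  have h2 := hP _ hsx i
  rw [h1] at h2
  obtain ⟨u, hu⟩ := isUnit_proj_zero h𝒜 hs
  have h3 := P.smul_mem (↑u⁻¹ : R) h2
  rwa [← hu, smul_smul, Units.inv_mul, one_smul] at h3

end Ring

end GradedLiaison


/-! ### Gradings on Hom and Ext -/

namespace GradedLiaison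

open ExtModule

variable {K : Type v} [Field K] {R : Type u} [CommRing R] [Algebra K R]
  {𝒜 : ℤ → Submodule K R}

section

variable {M : Type*} [AddCommGroup M] {gr : ℤ → AddSubgroup M} {π : ℤ → M →+ M}

lemma IsProjection.addHom_ext {N : Type*} [AddCommGroup N] (h : IsProjection gr π) {f g : M →+ N}
    (hfg : ∀ i, ∀ x ∈ gr i, f x = g x) : f = g := by
  ext x
  obtain ⟨s, hs⟩ := h.exists_sum x
  rw [hs, map_sum, map_sum]
  exact Finset.sum_congr rfl fun i _ => hfg i _ (h.mem i x)

lemma IsProjection.exists_addHom {N : Type*} [AddCommGroup N] (h : IsProjection gr π)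
    (φ : ∀ i, gr i →+ N) : ∃ F : M →+ N, ∀ i (x : gr i), F x = φ i x := by
  classical
  let e := AddEquiv.ofBijective (DirectSum.coeAddMonoidHom gr) h.isInternal
  refine ⟨(DirectSum.toAddMonoid φ).comp e.symm.toAddMonoidHom, fun i x => ?_⟩
  have he : e.symm x = DirectSum.of (fun i => gr i) i x := by
    rw [AddEquiv.symm_apply_eq]
    exact (DirectSum.coeAddMonoidHom_of gr i x).symm
  change DirectSum.toAddMonoid φ (e.symm x) = _
  rw [he, DirectSum.toAddMonoid_of]

end

variable [GradedAlgebra 𝒜]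
variable {M : Type u} [AddCommGroup M] [Module R M] {gr : ℤ → AddSubgroup M} {π : ℤ → M →+ M}

/-- Homomorphisms of degree `j`. -/
def homGrading (𝒜 : ℤ → Submodule K R) (gr : ℤ → AddSubgroup M) (j : ℤ) :
    AddSubgroup (M →ₗ[R] R) where
  carrier := {f | ∀ i, ∀ x ∈ gr i, f x ∈ 𝒜 (i + j)}
  zero_mem' := fun i _ _ => zero_mem (𝒜 (i + j))
  add_mem' := fun hf hg i x hx => add_mem (hf i x hx) (hg i x hx)
  neg_mem' := fun hf i x hx => neg_mem (hf i x hx)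

/-- The degree `j` component of `f` is prescribed on homogeneous elements; its linearity is checked
on homogeneous scalars and vectors. -/
lemma exists_hom_component (hM : IsModuleGrading 𝒜 gr) (h : IsProjection gr π)
    (f : M →ₗ[R] R) (j : ℤ) :
    ∃ g : M →ₗ[R] R, ∀ i, ∀ x ∈ gr i, g x = ringProj 𝒜 (i + j) (f x) := by
  obtain ⟨F, hF⟩ := h.exists_addHom fun i =>
    ((ringProj 𝒜 (i + j)).comp f.toAddMonoidHom).comp (gr i).subtype
  have hF' : ∀ i, ∀ x ∈ gr i, F x = ringProj 𝒜 (i + j) (f x) := fun i x hx => hF i ⟨x, hx⟩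
  refine ⟨{ F with map_smul' := fun r x => ?_ }, hF'⟩
  change F (r • x) = r • F x
  obtain ⟨s, hs⟩ := (isProjection_ring (𝒜 := 𝒜)).exists_sum r
  rw [hs, Finset.sum_smul, Finset.sum_smul, map_sum]
  refine Finset.sum_congr rfl fun a _ => ?_
  have ha : ringProj 𝒜 a r ∈ 𝒜 a := isProjection_ring.mem a r
  generalize ringProj 𝒜 a r = r at ha
  obtain ⟨t, ht⟩ := h.exists_sum x
  rw [ht, Finset.smul_sum, map_sum, map_sum, Finset.smul_sum]
  refine Finset.sum_congr rfl fun i _ => ?_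
  rw [hF' _ _ (hM.smul_mem a i r ha _ (h.mem i x)), hF' _ _ (h.mem i x), map_smul,
    show a + i + j = i + j + a by ring]
  exact isModuleGrading_ring.smul_apply isProjection_ring ha _ _

/-- A finitely generated graded module is generated by finitely many homogeneous elements. -/
lemma exists_homogeneous_generators [Module.Finite R M] (h : IsProjection gr π) :
    ∃ (k : ℕ) (d : Fin k → ℤ) (x : Fin k → M), (∀ l, x l ∈ gr (d l)) ∧
      Submodule.span R (Set.range x) = ⊤ := by
  classical
  obtain ⟨S, hS⟩ := (Module.Finite.fg_top : (⊤ : Submodule R M).FG)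
  choose s hs using h.exists_sum
  let T : Finset (ℤ × M) := S.biUnion fun y => (s y).image fun i => (i, π i y)
  have hT : ∀ p ∈ T, p.2 ∈ gr p.1 := by
    intro p hp
    obtain ⟨y, -, hy⟩ := Finset.mem_biUnion.mp hp
    obtain ⟨i, -, rfl⟩ := Finset.mem_image.mp hy
    exact h.mem i y
  refine ⟨T.card, fun l => (T.equivFin.symm l).1.1, fun l => (T.equivFin.symm l).1.2,
    fun l => hT _ (T.equivFin.symm l).2, ?_⟩
  rw [eq_top_iff, ← hS, Submodule.span_le]
  intro y hy
  change y ∈ Submodule.span R _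
  rw [hs y]
  refine Submodule.sum_mem _ fun i hi => Submodule.subset_span ?_
  have hp : (i, π i y) ∈ T := Finset.mem_biUnion.mpr ⟨y, hy, Finset.mem_image_of_mem _ hi⟩
  exact ⟨T.equivFin ⟨_, hp⟩, by simp⟩

/-- Finite generation is what makes Hom the direct sum of its graded pieces: the values on finitely
many homogeneous generators involve only finitely many degrees. -/
lemma exists_homProjection [Module.Finite R M] (hM : IsModuleGrading 𝒜 gr)
    (h : IsProjection gr π) : ∃ ρ, IsProjection (homGrading 𝒜 gr) ρ := by
  classical
  choose c hc using exists_hom_component hM h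
  have hext : ∀ {f g : M →ₗ[R] R}, (∀ i, ∀ x ∈ gr i, f x = g x) → f = g := fun hfg =>
    LinearMap.toAddMonoidHom_injective (h.addHom_ext hfg)
  have hadd : ∀ j f g, c (f + g) j = c f j + c g j := fun j f g => hext fun i x hx => by
    rw [LinearMap.add_apply, hc _ _ _ _ hx, hc _ _ _ _ hx, hc _ _ _ _ hx, LinearMap.add_apply,
      map_add]
  refine ⟨fun j => AddMonoidHom.mk' (fun f => c f j) (hadd j), ?_, ?_, ?_, ?_⟩
  · intro j f i x hx
    change c f j x ∈ _
    rw [hc _ _ _ _ hx]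
    exact isProjection_ring.mem _ _
  · intro j f hf
    refine hext fun i x hx => ?_
    change c f j x = f x
    rw [hc _ _ _ _ hx]
    exact isProjection_ring.same _ _ (hf i x hx)
  · intro j j' f hf hjj
    refine hext fun i x hx => ?_
    change c f j x = 0
    rw [hc _ _ _ _ hx]
    exact isProjection_ring.ne _ (i + j') _ (hf i x hx) (by omega)
  · intro f
    obtain ⟨k, d, x, hx, hspan⟩ := exists_homogeneous_generators (R := R) h
    choose s hs using fun y : R => (isProjection_ring (𝒜 := 𝒜)).exists_finset y
    -- The degree of a component of `f` is the degree in which its value lies minus the degree of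
    -- the generator.
    let t : Finset ℤ := Finset.univ.biUnion fun l => (s (f (x l))).image fun i => i - d l
    refine ⟨t, LinearMap.ext_on_range hspan fun l => ?_⟩
    rw [LinearMap.sum_apply]
    have h1 := hs (f (x l)) (t.image fun i => d l + i) (by
      intro i hi
      refine Finset.mem_image.mpr ⟨i - d l, ?_, by ring⟩
      exact Finset.mem_biUnion.mpr ⟨l, Finset.mem_univ l, Finset.mem_image_of_mem _ hi⟩)
    rw [Finset.sum_image fun a _ b _ hab => add_left_cancel hab] at h1
    conv_lhs => rw [h1]
    refine Finset.sum_congr rfl fun j _ => ?_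
    exact (hc f j _ _ (hx l)).symm

lemma homGrading_smul_mem (i j : ℤ) (r : R) (hr : r ∈ 𝒜 i) (f : M →ₗ[R] R)
    (hf : f ∈ homGrading 𝒜 gr j) : r • f ∈ homGrading 𝒜 gr (i + j) := by
  intro a x hx
  rw [show a + (i + j) = i + (a + j) by ring]
  exact SetLike.mul_mem_graded (A := 𝒜) hr (hf a x hx)

/-- The grading of a free module with generators of degrees `d`. -/
def freeGrading (𝒜 : ℤ → Submodule K R) {k : ℕ} (d : Fin k → ℤ) (i : ℤ) :
    AddSubgroup (Fin k → R) where
  carrier := {v | ∀ l, v l ∈ 𝒜 (i - d l)}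
  zero_mem' := fun l => zero_mem (𝒜 (i - d l))
  add_mem' := fun hf hg l => add_mem (hf l) (hg l)
  neg_mem' := fun hf l => neg_mem (hf l)

lemma exists_freeProjection {k : ℕ} (d : Fin k → ℤ) :
    ∃ ρ, IsProjection (freeGrading 𝒜 d) ρ := by
  classical
  refine ⟨fun i => AddMonoidHom.mk' (fun v l => ringProj 𝒜 (i - d l) (v l)) fun v w => by
    ext l; exact map_add _ _ _, ?_, ?_, ?_, ?_⟩
  · exact fun i v l => isProjection_ring.mem _ _
  · exact fun i v hv => funext fun l => isProjection_ring.same _ _ (hv l)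
  · exact fun i j v hv hij => funext fun l => isProjection_ring.ne _ (j - d l) _ (hv l) (by omega)
  · intro v
    choose s hs using fun y : R => (isProjection_ring (𝒜 := 𝒜)).exists_finset y
    let t : Finset ℤ := Finset.univ.biUnion fun l => (s (v l)).image fun i => i + d l
    refine ⟨t, funext fun l => ?_⟩
    rw [Finset.sum_apply]
    have h1 := hs (v l) (t.image fun i => i - d l) (by
      intro i hi
      refine Finset.mem_image.mpr ⟨i + d l, ?_, by ring⟩
      exact Finset.mem_biUnion.mpr ⟨l, Finset.mem_univ l, Finset.mem_image_of_mem _ hi⟩)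
    rw [Finset.sum_image fun a _ b _ hab => sub_left_injective hab] at h1
    exact h1

lemma isModuleGrading_free {k : ℕ} (d : Fin k → ℤ) : IsModuleGrading 𝒜 (freeGrading 𝒜 d) := by
  obtain ⟨ρ, hρ⟩ := exists_freeProjection (𝒜 := 𝒜) d
  refine .of_projection hρ fun i j r hr v hv l => ?_
  rw [show i + j - d l = i + (j - d l) by ring]
  exact SetLike.mul_mem_graded (A := 𝒜) hr (hv l)

omit [GradedAlgebra 𝒜] in
/-- A finitely generated graded module is the image of a finitely generated graded free module. -/
lemma exists_free_cover [Module.Finite R M] (hM : IsModuleGrading 𝒜 gr) (h : IsProjection gr π) :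
    ∃ (k : ℕ) (d : Fin k → ℤ) (g : (Fin k → R) →ₗ[R] M), Function.Surjective g ∧
      ∀ i, ∀ v ∈ freeGrading 𝒜 d i, g v ∈ gr i := by
  obtain ⟨k, d, x, hx, hspan⟩ := exists_homogeneous_generators (R := R) h
  refine ⟨k, d, Fintype.linearCombination R x, ?_, fun i v hv => ?_⟩
  · rw [← LinearMap.range_eq_top, Fintype.range_linearCombination, hspan]
  · rw [Fintype.linearCombination_apply]
    refine sum_mem fun l _ => ?_
    have := hM.smul_mem (i - d l) (d l) (v l) (hv l) (x l) (hx l)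
    rwa [sub_add_cancel] at this

lemma exists_homogeneousExt_zero [Module.Finite R M] (hM : IsModuleGrading 𝒜 gr)
    (h : IsProjection gr π) :
    ∃ ρ, IsProjection (fun j => (homGrading 𝒜 gr j).map (homEquiv M R).symm.toAddMonoidHom) ρ ∧
      IsModuleGrading 𝒜 (fun j => (homGrading 𝒜 gr j).map (homEquiv M R).symm.toAddMonoidHom) := by
  obtain ⟨ρ, hρ⟩ := exists_homProjection hM h
  have hg : IsModuleGrading 𝒜 (homGrading 𝒜 gr) := .of_projection hρ homGrading_smul_mem
  have hk : IsHomogeneousSubmodule ρ (LinearMap.ker (homEquiv M R).symm.toLinearMap) := by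
    intro x hx i
    rw [LinearEquiv.ker, Submodule.mem_bot] at hx
    rw [hx, map_zero]
    exact zero_mem _
  obtain ⟨ρ', hρ', -⟩ := hρ.exists_map (homEquiv M R).symm.toLinearMap
    (homEquiv M R).symm.surjective hk
  exact ⟨ρ', hρ', hg.map hρ _ (homEquiv M R).symm.surjective hk⟩

/-- `Ext^n(M, R)` is a graded module for a finitely generated graded module `M`. -/
theorem exists_ext_grading [IsNoetherianRing R] (n : ℕ) (M : Type u) [AddCommGroup M] [Module R M]
    [Module.Finite R M] {gr : ℤ → AddSubgroup M} (hM : IsModuleGrading 𝒜 gr) :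
    ∃ gr' : ℤ → AddSubgroup (ExtMod R M R n), IsModuleGrading 𝒜 gr' ∧
      ∀ j, ∀ e ∈ gr' j, IsHomogeneousExt 𝒜 j n (ModuleCat.of R M) gr e := by
  induction n generalizing M with
  | zero =>
    obtain ⟨π, h⟩ := exists_isProjection hM.isInternal
    obtain ⟨-, -, h2⟩ := exists_homogeneousExt_zero hM h
    refine ⟨_, h2, ?_⟩
    rintro j _ ⟨f, hf, rfl⟩
    exact ⟨ModuleCat.ofHom f, rfl, hf⟩
  | succ n ih =>
    obtain ⟨π, h⟩ := exists_isProjection hM.isInternal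
    obtain ⟨k, d, g, hg, hgd⟩ := exists_free_cover hM h
    obtain ⟨ρ, hρ⟩ := exists_freeProjection (𝒜 := 𝒜) d
    have hF := isModuleGrading_free (𝒜 := 𝒜) d
    have hker := hρ.isHomogeneousSubmodule_ker h g hgd
    have hN := hF.sub hρ hker
    obtain ⟨πN, hπN, -⟩ := hρ.exists_sub hker
    have hinj := Submodule.subtype_injective (LinearMap.ker g)
    have hex := LinearMap.exact_subtype_ker_map g
    have hfree : Subsingleton (ExtMod R (Fin k → R) R (n + 1)) := subsingleton_of_free (by omega)
    have hsurj : Function.Surjective (preδ R hinj hg hex n) := fun e =>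
      (preδ_pre_exact (N := R) hinj hg hex n e).mp (Subsingleton.elim _ _)
    -- The grading is pushed forward along the connecting map of a graded free cover, so the kernel
    -- of that map has to be homogeneous. In degree zero the kernel is the image of `Hom(F, R)`
    -- under a map preserving degrees; in higher degrees it is zero because `F` is free.
    have key : ∃ (gr' : ℤ → AddSubgroup (ExtMod R (LinearMap.ker g) R n))
        (ρ' : ℤ → ExtMod R (LinearMap.ker g) R n →+ ExtMod R (LinearMap.ker g) R n),
        IsModuleGrading 𝒜 gr' ∧ IsProjection gr' ρ' ∧
        (∀ j, ∀ e ∈ gr' j, IsHomogeneousExt 𝒜 j n (ModuleCat.of R (LinearMap.ker g))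
          (subGrading (freeGrading 𝒜 d) (LinearMap.ker g)) e) ∧
        IsHomogeneousSubmodule ρ' (LinearMap.ker (preδ R hinj hg hex n)) := by
      rcases n with _ | n
      · obtain ⟨ρF, hρF, -⟩ := exists_homogeneousExt_zero hF hρ
        obtain ⟨ρN, hρN, hgN⟩ := exists_homogeneousExt_zero hN hπN
        refine ⟨_, ρN, hgN, hρN, ?_, ?_⟩
        · rintro j _ ⟨f, hf, rfl⟩
          exact ⟨ModuleCat.ofHom f, rfl, hf⟩
        · intro e he i
          obtain ⟨e', rfl⟩ := (pre_preδ_exact (N := R) hinj hg hex 0 e).mp he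
          have h3 := hρF.map_apply_zero hρN (pre R (LinearMap.ker g).subtype 0).toAddMonoidHom ?_ i e'
          · refine (pre_preδ_exact (N := R) hinj hg hex 0 _).mpr ⟨ρF i e', ?_⟩
            exact h3.symm
          · rintro j _ ⟨f, hf, rfl⟩
            refine ⟨f ∘ₗ (LinearMap.ker g).subtype, fun a x hx => hf a _ hx, ?_⟩
            exact (pre_homEquiv_symm (LinearMap.ker g).subtype f).symm
      · obtain ⟨gr', hgr', hhom⟩ := ih (LinearMap.ker g) hN
        obtain ⟨ρ', hρ'⟩ := exists_isProjection hgr'.isInternal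
        refine ⟨gr', ρ', hgr', hρ', hhom, fun e he i => ?_⟩
        have : Subsingleton (ExtMod R (Fin k → R) R (n + 1)) := subsingleton_of_free (by omega)
        obtain ⟨e', rfl⟩ := (pre_preδ_exact (N := R) hinj hg hex (n + 1) e).mp he
        rw [Subsingleton.elim e' 0, map_zero, map_zero]
        exact zero_mem _
    obtain ⟨gr', ρ', hgr', hρ', hhom, hk⟩ := key
    refine ⟨_, hgr'.map hρ' _ hsurj hk, ?_⟩
    rintro j _ ⟨e, he, rfl⟩
    exact ⟨ModuleCat.of R (LinearMap.ker g), ModuleCat.of R (Fin k → R), _, _,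
      ModuleCat.ofHom (LinearMap.ker g).subtype, ModuleCat.ofHom g, _, shortExact hinj hg hex, e, hN,
      hF, fun i x hx => hx, hgd, hhom j e he, rfl⟩

omit [GradedAlgebra 𝒜] in
/-- Restrictions of homogeneous extension classes to graded submodules are homogeneous. -/
theorem IsHomogeneousExt.restrict {j : ℤ} {n : ℕ} {M : Type u} [AddCommGroup M] [Module R M]
    {gr : ℤ → AddSubgroup M} {π : ℤ → M →+ M} (h : IsProjection gr π)
    {e : ExtMod R M R n} (he : IsHomogeneousExt 𝒜 j n (ModuleCat.of R M) gr e) {P : Submodule R M}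
    (hP : IsHomogeneousSubmodule π P) :
    IsHomogeneousExt 𝒜 j n (ModuleCat.of R P) (subGrading gr P) (pre R P.subtype n e) := by
  rcases n with _ | n
  · obtain ⟨f, rfl, hf⟩ := he
    refine ⟨ModuleCat.ofHom P.subtype ≫ f, ?_, fun i x hx => hf i _ hx⟩
    rw [pre_apply, Ext.mk₀_comp_mk₀]
  · obtain ⟨N, F, grN, grF, f, g, w, hS, e', hN, hF, hf, hg, he', rfl⟩ := he
    obtain ⟨ρ, hρ⟩ := exists_isProjection hF.isInternal
    have hcomap := hρ.isHomogeneousSubmodule_comap h g.hom hg hP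
    have hfinj : Function.Injective f.hom := (ModuleCat.mono_iff_injective f).mp hS.mono_f
    have hgsurj : Function.Surjective g.hom := (ModuleCat.epi_iff_surjective g).mp hS.epi_g
    have hexact : Function.Exact f.hom g.hom :=
      (ShortComplex.ShortExact.moduleCat_exact_iff_function_exact _).mp hS.exact
    -- Pull the extension back along `P ⊂ M`: the middle term becomes the preimage of `P`, while `N`
    -- and the class `e'` stay the same. Naturality of the extension class identifies the result
    -- with the restriction.
    let f' : N →ₗ[R] P.comap g.hom := LinearMap.codRestrict _ f.hom fun x => by
      rw [Submodule.mem_comap, (hexact _).mpr ⟨x, rfl⟩]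
      exact zero_mem _
    let g' : P.comap g.hom →ₗ[R] P := g.hom.restrict fun x hx => hx
    have hf' : Function.Injective f' := fun x y hxy => hfinj (congrArg Subtype.val hxy)
    have hg' : Function.Surjective g' := fun y => by
      obtain ⟨x, hx⟩ := hgsurj y
      exact ⟨⟨x, by rw [Submodule.mem_comap, hx]; exact y.2⟩, Subtype.ext hx⟩
    have hex' : Function.Exact f' g' := by
      intro x
      refine ⟨fun hx => ?_, ?_⟩
      · obtain ⟨y, hy⟩ := (hexact x).mp (congrArg Subtype.val hx)
        exact ⟨y, Subtype.ext hy⟩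
      · rintro ⟨y, rfl⟩
        exact Subtype.ext ((hexact _).mpr ⟨y, rfl⟩)
    refine ⟨N, ModuleCat.of R (P.comap g.hom), grN, subGrading grF (P.comap g.hom),
      ModuleCat.ofHom f', ModuleCat.ofHom g', _, shortExact hf' hg' hex', e', hN,
      hF.sub hρ hcomap, fun i x hx => hf i x hx, fun i x hx => hg i _ hx, he', ?_⟩
    have hS' := shortExact hf' hg' hex'
    let τ : ShortComplex.mk (ModuleCat.ofHom f') (ModuleCat.ofHom g') (by
        rw [← ModuleCat.ofHom_comp, hex'.linearMap_comp_eq_zero]; rfl) ⟶ ShortComplex.mk f g w :=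
      { τ₁ := 𝟙 N
        τ₂ := ModuleCat.ofHom (P.comap g.hom).subtype
        τ₃ := ModuleCat.ofHom P.subtype
        comm₁₂ := rfl
        comm₂₃ := rfl }
    have hnat := ShortComplex.ShortExact.extClass_naturality hS' hS τ
    have h1 : (hS'.extClass.comp (Ext.mk₀ (𝟙 N)) (add_zero 1)) = hS'.extClass := Ext.comp_mk₀_id _
    rw [pre_apply, ← Ext.comp_assoc _ _ _ (zero_add 1) (add_comm 1 n) (by omega)]
    change _ = hS'.extClass.comp e' _
    rw [← h1]
    exact congrArg (fun a => Ext.comp a e' (add_comm 1 n)) hnat.symm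

end GradedLiaison


/-! ### Localization of Ext -/

namespace ExtModule

section PostEquiv

variable {R : Type u} [CommRing R] (M : Type u) [AddCommGroup M] [Module R M] {N₁ N₂ : Type u}
  [AddCommGroup N₁] [Module R N₁] [AddCommGroup N₂] [Module R N₂]

/-- Isomorphic modules in the second variable have isomorphic Ext modules. -/
noncomputable def postEquiv (e : N₁ ≃ₗ[R] N₂) (n : ℕ) : ExtMod R M N₁ n ≃ₗ[R] ExtMod R M N₂ n :=
  LinearEquiv.ofLinearMap (post M e.toLinearMap n) (post M e.symm.toLinearMap n)
    (by
      ext x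
      have : ModuleCat.ofHom e.symm.toLinearMap ≫ ModuleCat.ofHom e.toLinearMap =
          𝟙 (ModuleCat.of R N₂) := by ext; simp
      simp [post_apply, this])
    (by
      ext x
      have : ModuleCat.ofHom e.toLinearMap ≫ ModuleCat.ofHom e.symm.toLinearMap =
          𝟙 (ModuleCat.of R N₁) := by ext; simp
      simp [post_apply, this])

end PostEquiv

variable {R : Type u} [CommRing R] (S : Submonoid R)

/-- The localization of a module. -/
abbrev Loc (M : Type u) [AddCommGroup M] [Module R M] : Type u :=
  LocalizedModule S M

/-- The map to the localization. -/
noncomputable abbrev locMk (M : Type u) [AddCommGroup M] [Module R M] : M →ₗ[R] Loc S M :=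
  LocalizedModule.mkLinearMap S M

variable {M N P : Type u} [AddCommGroup M] [Module R M] [AddCommGroup N] [Module R N]
  [AddCommGroup P] [Module R P]

/-- The localization of a linear map. -/
noncomputable abbrev locMap (f : M →ₗ[R] N) : Loc S M →ₗ[Localization S] Loc S N :=
  IsLocalizedModule.mapExtendScalars S (locMk S M) (locMk S N) (Localization S) f

lemma locMap_locMk (f : M →ₗ[R] N) (x : M) : locMap S f (locMk S M x) = locMk S N (f x) :=
  IsLocalizedModule.map_apply S (locMk S M) (locMk S N) f x

lemma locMk_eq_zero_iff (x : M) : locMk S M x = 0 ↔ ∃ s ∈ S, s • x = 0 := by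
  rw [IsLocalizedModule.eq_zero_iff S (locMk S M)]
  exact ⟨fun ⟨s, hs⟩ => ⟨s, s.2, hs⟩, fun ⟨s, hs, h⟩ => ⟨⟨s, hs⟩, h⟩⟩

lemma exists_locMk_eq (y : Loc S M) : ∃ s ∈ S, ∃ x : M, algebraMap R (Localization S) s • y =
    locMk S M x := by
  obtain ⟨⟨x, s⟩, h⟩ := IsLocalizedModule.surj S (locMk S M) y
  exact ⟨s, s.2, x, by rw [algebraMap_smul]; exact h⟩

lemma locMap_smul_id (r : R) : locMap S (r • (LinearMap.id : M →ₗ[R] M)) =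
    algebraMap R (Localization S) r • LinearMap.id := by
  ext y
  obtain ⟨s, hs, x, hx⟩ := exists_locMk_eq S y
  have hu : IsUnit (algebraMap R (Localization S) s) :=
    IsLocalization.map_units (Localization S) ⟨s, hs⟩
  refine hu.smul_left_cancel.mp ?_
  rw [← map_smul, ← map_smul, hx, locMap_locMk]
  simp only [LinearMap.smul_apply, LinearMap.id_apply, map_smul, algebraMap_smul]

section Exact

variable {f : M →ₗ[R] N} {g : N →ₗ[R] P}

lemma locMap_exact (h : Function.Exact f g) : Function.Exact (locMap S f) (locMap S g) :=
  IsLocalizedModule.map_exact S (locMk S M) (locMk S N) (locMk S P) f g h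

lemma locMap_injective (hf : Function.Injective f) : Function.Injective (locMap S f) :=
  IsLocalizedModule.map_injective S (locMk S M) (locMk S N) f hf

lemma locMap_surjective (hf : Function.Surjective f) : Function.Surjective (locMap S f) :=
  IsLocalizedModule.map_surjective S (locMk S M) (locMk S N) f hf

end Exact

/-- The localization functor. -/
noncomputable abbrev locFunctor : ModuleCat.{u} R ⥤ ModuleCat.{u} (Localization S) where
  obj M := ModuleCat.of _ (Loc S M)
  map f := ModuleCat.ofHom (locMap S f.hom)
  map_id M := by
    ext y
    obtain ⟨s, hs, x, hx⟩ := exists_locMk_eq S y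
    have hu : IsUnit (algebraMap R (Localization S) s) :=
      IsLocalization.map_units (Localization S) ⟨s, hs⟩
    refine hu.smul_left_cancel.mp ?_
    rw [← map_smul, hx]
    exact (locMap_locMk S _ x).trans hx.symm
  map_comp {X Y Z} f g := by
    ext y
    obtain ⟨s, hs, x, hx⟩ := exists_locMk_eq S y
    have hu : IsUnit (algebraMap R (Localization S) s) :=
      IsLocalization.map_units (Localization S) ⟨s, hs⟩
    refine hu.smul_left_cancel.mp ?_
    rw [← map_smul, ← map_smul, hx]
    refine (locMap_locMk S _ x).trans ?_
    change _ = locMap S g.hom (locMap S f.hom (locMk S X x))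
    rw [locMap_locMk, locMap_locMk]
    rfl

instance : (locFunctor S).Additive where
  map_add {M N} f g := by
    ext y
    obtain ⟨s, hs, x, hx⟩ := exists_locMk_eq S y
    have hu : IsUnit (algebraMap R (Localization S) s) :=
      IsLocalization.map_units (Localization S) ⟨s, hs⟩
    refine hu.smul_left_cancel.mp ?_
    change _ • locMap S (f.hom + g.hom) y = _ • (locMap S f.hom y + locMap S g.hom y)
    rw [smul_add, ← map_smul, ← map_smul, ← map_smul, hx, locMap_locMk, locMap_locMk,
      locMap_locMk, LinearMap.add_apply, map_add]

lemma locFunctor_map_exact (T : ShortComplex (ModuleCat.{u} R)) (h : T.Exact) :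
    (T.map (locFunctor S)).Exact := by
  rw [CategoryTheory.ShortComplex.ShortExact.moduleCat_exact_iff_function_exact] at h ⊢
  exact locMap_exact S h

instance : Limits.PreservesFiniteLimits (locFunctor (R := R) S) :=
  have : Limits.PreservesFiniteLimits (locFunctor (R := R) S) ∧
      Limits.PreservesFiniteColimits (locFunctor (R := R) S) :=
    ((Functor.exact_tfae (locFunctor S)).out 1 3).mp (locFunctor_map_exact S)
  this.1

instance : Limits.PreservesFiniteColimits (locFunctor (R := R) S) :=
  have : Limits.PreservesFiniteLimits (locFunctor (R := R) S) ∧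
      Limits.PreservesFiniteColimits (locFunctor (R := R) S) :=
    ((Functor.exact_tfae (locFunctor S)).out 1 3).mp (locFunctor_map_exact S)
  this.2

/-- The map from Ext to the Ext of the localizations. -/
noncomputable def locExt (M N : Type u) [AddCommGroup M] [Module R M] [AddCommGroup N] [Module R N]
    (n : ℕ) : ExtMod R M N n →+ ExtMod (Localization S) (Loc S M) (Loc S N) n :=
  (locFunctor S).mapExtAddHom (ModuleCat.of R M) (ModuleCat.of R N) n

lemma locExt_zero (f : M →ₗ[R] N) :
    locExt S M N 0 ((homEquiv M N).symm f) = (homEquiv _ _).symm (locMap S f) :=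
  Ext.mapExactFunctor_mk₀ (locFunctor S) (ModuleCat.ofHom f)

lemma locExt_pre (f : M →ₗ[R] P) (n : ℕ) (e : ExtMod R P N n) :
    locExt S M N n (pre N f n e) = pre (Loc S N) (locMap S f) n (locExt S P N n e) := by
  refine (Ext.mapExactFunctor_comp (locFunctor S)
    (Ext.mk₀ (ModuleCat.ofHom f)) e (zero_add n)).trans ?_
  rw [Ext.mapExactFunctor_mk₀]
  rfl

/-- The functor only provides an additive map; compatibility with scalars follows because they act
through the first variable. -/
lemma locExt_smul (n : ℕ) (r : R) (e : ExtMod R M N n) :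
    locExt S M N n (r • e) = algebraMap R (Localization S) r • locExt S M N n e := by
  rw [← pre_smul_id, locExt_pre, locMap_smul_id, pre_smul_id]

lemma locExt_preδ {M₁ M₂ M₃ : Type u} [AddCommGroup M₁] [Module R M₁] [AddCommGroup M₂]
    [Module R M₂] [AddCommGroup M₃] [Module R M₃] {f : M₁ →ₗ[R] M₂} {g : M₂ →ₗ[R] M₃}
    (hf : Function.Injective f) (hg : Function.Surjective g) (h : Function.Exact f g) (n : ℕ)
    (e : ExtMod R M₁ N n) :
    locExt S M₃ N (n + 1) (preδ N hf hg h n e) =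
      preδ (Loc S N) (locMap_injective S hf) (locMap_surjective S hg) (locMap_exact S h) n
        (locExt S M₁ N n e) := by
  refine (Ext.mapExactFunctor_comp (locFunctor S)
    (shortExact hf hg h).extClass e (add_comm 1 n)).trans ?_
  rw [Ext.mapExactFunctor_extClass]
  rfl

/-- The Ext modules of finitely generated modules over a Noetherian ring commute with
localization. -/
theorem locExt_localizes [IsNoetherianRing R] (n : ℕ) (M : Type u) [AddCommGroup M] [Module R M]
    [Module.Finite R M] :
    (∀ e : ExtMod R M N n, locExt S M N n e = 0 → ∃ s ∈ S, s • e = 0) ∧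
      ∀ y, ∃ s ∈ S, ∃ e, algebraMap R (Localization S) s • y = locExt S M N n e := by
  induction n generalizing M with
  | zero =>
    have : Module.FinitePresentation R M := Module.finitePresentation_of_finite R M
    have hloc := Module.FinitePresentation.isLocalizedModule_mapExtendScalars S (locMk S M)
      (locMk S N) (Localization S)
    constructor
    · intro e he
      obtain ⟨f, rfl⟩ := (homEquiv M N).symm.surjective e
      rw [locExt_zero, LinearEquiv.map_eq_zero_iff] at he
      obtain ⟨s, hs⟩ := (IsLocalizedModule.eq_zero_iff S _).mp he
      have hs' : (s : R) • f = 0 := hs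
      exact ⟨s, s.2, by rw [← map_smul, hs', map_zero]⟩
    · intro y
      obtain ⟨f, rfl⟩ := (homEquiv _ _).symm.surjective y
      obtain ⟨⟨g, s⟩, hs⟩ := IsLocalizedModule.surj S (IsLocalizedModule.mapExtendScalars S
        (locMk S M) (locMk S N) (Localization S)) f
      refine ⟨s, s.2, (homEquiv M N).symm g, ?_⟩
      rw [locExt_zero, ← map_smul]
      congr 1
      rw [algebraMap_smul]
      exact hs
  | succ n ih =>
    obtain ⟨k, g, hg⟩ := Module.Finite.exists_fin' R M
    have hinj := Submodule.subtype_injective (LinearMap.ker g)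
    have hex := LinearMap.exact_subtype_ker_map g
    have hfree : Subsingleton (ExtMod R (Fin k → R) N (n + 1)) := subsingleton_of_free (by omega)
    have hsurj : Function.Surjective (preδ N hinj hg hex n) := fun e =>
      (preδ_pre_exact (N := N) hinj hg hex n e).mp (Subsingleton.elim _ _)
    have hproj : Module.Projective (Localization S) (Loc S (Fin k → R)) := by
      have := Module.Projective.of_equiv (R := Localization S)
        (LinearEquiv.extendScalarsOfIsLocalization S (Localization S)
        (IsLocalizedModule.linearEquiv S
          (LinearMap.pi fun i => (Algebra.linearMap R (Localization S)).comp
            (LinearMap.proj (R := R) (φ := fun _ : Fin k => R) i))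
          (locMk S (Fin k → R))))
      exact this
    have hfree' : Subsingleton (ExtMod (Localization S) (Loc S (Fin k → R)) (Loc S N) (n + 1)) :=
      subsingleton_of_free (by omega)
    obtain ⟨hN, hN'⟩ := ih (LinearMap.ker g)
    obtain ⟨-, hF⟩ := ih (Fin k → R)
    constructor
    · intro e he
      obtain ⟨e', rfl⟩ := hsurj e
      rw [locExt_preδ] at he
      -- If `e` dies after localization, its lift `e'` becomes the restriction of a class on the
      -- free module. After clearing denominators, a multiple of `e'` is such a restriction already
      -- over `R`, so the connecting map kills it.
      obtain ⟨y, hy⟩ := (pre_preδ_exact (N := Loc S N) (locMap_injective S hinj)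
        (locMap_surjective S hg) (locMap_exact S hex) n _).mp he
      obtain ⟨s, hs, e'', he''⟩ := hF y
      obtain ⟨t, ht, h0⟩ := hN (s • e' - pre N (LinearMap.ker g).subtype n e'') (by
        rw [map_sub, locExt_smul, locExt_pre, ← he'', map_smul, hy, sub_self])
      refine ⟨t * s, S.mul_mem ht hs, ?_⟩
      rw [smul_sub, sub_eq_zero] at h0
      rw [← map_smul, mul_smul, h0, map_smul,
        (pre_preδ_exact (N := N) hinj hg hex n _).mpr ⟨e'', rfl⟩, smul_zero]
    · intro y
      obtain ⟨y', rfl⟩ := (preδ_pre_exact (N := Loc S N) (locMap_injective S hinj)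
        (locMap_surjective S hg) (locMap_exact S hex) n y).mp (Subsingleton.elim _ _)
      obtain ⟨s, hs, e, he⟩ := hN' y'
      exact ⟨s, hs, preδ N hinj hg hex n e, by rw [locExt_preδ, ← he, map_smul]⟩

/-- The localization of the ring as a module. -/
noncomputable def locSelfEquiv : Loc S R ≃ₗ[Localization S] Localization S :=
  LinearEquiv.extendScalarsOfIsLocalization S (Localization S)
    (IsLocalizedModule.linearEquiv S (locMk S R) (Algebra.linearMap R (Localization S)))

/-- The localization of a cyclic module. -/
lemma nonempty_locQuotientEquiv (c : Ideal R) : Nonempty (Loc S (R ⧸ c) ≃ₗ[Localization S]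
    (Localization S ⧸ c.map (algebraMap R (Localization S)))) := by
  refine nonempty_equiv_of_annihilator_eq ⟨locMk S (R ⧸ c) (c.mkQ 1), fun y => ?_⟩
    (IsCyclicModule.quotient _) ?_
  · obtain ⟨s, hs, x, hx⟩ := exists_locMk_eq S y
    obtain ⟨r, rfl⟩ := Submodule.mkQ_surjective c x
    obtain ⟨u, hu⟩ : IsUnit (algebraMap R (Localization S) s) :=
      IsLocalization.map_units (Localization S) ⟨s, hs⟩
    refine ⟨↑u⁻¹ * algebraMap R _ r, ?_⟩
    have h : algebraMap R (Localization S) r • locMk S (R ⧸ c) (c.mkQ 1) =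
        locMk S (R ⧸ c) (c.mkQ r) := by
      rw [algebraMap_smul, ← map_smul, ← map_smul, smul_eq_mul, mul_one]
    rw [mul_smul, h, ← hx, ← hu, smul_smul, Units.inv_mul, one_smul]
  · rw [Ideal.annihilator_quotient]
    refine le_antisymm (fun a ha => ?_) ?_
    · obtain ⟨⟨r, s⟩, hrs⟩ := IsLocalization.surj S a
      have h1 : algebraMap R (Localization S) r • locMk S (R ⧸ c) (c.mkQ 1) = 0 := by
        rw [← hrs, mul_comm, mul_smul, Module.mem_annihilator.mp ha, smul_zero]
      rw [algebraMap_smul, ← map_smul, ← map_smul, smul_eq_mul, mul_one, locMk_eq_zero_iff] at h1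
      obtain ⟨t, ht, h2⟩ := h1
      rw [← map_smul] at h2
      have h3 : t * r ∈ c := (Submodule.Quotient.mk_eq_zero c).mp h2
      have h4 := Ideal.mem_map_of_mem (algebraMap R (Localization S)) h3
      rw [map_mul] at h4
      have h5 := (Ideal.unit_mul_mem_iff_mem _
        (IsLocalization.map_units (Localization S) ⟨t, ht⟩)).mp h4
      have h6 : a * algebraMap R (Localization S) s ∈ c.map (algebraMap R (Localization S)) :=
        hrs ▸ h5
      exact (Ideal.mul_unit_mem_iff_mem _ (IsLocalization.map_units (Localization S) s)).mp h6
    · rw [Ideal.map_le_iff_le_comap]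
      intro r hr
      rw [Ideal.mem_comap, Module.mem_annihilator]
      intro y
      obtain ⟨s, hs, x, hx⟩ := exists_locMk_eq S y
      have hu : IsUnit (algebraMap R (Localization S) s) :=
        IsLocalization.map_units (Localization S) ⟨s, hs⟩
      refine hu.smul_left_cancel.mp ?_
      rw [smul_comm, hx, algebraMap_smul, ← map_smul, smul_quotient_eq_zero hr, map_zero, smul_zero]

/-- Contraction of primes is strictly increasing and maps the localized support into the original
one. -/
lemma supportDim_loc_le (M : Type u) [AddCommGroup M] [Module R M] [Module.Finite R M] :
    Module.supportDim (Localization S) (Loc S M) ≤ Module.supportDim R M := by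
  let φ : Module.support (Localization S) (Loc S M) → Module.support R M := fun p =>
    ⟨PrimeSpectrum.comap (algebraMap R (Localization S)) p.1, by
      rw [Module.mem_support_iff_of_finite]
      intro r hr
      obtain ⟨y, hy⟩ := Module.mem_support_iff_exists_annihilator.mp p.2
      refine hy ?_
      rw [Submodule.mem_annihilator_span_singleton]
      obtain ⟨s, hs, x, hx⟩ := exists_locMk_eq S y
      have hu : IsUnit (algebraMap R (Localization S) s) :=
        IsLocalization.map_units (Localization S) ⟨s, hs⟩
      refine hu.smul_left_cancel.mp ?_
      rw [smul_comm, hx, algebraMap_smul, ← map_smul, Module.mem_annihilator.mp hr, map_zero,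
        smul_zero]⟩
  refine Order.krullDim_le_of_strictMono φ fun p q hpq => ?_
  refine lt_of_le_of_ne (Ideal.comap_mono hpq.le) fun h => hpq.ne ?_
  have h1 : PrimeSpectrum.comap (algebraMap R (Localization S)) p.1 =
    PrimeSpectrum.comap (algebraMap R (Localization S)) q.1 := congrArg Subtype.val h
  exact Subtype.ext (PrimeSpectrum.localization_comap_injective (Localization S) S h1)

end ExtModule


/-! ### The dimension of a standard graded algebra -/

namespace GradedLiaison

variable {K : Type v} [Field K] {R : Type u} [CommRing R] [Algebra K R]
  {𝒜 : ℤ → Submodule K R} [GradedAlgebra 𝒜]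

lemma mem_of_forall_proj {q : Ideal R} {x : R} (h : ∀ i, ringProj 𝒜 i x ∈ q) : x ∈ q := by
  obtain ⟨s, hs⟩ := isProjection_ring (𝒜 := 𝒜).exists_sum x
  rw [hs]
  exact sum_mem fun i _ => h i

lemma proj_mul_homogeneous {r : R} {d : ℤ} (hr : r ∈ 𝒜 d) (i : ℤ) (x : R) :
    ringProj 𝒜 i (r * x) = r * ringProj 𝒜 (i - d) x := by
  have := isModuleGrading_ring.smul_apply (isProjection_ring (𝒜 := 𝒜)) hr (i - d) x
  rwa [sub_add_cancel] at this

/-- A prime ideal is minimal over the sum of its homogeneous core and a principal ideal. -/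
lemma exists_mem_minimalPrimes_homogeneousCore (p : Ideal R) [hp : p.IsPrime] :
    ∃ g, p ∈ ((p.homogeneousCore 𝒜).toIdeal ⊔ Ideal.span {g}).minimalPrimes := by
  set q : Ideal R := (p.homogeneousCore 𝒜).toIdeal with hq
  have hqp : q ≤ p := Ideal.toIdeal_homogeneousCore_le 𝒜 p
  have hcore : ∀ i x, ringProj 𝒜 i x ∈ p → ringProj 𝒜 i x ∈ q := fun i x hx =>
    Ideal.mem_homogeneousCore_of_homogeneous_of_mem ⟨i, isProjection_ring.mem i x⟩ hx
  by_cases hpq : p ≤ q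
  · refine ⟨0, ?_⟩
    have : q = p := le_antisymm hqp hpq
    rw [this]
    simp [Ideal.minimalPrimes_eq_subsingleton_self]
  -- `W N f` says that modulo `q` the components of `f` lie in a window of `N` consecutive degrees.
  -- The width plays the role of the degree in a division algorithm.
  let W : ℕ → R → Prop := fun N f => ∃ a : ℤ, ∀ i, ringProj 𝒜 i f ∉ q → a ≤ i ∧ i < a + N
  have hW0 : ∀ f, W 0 f → f ∈ q := by
    rintro f ⟨a, ha⟩
    refine mem_of_forall_proj (𝒜 := 𝒜) fun i => ?_
    by_contra hi
    have := ha i hi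
    push_cast at this
    omega
  have hW : ∀ f, ∃ N, W N f := by
    intro f
    obtain ⟨s, hs⟩ := isProjection_ring (𝒜 := 𝒜).exists_finset f
    have hs' : ∀ i, ringProj 𝒜 i f ∉ q → i ∈ s := by
      intro i hi
      by_contra his
      have h1 := hs s subset_rfl
      refine hi ?_
      rw [h1, map_sum]
      refine sum_mem fun j hj => ?_
      rw [isProjection_ring.apply_apply, if_neg (by rintro rfl; exact his hj)]
      exact zero_mem _
    obtain ⟨B, hB⟩ : ∃ B : ℕ, ∀ i ∈ s, i.natAbs ≤ B :=
      ⟨s.sup Int.natAbs, fun i hi => Finset.le_sup (f := Int.natAbs) hi⟩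
    refine ⟨2 * B + 1, -B, fun i hi => ?_⟩
    have := hB i (hs' i hi)
    push_cast
    omega
  -- The divisor `g` is an element of `p` outside `q` of least width `n`.
  have hex : ∃ N, ∃ g ∈ p, g ∉ q ∧ W N g := by
    obtain ⟨g, hg, hgq⟩ := SetLike.not_le_iff_exists.mp hpq
    obtain ⟨N, hN⟩ := hW g
    exact ⟨N, g, hg, hgq, hN⟩
  classical
  obtain ⟨g, hg, hgq, a, ha⟩ := Nat.find_spec hex
  set n := Nat.find hex with hn
  have hmin : ∀ N < n, ∀ f ∈ p, W N f → f ∈ q := by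
    intro N hN f hf hfW
    by_contra hfq
    exact Nat.find_min hex hN ⟨f, hf, hfq, hfW⟩
  obtain ⟨k, hk⟩ : ∃ k, n = k + 1 := by
    refine ⟨n - 1, ?_⟩
    have : n ≠ 0 := by
      intro h0
      exact hgq (hW0 g ⟨a, by rw [← h0]; exact ha⟩)
    omega
  -- The component of `g` in the last degree of its window is its leading coefficient. If it were in
  -- `p`, then as a homogeneous element it would be in `q`, and the width could be decreased.
  set v := ringProj 𝒜 (a + k) g with hv
  have hvp : v ∉ p := by
    intro hvp
    have hvq := hcore _ _ hvp
    refine hgq (hmin k (by omega) g hg ⟨a, fun i hi => ?_⟩)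
    have h1 := ha i hi
    rw [hk] at h1
    push_cast at h1
    refine ⟨h1.1, lt_of_le_of_ne (by omega) ?_⟩
    rintro rfl
    exact hi hvq
  -- Pseudo-division by `g`: in `v * f - w * g` the top degrees cancel, and `N + 1 ≥ n` makes both
  -- products fit in the same window. So some `v ^ m * f` lies in `q + (g)`, and since `v ∉ p`, a
  -- prime inside `p` containing `q + (g)` contains every `f ∈ p`.
  have hdiv : ∀ N f, f ∈ p → W N f → ∃ m, v ^ m * f ∈ q ⊔ Ideal.span {g} := by
    intro N
    induction N with
    | zero => exact fun f _ hfW => ⟨0, by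
        rw [pow_zero, one_mul]; exact Ideal.mem_sup_left (hW0 f hfW)⟩
    | succ N ih =>
      intro f hf hfW
      by_cases hNn : N + 1 < n
      · exact ⟨0, by
          rw [pow_zero, one_mul]; exact Ideal.mem_sup_left (hmin _ hNn f hf hfW)⟩
      obtain ⟨b, hb⟩ := hfW
      set w := ringProj 𝒜 (b + N) f with hw
      have hcomp : ∀ i, ringProj 𝒜 i (v * f - w * g) =
          v * ringProj 𝒜 (i - (a + k)) f - w * ringProj 𝒜 (i - (b + N)) g := by
        intro i
        rw [map_sub, proj_mul_homogeneous (isProjection_ring.mem (a + k) g) i f,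
          proj_mul_homogeneous (isProjection_ring.mem (b + N) f) i g]
      obtain ⟨m, hm⟩ := ih (v * f - w * g)
        (sub_mem (Ideal.mul_mem_left _ _ hf) (Ideal.mul_mem_left _ _ hg))
        ⟨a + b + k, fun i hi => by
          rw [hcomp] at hi
          have hne : i ≠ a + b + k + N := by
            rintro rfl
            refine hi ?_
            rw [show a + b + k + N - (a + k) = b + N by ring,
              show a + b + k + N - (b + N) = a + k by ring, ← hv, ← hw, mul_comm, sub_self]
            exact zero_mem _
          have h12 : ringProj 𝒜 (i - (a + k)) f ∉ q ∨ ringProj 𝒜 (i - (b + N)) g ∉ q := by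
            by_contra! h
            exact hi (sub_mem (Ideal.mul_mem_left _ _ h.1) (Ideal.mul_mem_left _ _ h.2))
          rcases h12 with h | h
          · have := hb _ h
            push_cast at this
            omega
          · have := ha _ h
            rw [hk] at this
            push_cast at this
            omega⟩
      refine ⟨m + 1, ?_⟩
      have : v ^ (m + 1) * f = v ^ m * (v * f - w * g) + v ^ m * w * g := by ring
      rw [this]
      exact add_mem hm (Ideal.mem_sup_right (Ideal.mul_mem_left _ _
        (Ideal.mem_span_singleton_self g)))
  refine ⟨g, ⟨hp, sup_le hqp ((Ideal.span_singleton_le_iff_mem p).mpr hg)⟩, ?_⟩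
  rintro p' ⟨hp', hle⟩ hle' f hf
  obtain ⟨N, hN⟩ := hW f
  obtain ⟨m, hm⟩ := hdiv N f hf hN
  refine (hp'.mem_or_mem (hle hm)).resolve_left fun h => hvp (hle' (hp'.mem_of_pow_mem m h))

variable [IsNoetherianRing R]

/-- Krull's principal ideal theorem bounds the height of `p/q` by one, where `q` is the homogeneous
core, so no prime lies strictly between `q` and `p`. -/
lemma eq_homogeneousCore_of_lt (p p' : Ideal R) [p.IsPrime] [p'.IsPrime] (h : p' < p)
    (hq : (p.homogeneousCore 𝒜).toIdeal ≤ p') : (p.homogeneousCore 𝒜).toIdeal = p' := by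
  by_contra hne
  obtain ⟨g, hg⟩ := exists_mem_minimalPrimes_homogeneousCore (𝒜 := 𝒜) p
  set q : Ideal R := (p.homogeneousCore 𝒜).toIdeal with hqdef
  have hqprime : q.IsPrime := Ideal.IsPrime.homogeneousCore (𝒜 := 𝒜) inferInstance
  have h1 := Ideal.map_height_le_one_of_mem_minimalPrimes hg
  have hker : ∀ J : Ideal R, q ≤ J →
      (J.map (Ideal.Quotient.mk q)).comap (Ideal.Quotient.mk q) = J := fun J hJ => by
    rw [Ideal.comap_map_of_surjective' _ Ideal.Quotient.mk_surjective, Ideal.mk_ker,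
      sup_eq_left.mpr hJ]
  have hprime : ∀ J : Ideal R, J.IsPrime → q ≤ J → (J.map (Ideal.Quotient.mk q)).IsPrime :=
    fun J hJ hqJ => Ideal.map_isPrime_of_surjective Ideal.Quotient.mk_surjective
      (by rwa [Ideal.mk_ker])
  have hlt : ∀ J J' : Ideal R, q ≤ J → q ≤ J' → J < J' →
      J.map (Ideal.Quotient.mk q) < J'.map (Ideal.Quotient.mk q) := by
    intro J J' hJ hJ' hJJ
    refine lt_of_le_of_ne (Ideal.map_mono hJJ.le) fun he => hJJ.ne ?_
    rw [← hker J hJ, ← hker J' hJ', he]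
  have i1 := hprime p inferInstance (hq.trans h.le)
  have i2 := hprime p' inferInstance hq
  have i3 := hprime q hqprime le_rfl
  have h2 := Ideal.height_add_one_le_of_lt_of_isPrime
    (hlt p' p hq (hq.trans h.le) h)
  have h3 := Ideal.height_add_one_le_of_lt_of_isPrime
    (hlt q p' le_rfl hq (lt_of_le_of_ne hq hne))
  have h4 := (add_le_add_left ((self_le_add_left 1 _).trans h3) 1).trans (h2.trans h1)
  exact absurd h4 (by decide)

/-- Induction on the height. A prime `p' < p` either has the same core as `p`, and is then equal to
that core, or has a strictly smaller core, and induction bounds its height by that of the core of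
`p`. -/
lemma height_le_homogeneousCore (n : ℕ) (p : Ideal R) [p.IsPrime] (hn : p.height = n) :
    p.height ≤ (p.homogeneousCore 𝒜).toIdeal.height + 1 := by
  induction n using Nat.strong_induction_on generalizing p with
  | _ n ih =>
    set q : Ideal R := (p.homogeneousCore 𝒜).toIdeal with hqdef
    have hqprime : q.IsPrime := Ideal.IsPrime.homogeneousCore (𝒜 := 𝒜) inferInstance
    have hqp : q ≤ p := Ideal.toIdeal_homogeneousCore_le 𝒜 p
    obtain ⟨m, hm⟩ := ENat.ne_top_iff_exists.mp (Ideal.height_ne_top_of_isPrime (I := q))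
    rw [← hm]
    have : ((m : ℕ∞) + 1) = ((m + 1 : ℕ) : ℕ∞) := by push_cast; rfl
    rw [this, Ideal.height_le_iff]
    intro p' hp' hlt
    rw [Nat.cast_add, Nat.cast_one, ENat.lt_add_one_iff (ENat.natCast_ne_top m), hm]
    set q' : Ideal R := (p'.homogeneousCore 𝒜).toIdeal with hqdef'
    have hqprime' : q'.IsPrime := Ideal.IsPrime.homogeneousCore (𝒜 := 𝒜) inferInstance
    have hqq : q' ≤ q := Ideal.homogeneousCore_mono 𝒜 hlt.le
    rcases hqq.eq_or_lt with he | hne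
    · have hqp' : q ≤ p' := he ▸ Ideal.toIdeal_homogeneousCore_le 𝒜 p'
      rw [← eq_homogeneousCore_of_lt (𝒜 := 𝒜) p p' hlt hqp']
    · obtain ⟨k, hk⟩ := ENat.ne_top_iff_exists.mp (Ideal.height_ne_top_of_isPrime (I := p'))
      have hkn : k < n := by
        have := Ideal.height_strict_mono_of_isPrime_of_isPrime hlt
        rw [hn, ← hk] at this
        exact_mod_cast this
      exact (ih k hkn p' hk.symm).trans (Ideal.height_add_one_le_of_lt_of_isPrime hne)

/-- The dimension of a standard graded algebra is the height of the irrelevant ideal. -/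
theorem ringKrullDim_eq_height_irrelevantIdeal (h𝒜 : IsStandardGraded 𝒜) :
    ringKrullDim R = (irrelevantIdeal 𝒜).height := by
  have hmax := irrelevantIdeal_isMaximal h𝒜
  refine le_antisymm ?_ Ideal.height_le_ringKrullDim_of_isPrime
  rw [ringKrullDim_le_iff_height_le]
  intro p hp
  refine WithBot.coe_le_coe.mpr ?_
  set q : Ideal R := (p.homogeneousCore 𝒜).toIdeal with hqdef
  have hqprime : q.IsPrime := Ideal.IsPrime.homogeneousCore (𝒜 := 𝒜) inferInstance
  have hqm : q ≤ irrelevantIdeal 𝒜 :=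
    le_irrelevantIdeal h𝒜 (p.homogeneousCore 𝒜).isHomogeneous hqprime.ne_top
  -- If the core of `p` is `𝔪` then `p = 𝔪`; otherwise the height of `p` exceeds that of its core by
  -- at most one, so is at most that of `𝔪`.
  rcases hqm.eq_or_lt with he | hlt
  · have hle : irrelevantIdeal 𝒜 ≤ p := he ▸ Ideal.toIdeal_homogeneousCore_le 𝒜 p
    rw [hmax.eq_of_le hp.ne_top hle]
  · obtain ⟨n, hn⟩ := ENat.ne_top_iff_exists.mp (Ideal.height_ne_top_of_isPrime (I := p))
    exact (height_le_homogeneousCore n p hn.symm).trans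
      (Ideal.height_add_one_le_of_lt_of_isPrime hlt)

end GradedLiaison


/-! ### Localization of Gorenstein rings and of Cohen-Macaulay quotients -/

namespace ExtModule

open RingTheory.Sequence IsLocalRing

variable {R : Type u} [CommRing R]

/-- The localization of a ring, as a module over itself, is the localized module. -/
noncomputable def localizedModuleSelfEquiv (S : Submonoid R) :
    (ModuleCat.of R R).localizedModule S ≃ₗ[Localization S] Localization S :=
  have : IsLocalizedModule S ((ModuleCat.of R R).localizedModuleMkLinearMap S) :=
    ModuleCat.localizedModule_isLocalizedModule (ModuleCat.of R R) S
  LinearEquiv.extendScalarsOfIsLocalization S (Localization S)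
    (IsLocalizedModule.linearEquiv S ((ModuleCat.of R R).localizedModuleMkLinearMap S)
      (Algebra.linearMap R (Localization S)))

lemma localizedModule_self_injectiveDimensionLE_iff (S : Submonoid R) (n : ℕ) :
    HasInjectiveDimensionLE ((ModuleCat.of R R).localizedModule S) n ↔
      HasInjectiveDimensionLE (ModuleCat.of (Localization S) (Localization S)) n :=
  ModuleCat.hasInjectiveDimensionLE_iff_of_linearEquiv
    (N := ModuleCat.of (Localization S) (Localization S)) (localizedModuleSelfEquiv S) n

/-- A Gorenstein ring of finite dimension has finite injective dimension over itself. -/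
theorem injectiveDimensionLE_of_isGorensteinRing (hR : IsGorensteinRing R) {n : ℕ}
    (hn : ringKrullDim R = n) : HasInjectiveDimensionLE (ModuleCat.of R R) n := by
  have := hR.isNoetherianRing
  rw [ModuleCat.hasInjectiveDimensionLE_iff_forall_maximalSpectrum]
  intro p
  have hp := p.isMaximal
  rw [localizedModule_self_injectiveDimensionLE_iff]
  have hA : IsGorensteinLocalRing (Localization.AtPrime p.asIdeal) := hR.localization p.asIdeal
  obtain ⟨k, hk⟩ := exists_ringKrullDim_eq (Localization.AtPrime p.asIdeal)
  have hkn : k ≤ n := by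
    have h1 : ringKrullDim (Localization.AtPrime p.asIdeal) ≤ ringKrullDim R := by
      rw [IsLocalization.AtPrime.ringKrullDim_eq_height p.asIdeal]
      exact Ideal.height_le_ringKrullDim_of_isPrime
    rw [hk, hn] at h1
    exact_mod_cast h1
  have := injectiveDimensionLE_ringKrullDim hA hk
  exact hasInjectiveDimensionLT_of_ge _ (k + 1) (n + 1) (by omega)

theorem isGorensteinRing_of_injectiveDimensionLE [IsNoetherianRing R] {n : ℕ}
    (h : HasInjectiveDimensionLE (ModuleCat.of R R) n) : IsGorensteinRing R where
  isNoetherianRing := inferInstance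
  localization p _ :=
    { isLocalRing := inferInstance
      isNoetherianRing := IsLocalization.isNoetherianRing p.primeCompl _ inferInstance
      finite_injectiveDimension := ⟨n, (localizedModule_self_injectiveDimensionLE_iff _ n).mp
        ((ModuleCat.of R R).localizedModule_hasInjectiveDimensionLE n p.primeCompl)⟩ }

attribute [local instance] RingHomInvPair.of_ringEquiv in
lemma isGorensteinLocalRing_of_ringEquiv {A B : Type u} [CommRing A] [CommRing B] (e : A ≃+* B)
    (h : IsGorensteinLocalRing A) : IsGorensteinLocalRing B where
  isLocalRing := have := h.isLocalRing; e.isLocalRing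
  isNoetherianRing := have := h.isNoetherianRing; isNoetherianRing_of_ringEquiv A e
  finite_injectiveDimension := by
    obtain ⟨n, hn⟩ := h.finite_injectiveDimension
    let σ : A ≃ₛₗ[RingHomClass.toRingHom e] B :=
      { e with map_smul' := fun a b => by simp }
    exact ⟨n, (ModuleCat.hasInjectiveDimensionLE_iff_of_semiLinearEquiv e
      (M := ModuleCat.of A A) (N := ModuleCat.of B B) σ n).mp hn⟩

variable (m : Ideal R) [m.IsMaximal] {c : Ideal R}

/-- The quotient of the localization of `R` at `m` by a Gorenstein ideal is Gorenstein. -/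
lemma isGorensteinLocalRing_localization_quotient (hcm : c ≤ m) (hc : IsGorensteinRing (R ⧸ c)) :
    IsGorensteinLocalRing
      (Localization.AtPrime m ⧸ c.map (algebraMap R (Localization.AtPrime m))) := by
  have hker : RingHom.ker (Ideal.Quotient.mk c) ≤ m := by rwa [Ideal.mk_ker]
  have hmax : (m.map (Ideal.Quotient.mk c)).IsMaximal :=
    Ideal.IsMaximal.map_of_surjective_of_ker_le Ideal.Quotient.mk_surjective hker
  -- Localization commutes with the quotient: the image of the complement of `m` is the complement
  -- of `m/c`, because `c ≤ m`.
  have hS : Algebra.algebraMapSubmonoid (R ⧸ c) m.primeCompl =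
      (m.map (Ideal.Quotient.mk c)).primeCompl := by
    ext x
    obtain ⟨x, rfl⟩ := Ideal.Quotient.mk_surjective x
    have hmem : ∀ y, Ideal.Quotient.mk c y ∈ m.map (Ideal.Quotient.mk c) ↔ y ∈ m := fun y => by
      rw [← Ideal.mem_comap, Ideal.comap_map_of_surjective' _ Ideal.Quotient.mk_surjective,
        sup_eq_left.mpr hker]
    constructor
    · rintro ⟨y, hy, hyx⟩
      rw [← hyx]
      exact fun h => hy ((hmem y).mp h)
    · exact fun h => ⟨x, fun hx => h ((hmem x).mpr hx), rfl⟩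
  have hloc : IsLocalization (Algebra.algebraMapSubmonoid (R ⧸ c) m.primeCompl)
    (Localization.AtPrime m ⧸ c.map (algebraMap R (Localization.AtPrime m))) := inferInstance
  rw [hS] at hloc
  exact isGorensteinLocalRing_of_ringEquiv (IsLocalization.algEquiv
    (m.map (Ideal.Quotient.mk c)).primeCompl (Localization.AtPrime (m.map (Ideal.Quotient.mk c)))
    _).toRingEquiv (hc.localization _)

/-- Localization of a Cohen-Macaulay quotient. -/
lemma exists_isWeaklyRegular_localization [IsNoetherianRing R] (hcm : c ≤ m) (rs : List R)
    (hrs : ∀ r ∈ rs, r ∈ m) (hreg : IsWeaklyRegular (R ⧸ c) rs)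
    (hdim : Module.supportDim R (R ⧸ c) = rs.length) :
    ∃ rs' : List (Localization.AtPrime m), rs'.length = rs.length ∧
      (∀ r ∈ rs', r ∈ maximalIdeal (Localization.AtPrime m)) ∧
      IsWeaklyRegular (Loc m.primeCompl (R ⧸ c)) rs' ∧
      Module.supportDim (Localization.AtPrime m) (Loc m.primeCompl (R ⧸ c)) = rs'.length := by
  have hmem : ∀ r ∈ rs.map (algebraMap R (Localization.AtPrime m)),
      r ∈ maximalIdeal (Localization.AtPrime m) := by
    intro r hr
    obtain ⟨x, hx, rfl⟩ := List.mem_map.mp hr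
    exact (IsLocalization.AtPrime.to_map_mem_maximal_iff _ m x).mpr (hrs x hx)
  have hreg' : IsWeaklyRegular (Loc m.primeCompl (R ⧸ c))
      (rs.map (algebraMap R (Localization.AtPrime m))) :=
    hreg.of_isLocalizedModule (Localization.AtPrime m) m.primeCompl (locMk m.primeCompl (R ⧸ c))
  have hnt : Nontrivial (Loc m.primeCompl (R ⧸ c)) := by
    refine ⟨locMk m.primeCompl (R ⧸ c) (c.mkQ 1), 0, fun h => ?_⟩
    obtain ⟨s, hs, h1⟩ := (locMk_eq_zero_iff _ _).mp h
    rw [← map_smul, smul_eq_mul, mul_one] at h1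
    exact hs (hcm ((Submodule.Quotient.mk_eq_zero c).mp h1))
  refine ⟨rs.map (algebraMap R (Localization.AtPrime m)), by simp, hmem, hreg', ?_⟩
  refine le_antisymm ?_ (length_le_supportDim _ hmem hreg')
  rw [List.length_map, ← hdim]
  exact supportDim_loc_le _ _

end ExtModule


/-! ### Linkage of homogeneous ideals -/

namespace GradedLiaison

open ExtModule RingTheory.Sequence IsLocalRing

variable {K : Type v} [Field K] {R : Type u} [CommRing R] [Algebra K R]
  {𝒜 : ℤ → Submodule K R} [GradedAlgebra 𝒜]

lemma exists_ringKrullDim_eq_localization [IsNoetherianRing R] (h𝒜 : IsStandardGraded 𝒜)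
    [(irrelevantIdeal 𝒜).IsMaximal] :
    ∃ n : ℕ, ringKrullDim R = n ∧
      ringKrullDim (Localization.AtPrime (irrelevantIdeal 𝒜)) = n := by
  have : IsNoetherianRing (Localization.AtPrime (irrelevantIdeal 𝒜)) :=
    IsLocalization.isNoetherianRing (irrelevantIdeal 𝒜).primeCompl _ inferInstance
  obtain ⟨n, hn⟩ := exists_ringKrullDim_eq (Localization.AtPrime (irrelevantIdeal 𝒜))
  refine ⟨n, ?_, hn⟩
  rw [← hn, ringKrullDim_eq_height_irrelevantIdeal h𝒜,
    IsLocalization.AtPrime.ringKrullDim_eq_height (irrelevantIdeal 𝒜)]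

lemma exists_quotientProjection {c : Ideal R} (hc : c.IsHomogeneous 𝒜) :
    ∃ π, IsProjection (quotientGrading (ringGrading 𝒜) c) π := by
  obtain ⟨π, hπ, -⟩ := (isProjection_ring (𝒜 := 𝒜)).exists_map c.mkQ (Submodule.mkQ_surjective c)
    (by rw [Submodule.ker_mkQ]; exact isHomogeneousSubmodule_ideal hc)
  exact ⟨π, hπ⟩

lemma isModuleGrading_quotient {c : Ideal R} (hc : c.IsHomogeneous 𝒜) :
    IsModuleGrading 𝒜 (quotientGrading (ringGrading 𝒜) c) :=
  isModuleGrading_ring.map isProjection_ring c.mkQ (Submodule.mkQ_surjective c)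
    (by rw [Submodule.ker_mkQ]; exact isHomogeneousSubmodule_ideal hc)

/-- Vanishing of graded Ext modules can be checked locally. -/
lemma ext_subsingleton_of_localization [IsNoetherianRing R] (h𝒜 : IsStandardGraded 𝒜)
    [(irrelevantIdeal 𝒜).IsMaximal] {M : Type u} [AddCommGroup M] [Module R M] [Module.Finite R M]
    {gr : ℤ → AddSubgroup M} (hM : IsModuleGrading 𝒜 gr) (i : ℕ)
    [Subsingleton (ExtMod (Localization.AtPrime (irrelevantIdeal 𝒜))
      (Loc (irrelevantIdeal 𝒜).primeCompl M) (Loc (irrelevantIdeal 𝒜).primeCompl R) i)] :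
    Subsingleton (ExtMod R M R i) := by
  obtain ⟨gr', hgr', -⟩ := exists_ext_grading i M hM
  obtain ⟨π, hπ⟩ := exists_isProjection hgr'.isInternal
  have hle : (⊤ : Submodule R (ExtMod R M R i)) ≤ ⊥ := by
    refine le_of_locally_le h𝒜 hgr' hπ ?_ (fun _ _ _ => trivial) fun x _ => ?_
    · intro x hx j
      rw [Submodule.mem_bot] at hx ⊢
      rw [hx, map_zero]
    · obtain ⟨s, hs, hsx⟩ := (locExt_localizes (N := R) (irrelevantIdeal 𝒜).primeCompl i M).1 x
        (Subsingleton.elim _ _)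
      exact ⟨s, hs, hsx⟩
  exact subsingleton_of_forall_eq 0 fun x => hle (Submodule.mem_top (x := x))

/-- A generator of the localized canonical module of `R ⧸ c` with annihilator `c` yields a
homogeneous isomorphism of `R ⧸ c` with its canonical module. -/
lemma exists_isGradedDuality [IsNoetherianRing R] (h𝒜 : IsStandardGraded 𝒜)
    [(irrelevantIdeal 𝒜).IsMaximal] {c : Ideal R} (hc : c.IsHomogeneous 𝒜)
    (hcm : c ≤ irrelevantIdeal 𝒜) (n : ℕ)
    (γ : ExtMod (Localization.AtPrime (irrelevantIdeal 𝒜))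
      (Loc (irrelevantIdeal 𝒜).primeCompl (R ⧸ c)) (Loc (irrelevantIdeal 𝒜).primeCompl R) n)
    (hγ : ∀ y, ∃ a : Localization.AtPrime (irrelevantIdeal 𝒜), a • γ = y)
    (hγc : ∀ a : Localization.AtPrime (irrelevantIdeal 𝒜), a • γ = 0 →
      a ∈ c.map (algebraMap R (Localization.AtPrime (irrelevantIdeal 𝒜)))) :
    ∃ (s : ℤ) (α : (R ⧸ c) ≃ₗ[R] ExtRing R (R ⧸ c) n),
      IsGradedDuality 𝒜 (quotientGrading (ringGrading 𝒜) c) s α := by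
  set m := irrelevantIdeal 𝒜 with hm
  set A := Localization.AtPrime m with hA
  let Λ := locExt m.primeCompl (R ⧸ c) R n
  obtain ⟨hker, hsurj⟩ := locExt_localizes (N := R) m.primeCompl n (R ⧸ c)
  obtain ⟨gr', hgr', hhom⟩ := exists_ext_grading n (R ⧸ c) (isModuleGrading_quotient hc)
  obtain ⟨π, hπ⟩ := exists_isProjection hgr'.isInternal
  have hunit : ∀ s, s ∉ m → IsUnit (algebraMap R A s) := fun s hs =>
    IsLocalization.map_units A (⟨s, hs⟩ : m.primeCompl)
  -- a homogeneous generator of the localized module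
  obtain ⟨t, ht, e, he⟩ := hsurj γ
  have hgen : ∀ y, ∃ a : A, a • Λ e = y := by
    intro y
    obtain ⟨a, rfl⟩ := hγ y
    obtain ⟨u, hu⟩ := hunit t ht
    exact ⟨a * ↑u⁻¹, by
      change (a * ↑u⁻¹) • locExt m.primeCompl (R ⧸ c) R n e = _
      rw [← he, ← hu, smul_smul, mul_assoc, Units.inv_mul, mul_one]⟩
  have hann : ∀ a : A, a • Λ e = 0 → a ∈ c.map (algebraMap R A) := by
    intro a ha
    have h1 : (a * algebraMap R A t) • γ = 0 := by
      rw [mul_smul, he]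
      exact ha
    exact (Ideal.mul_unit_mem_iff_mem _ (hunit t ht)).mp (hγc _ h1)
  -- Each component of `e` is locally a multiple `a i` of `e`. These multiples sum to `1` modulo
  -- `cA`, which lies in the maximal ideal, so in the local ring `A` one of them is a unit and the
  -- corresponding component generates.
  choose a ha using fun i => hgen (Λ (π i e))
  obtain ⟨T, hT⟩ := hπ.exists_sum e
  have hsum : (1 - ∑ i ∈ T, a i) • Λ e = 0 := by
    rw [sub_smul, one_smul, Finset.sum_smul, Finset.sum_congr rfl fun i _ => ha i, ← map_sum,
      ← hT, sub_self]
  have hcA : c.map (algebraMap R A) ≤ maximalIdeal A := by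
    rw [Ideal.map_le_iff_le_comap]
    exact fun r hr => (IsLocalization.AtPrime.to_map_mem_maximal_iff _ m r).mpr (hcm hr)
  obtain ⟨d, hd⟩ : ∃ d, IsUnit (a d) := by
    by_contra! hno
    have h1 : ∑ i ∈ T, a i ∈ maximalIdeal A := sum_mem fun i _ => hno i
    have h2 := add_mem (hcA (hann _ hsum)) h1
    rw [sub_add_cancel] at h2
    exact (Ideal.ne_top_iff_one _).mp (maximalIdeal.isMaximal A).ne_top h2
  set ε := π d e with hε
  have hεmem : ε ∈ gr' d := hπ.mem d e
  obtain ⟨u, hu⟩ := hd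
  have hgenε : ∀ y, ∃ b : A, b • Λ ε = y := by
    intro y
    obtain ⟨b, rfl⟩ := hgen y
    exact ⟨b * ↑u⁻¹, by rw [← ha d, ← hu, smul_smul, mul_assoc, Units.inv_mul, mul_one]⟩
  have hannε : ∀ b : A, b • Λ ε = 0 → b ∈ c.map (algebraMap R A) := by
    intro b hb
    rw [← ha d, smul_smul] at hb
    exact (Ideal.mul_unit_mem_iff_mem _ (hu ▸ u.isUnit)).mp (hann _ hb)
  -- the homogeneous generator of the graded module
  let f : R →ₗ[R] ExtMod R (R ⧸ c) R n := LinearMap.toSpanSingleton R _ ε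
  have hf : ∀ r, f r = r • ε := fun r => rfl
  have hfgr : ∀ i, ∀ r ∈ 𝒜 i, f r ∈ gr' (i + d) := fun i r hr => hgr'.smul_mem i d r hr ε hεmem
  have hπf : ∀ i r, π (i + d) (f r) = f (ringProj 𝒜 i r) := fun i r =>
    smul_proj_apply hgr' hπ r hεmem i
  -- Surjectivity of `f`, and below the equality of its kernel with `c`, concern graded submodules,
  -- so graded Nakayama deduces them from the localization.
  have hrange : (⊤ : Submodule R (ExtMod R (R ⧸ c) R n)) ≤ LinearMap.range f := by
    refine le_of_locally_le h𝒜 hgr' hπ ?_ (fun _ _ _ => trivial) fun x _ => ?_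
    · rintro _ ⟨r, rfl⟩ i
      have := hπf (i - d) r
      rw [sub_add_cancel] at this
      exact ⟨_, this.symm⟩
    · obtain ⟨b, hb⟩ := hgenε (Λ x)
      obtain ⟨⟨r, s⟩, hrs⟩ := IsLocalization.surj m.primeCompl b
      have h1 : Λ ((s : R) • x - r • ε) = 0 := by
        rw [map_sub, sub_eq_zero]
        refine (locExt_smul _ _ _ _).trans ?_
        refine Eq.trans ?_ (locExt_smul _ _ _ _).symm
        change algebraMap R A s • Λ x = algebraMap R A r • Λ ε
        rw [← hb, ← hrs, smul_smul, mul_comm]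
      obtain ⟨w, hw, h2⟩ := hker _ h1
      rw [smul_sub, sub_eq_zero, smul_smul, smul_smul] at h2
      exact ⟨w * s, m.primeCompl.mul_mem hw s.2, w * r, h2.symm⟩
  have hkerf : LinearMap.ker f = c := by
    refine le_antisymm ?_ fun r hr => smul_eq_zero_of_left r (smul_quotient_eq_zero hr) n ε
    refine le_of_locally_le h𝒜 isModuleGrading_ring (isProjection_ring (𝒜 := 𝒜))
      (isHomogeneousSubmodule_ideal hc) ?_ fun r hr => ?_
    · intro r hr i
      rw [LinearMap.mem_ker] at hr ⊢
      rw [← hπf, hr, map_zero]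
    · have h1 : algebraMap R A r • Λ ε = 0 := by
        refine (locExt_smul _ _ _ _).symm.trans ?_
        rw [show r • ε = 0 from hr, map_zero]
      obtain ⟨s, hs, h2⟩ := (IsLocalization.algebraMap_mem_map_algebraMap_iff m.primeCompl A c r).mp
        (hannε _ h1)
      exact ⟨s, hs, h2⟩
  -- The shift is the degree of the homogeneous generator.
  refine ⟨d, (Submodule.quotEquivOfEq _ _ hkerf.symm).trans (f.quotKerEquivOfSurjective
    (LinearMap.range_eq_top.mp (top_le_iff.mp hrange))), ?_⟩
  rintro i _ ⟨r, hr, rfl⟩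
  exact hhom _ _ (hfgr i r hr)

end GradedLiaison


/-! ### The graded theorem -/

namespace GradedLiaison

open ExtModule RingTheory.Sequence IsLocalRing

variable {K : Type v} [Field K] {R : Type u} [CommRing R] [Algebra K R]
  {𝒜 : ℤ → Submodule K R} [GradedAlgebra 𝒜]

/-- Homogeneous ideals linked by `c` have the same dimension as `c`. -/
lemma supportDim_quotient_colon [IsNoetherianRing R] (h𝒜 : IsStandardGraded 𝒜)
    {I J c : Ideal R} (hJ' : J.IsHomogeneous 𝒜) (hc : c.IsHomogeneous 𝒜) (hI : I ≠ ⊤)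
    (hcm : c ≤ irrelevantIdeal 𝒜) (rs : List R) (hrs : ∀ r ∈ rs, r ∈ irrelevantIdeal 𝒜)
    (hreg : IsWeaklyRegular (R ⧸ c) rs) (hdim : Module.supportDim R (R ⧸ c) = rs.length)
    (h : c.colon (J : Set R) = I) :
    Module.supportDim R (R ⧸ I) = Module.supportDim R (R ⧸ c) := by
  have hmax := irrelevantIdeal_isMaximal h𝒜
  have hcI : c ≤ I := h ▸ le_colon c J
  refine le_antisymm (Module.supportDim_le_of_surjective (Submodule.factor hcI)
    (Submodule.factor_surjective hcI)) ?_
  set m := irrelevantIdeal 𝒜 with hm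
  obtain ⟨rs', hlen, hrs', hreg', -⟩ := exists_isWeaklyRegular_localization m hcm rs hrs hreg hdim
  have : IsNoetherianRing (Localization.AtPrime m) :=
    IsLocalization.isNoetherianRing m.primeCompl _ inferInstance
  set P : Submodule R (R ⧸ c) := Submodule.map c.mkQ J with hP
  -- The dimension bound is applied to the localized image of `J`, which is non-zero by graded
  -- Nakayama; localizing does not raise the dimension.
  set ι := locMap m.primeCompl P.subtype with hι
  have hιinj : Function.Injective ι := locMap_injective _ P.subtype_injective
  have hne : LinearMap.range ι ≠ ⊥ := by
    intro h0
    rw [LinearMap.range_eq_bot] at h0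
    have hle : J ≤ c := by
      refine le_of_locally_le h𝒜 isModuleGrading_ring (isProjection_ring (𝒜 := 𝒜))
        (isHomogeneousSubmodule_ideal hc) (isHomogeneousSubmodule_ideal hJ') fun j hj => ?_
      have h1 := locMap_locMk m.primeCompl P.subtype ⟨c.mkQ j, Submodule.mem_map_of_mem hj⟩
      rw [← hι, h0] at h1
      obtain ⟨s, hs, h2⟩ := (locMk_eq_zero_iff _ _).mp h1.symm
      change s • c.mkQ j = 0 at h2
      rw [← map_smul] at h2
      exact ⟨s, hs, (Submodule.Quotient.mk_eq_zero c).mp h2⟩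
    apply hI
    rw [← h, Ideal.eq_top_iff_one, Submodule.mem_colon]
    intro j hj
    rw [one_smul]
    exact hle hj
  have h1 := length_le_supportDim_submodule _ rs' hrs' hreg' _ hne
  rw [← Module.supportDim_eq_of_equiv (LinearEquiv.ofInjective ι hιinj)] at h1
  rw [hdim, ← hlen]
  refine h1.trans ((supportDim_loc_le m.primeCompl P).trans (supportDim_le_of_killed I _ ?_))
  rintro r hr ⟨_, j, hj, rfl⟩
  refine Subtype.ext ?_
  change r • c.mkQ j = 0
  rw [← map_smul]
  rw [← h, Submodule.mem_colon] at hr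
  exact (Submodule.Quotient.mk_eq_zero c).mpr (hr j hj)

/-- `Ext^i(R ⧸ c, R)` vanishes for `i ≠ codim (R ⧸ c)` if `R ⧸ c` is Cohen-Macaulay. -/
lemma ext_subsingleton_of_ne (h𝒜 : IsStandardGraded 𝒜) (hR : IsGorensteinRing R)
    {c : Ideal R} (hc : c.IsHomogeneous 𝒜) (hcm : c ≤ irrelevantIdeal 𝒜) (rs : List R)
    (hrs : ∀ r ∈ rs, r ∈ irrelevantIdeal 𝒜) (hreg : IsWeaklyRegular (R ⧸ c) rs)
    (hdim : Module.supportDim R (R ⧸ c) = rs.length) {n k : ℕ} (hn : ringKrullDim R = n)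
    (hk : k + rs.length = n) (i : ℕ) (hi : i ≠ k) : Subsingleton (ExtMod R (R ⧸ c) R i) := by
  have := hR.isNoetherianRing
  have hmax := irrelevantIdeal_isMaximal h𝒜
  -- The ring and its localization at `𝔪` have the same dimension, so `k` is the codimension locally
  -- as well.
  obtain ⟨n', hn', hnA⟩ := exists_ringKrullDim_eq_localization h𝒜
  obtain rfl : n' = n := by
    rw [hn] at hn'
    exact_mod_cast hn'.symm
  have hA := hR.localization (irrelevantIdeal 𝒜)
  obtain ⟨rs', hlen, hrs', hreg', hdim'⟩ :=
    exists_isWeaklyRegular_localization (irrelevantIdeal 𝒜) hcm rs hrs hreg hdim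
  have h1 := ExtModule.ext_subsingleton_of_ne hA hnA rs' hrs' hreg' hdim' (hlen ▸ hk) i hi
  have h2 := (postEquiv (Loc (irrelevantIdeal 𝒜).primeCompl (R ⧸ c))
    (locSelfEquiv (irrelevantIdeal 𝒜).primeCompl) i).injective.subsingleton
  exact ext_subsingleton_of_localization h𝒜 (isModuleGrading_quotient hc) i

/-- A homogeneous Gorenstein ideal defines a quasi-Gorenstein module. -/
lemma exists_isGradedDuality_of_isGorensteinRing (h𝒜 : IsStandardGraded 𝒜)
    (hR : IsGorensteinRing R) {c : Ideal R} (hc : c.IsHomogeneous 𝒜)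
    (hcm : c ≤ irrelevantIdeal 𝒜) (hgor : IsGorensteinRing (R ⧸ c)) (rs : List R)
    (hrs : ∀ r ∈ rs, r ∈ irrelevantIdeal 𝒜) (hreg : IsWeaklyRegular (R ⧸ c) rs)
    (hdim : Module.supportDim R (R ⧸ c) = rs.length) {n k : ℕ} (hn : ringKrullDim R = n)
    (hk : k + rs.length = n) :
    ∃ (s : ℤ) (α : (R ⧸ c) ≃ₗ[R] ExtRing R (R ⧸ c) k),
      IsGradedDuality 𝒜 (quotientGrading (ringGrading 𝒜) c) s α := by
  have := hR.isNoetherianRing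
  have hmax := irrelevantIdeal_isMaximal h𝒜
  obtain ⟨n', hn', hnA⟩ := exists_ringKrullDim_eq_localization h𝒜
  obtain rfl : n' = n := by
    rw [hn] at hn'
    exact_mod_cast hn'.symm
  set m := irrelevantIdeal 𝒜 with hm
  have hA := hR.localization m
  obtain ⟨rs', hlen, hrs', hreg', hdim'⟩ :=
    exists_isWeaklyRegular_localization m hcm rs hrs hreg hdim
  have hcA := isGorensteinLocalRing_localization_quotient m hcm hgor
  have := hcA.isLocalRing
  obtain ⟨e⟩ := nonempty_locQuotientEquiv m.primeCompl c
  obtain ⟨β⟩ := nonempty_quotient_equiv_ext hA hnA _ hcA rs' hrs'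
    ((e.isWeaklyRegular_congr rs').mp hreg') ((Module.supportDim_eq_of_equiv e).symm.trans hdim')
    k (hlen ▸ hk)
  let β' := (β.trans (preEquiv _ e k)).trans
    (postEquiv (Loc m.primeCompl (R ⧸ c)) (locSelfEquiv m.primeCompl).symm k)
  refine exists_isGradedDuality h𝒜 hc hcm k (β' (Submodule.mkQ _ 1)) (fun y => ?_) fun a ha => ?_
  · obtain ⟨a, ha⟩ := Submodule.mkQ_surjective _ (β'.symm y)
    refine ⟨a, ?_⟩
    rw [← map_smul, smul_mkQ_eq, one_smul, ha, LinearEquiv.apply_symm_apply]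
  · rw [← map_smul, LinearEquiv.map_eq_zero_iff, smul_mkQ_eq, one_smul] at ha
    exact (Submodule.Quotient.mk_eq_zero _).mp ha

omit [GradedAlgebra 𝒜] in
lemma factor_mem_quotientGrading {I c : Ideal R} (h : c ≤ I) (i : ℤ) (x : R ⧸ c)
    (hx : x ∈ quotientGrading (ringGrading 𝒜) c i) :
    Submodule.factor h x ∈ quotientGrading (ringGrading 𝒜) I i := by
  obtain ⟨r, hr, rfl⟩ := hx
  exact ⟨r, hr, rfl⟩

/-- The linking map is `α` followed by restriction to a graded submodule, and both preserve
homogeneity. -/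
lemma isoImageLinkingMap [IsNoetherianRing R] {I J c : Ideal R} (hI : I.IsHomogeneous 𝒜)
    (hc : c.IsHomogeneous 𝒜) {k : ℕ} (hv : ∀ j < k, Subsingleton (ExtMod R (R ⧸ c) R j)) (s : ℤ)
    (α : (R ⧸ c) ≃ₗ[R] ExtRing R (R ⧸ c) k)
    (hα : IsGradedDuality 𝒜 (quotientGrading (ringGrading 𝒜) c) s α) (h1 : c ≤ I)
    (h : c.colon (I : Set R) = J) :
    IsoImageLinkingMap 𝒜 (quotientGrading (ringGrading 𝒜) J)
      (quotientGrading (ringGrading 𝒜) c) s α (Submodule.factor h1) := by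
  obtain ⟨e, he⟩ := exists_equiv_range_linkingMap hv α _ (range_factor h1) h
  obtain ⟨π, hπ⟩ := exists_quotientProjection hc
  obtain ⟨π', hπ'⟩ := exists_quotientProjection hI
  refine ⟨e, ?_⟩
  rintro i _ ⟨r, hr, rfl⟩
  have h2 := IsHomogeneousExt.restrict hπ (hα i (c.mkQ r) ⟨r, hr, rfl⟩)
    (hπ.isHomogeneousSubmodule_ker hπ' (Submodule.factor h1) (factor_mem_quotientGrading h1))
  have h3 := he r
  change IsHomogeneousExt 𝒜 (i + s) k _ _ (e (J.mkQ r)).1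
  rw [h3]
  exact h2

/-- As in the local case, with two changes. Finite injective dimension of `R/c` over itself gives
the Gorenstein property at all maximal ideals at once, not only at `𝔪`; and conversely the duality
has to be homogeneous, which comes from the homogeneous generator of the canonical module. -/
theorem idealsSmLinked_iff (h𝒜 : IsStandardGraded 𝒜) (hR : IsGorensteinRing R) {I J c : Ideal R}
    (hI' : I.IsHomogeneous 𝒜) (hJ' : J.IsHomogeneous 𝒜) (hc : c.IsHomogeneous 𝒜)
    (hI : I ≠ ⊤) (hJ : J ≠ ⊤) :
    IdealsSmLinked 𝒜 I J c ↔ GorensteinLinked 𝒜 I J c := by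
  have := hR.isNoetherianRing
  have hmax := irrelevantIdeal_isMaximal h𝒜
  obtain ⟨n, hn, -⟩ := exists_ringKrullDim_eq_localization h𝒜
  have hid := injectiveDimensionLE_of_isGorensteinRing hR hn
  constructor
  · rintro ⟨⟨hperf, -⟩, k, s, α, φ, ψ, hk, hα, -, -, -, -, hφ, hψ, ⟨eψ, -⟩, ⟨eφ, -⟩⟩
    have hcm : c ≤ irrelevantIdeal 𝒜 :=
      (le_of_range_eq_top hφ).trans (le_irrelevantIdeal h𝒜 hI' hI)
    obtain ⟨rs, hrs, hreg, hdim⟩ := hperf.isCohenMacaulay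
    have hv := ext_subsingleton_of_ne h𝒜 hR hc hcm rs hrs hreg.toIsWeaklyRegular hdim.symm hn
      ((add_length_eq hn hdim.symm).mp hk)
    have hv' : ∀ j < k, Subsingleton (ExtMod R (R ⧸ c) R j) := fun j hj => hv j hj.ne
    obtain ⟨n', hn'⟩ := exists_injectiveDimensionLE_quotient c hid hv α
    exact ⟨⟨hperf, isGorensteinRing_of_injectiveDimensionLE hn'⟩,
      colon_eq_of_linkingMap hv' α φ hφ eφ, colon_eq_of_linkingMap hv' α ψ hψ eψ⟩
  · rintro ⟨⟨hperf, hgor⟩, hcI, hcJ⟩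
    have h1 : c ≤ I := hcJ ▸ le_colon c J
    have h2 : c ≤ J := hcI ▸ le_colon c I
    have hcm := h1.trans (le_irrelevantIdeal h𝒜 hI' hI)
    obtain ⟨rs, hrs, hreg, hdim⟩ := hperf.isCohenMacaulay
    have hle : rs.length ≤ n := by
      have := Module.supportDim_le_ringKrullDim R (R ⧸ c)
      rw [← hdim, hn] at this
      exact_mod_cast this
    obtain ⟨k, rfl⟩ : ∃ k, n = k + rs.length := ⟨n - rs.length, by omega⟩
    have hk : HasCodim R (R ⧸ c) k := (add_length_eq hn hdim.symm).mpr rfl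
    have hv := ext_subsingleton_of_ne h𝒜 hR hc hcm rs hrs hreg.toIsWeaklyRegular hdim.symm hn rfl
    have hv' : ∀ j < k, Subsingleton (ExtMod R (R ⧸ c) R j) := fun j hj => hv j hj.ne
    obtain ⟨s, α, hα⟩ := exists_isGradedDuality_of_isGorensteinRing h𝒜 hR hc hcm hgor rs hrs
      hreg.toIsWeaklyRegular hdim.symm hn rfl
    exact ⟨⟨hperf, k, s, α, hk, hα⟩, k, s, α, Submodule.factor h1, Submodule.factor h2, hk, hα,
      factor_mem_quotientGrading h1, factor_mem_quotientGrading h2,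
      (isEpiFrom_iff _ (range_factor h1)).mpr (supportDim_quotient_colon h𝒜 hJ' hc hI hcm rs hrs
        hreg.toIsWeaklyRegular hdim.symm hcJ),
      (isEpiFrom_iff _ (range_factor h2)).mpr (supportDim_quotient_colon h𝒜 hI' hc hJ hcm rs hrs
        hreg.toIsWeaklyRegular hdim.symm hcI),
      range_factor h1, range_factor h2,
      isoImageLinkingMap hJ' hc hv' s α hα h2 hcJ, isoImageLinkingMap hI' hc hv' s α hα h1 hcI⟩

theorem smLiaison_iff (h𝒜 : IsStandardGraded 𝒜) (hR : IsGorensteinRing R)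
    (I J : ProperHomogeneousIdeal 𝒜) : SmLiaison 𝒜 I J ↔ GorensteinLiaison 𝒜 I J := by
  have h : (fun I J : ProperHomogeneousIdeal 𝒜 => ∃ c : Ideal R, c.IsHomogeneous 𝒜 ∧
      IdealsSmLinked 𝒜 I.1 J.1 c) =
      fun I J => ∃ c : Ideal R, c.IsHomogeneous 𝒜 ∧ GorensteinLinked 𝒜 I.1 J.1 c := by
    funext I J
    exact propext (exists_congr fun c => and_congr_right fun hc =>
      idealsSmLinked_iff h𝒜 hR I.2.1 J.2.1 hc I.2.2 J.2.2)
  rw [SmLiaison, h]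
  rfl

end GradedLiaison

theorem mainTheorem12 :
    (∀ (R : Type u) [CommRing R] [IsLocalRing R], IsGorensteinLocalRing R →
      (∀ I J c : Ideal R, I ≠ ⊤ → J ≠ ⊤ →
        (LocalLiaison.SmLinked I J c ↔
          LocalLiaison.IsGorensteinIdeal c ∧
            c.colon (I : Set R) = J ∧ c.colon (J : Set R) = I)) ∧
      (∀ I J : {I : Ideal R // I ≠ ⊤},
        LocalLiaison.SmLiaison I J ↔ LocalLiaison.GorensteinLiaison I J)) ∧
    (∀ (K : Type v) (R : Type u) [Field K] [CommRing R] [Algebra K R]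
      (𝒜 : ℤ → Submodule K R) [GradedAlgebra 𝒜],
      GradedLiaison.IsStandardGraded 𝒜 → IsGorensteinRing R →
      (∀ I J c : Ideal R, I.IsHomogeneous 𝒜 → J.IsHomogeneous 𝒜 → c.IsHomogeneous 𝒜 →
        I ≠ ⊤ → J ≠ ⊤ →
        (GradedLiaison.IdealsSmLinked 𝒜 I J c ↔
          GradedLiaison.IsGorensteinIdeal 𝒜 c ∧
            c.colon (I : Set R) = J ∧ c.colon (J : Set R) = I)) ∧
      (∀ I J : GradedLiaison.ProperHomogeneousIdeal 𝒜,
        GradedLiaison.SmLiaison 𝒜 I J ↔ GradedLiaison.GorensteinLiaison 𝒜 I J)) := by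
  refine ⟨fun R _ _ hR => ⟨fun I J c hI hJ => LocalLiaison.smLinked_iff hR hI hJ,
    LocalLiaison.smLiaison_iff hR⟩, fun K R _ _ _ 𝒜 _ h𝒜 hR =>
    ⟨fun I J c hI' hJ' hc hI hJ => GradedLiaison.idealsSmLinked_iff h𝒜 hR hI' hJ' hc hI hJ,
      GradedLiaison.smLiaison_iff h𝒜 hR⟩⟩
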